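/- Let $d\ge 3$, $0<\alpha\le d$, $I=[0,1]$, and let $\gamma:I\to\mathbb R^d$ be a $C^{d+1}$ curve with $\det(\gamma'(t),\gamma''(t),\dots,\gamma^{(d)}(t))\ne0$ for all $t\in I$. Write $[x]$ for the integer part of $x\ge 0$, and for $1\le j\le d$ and $0<s\le j$ put $$\beta_j(s)=([j-s]+1)\,s+\frac{(j-1-[j-s])(j-[j-s])}{2}.$$ Let $\ell$ be an integer with $0\le\ell\le d-1-[d-\alpha]$, and let $1\le p,q\le\infty$ satisfy $$\frac{d-\ell}{q}+\frac1p\le1,\qquad q\ge2(d-\ell),\qquad \frac{\beta_{d-\ell}(\alpha-\ell)}{q}+\frac1p<1,\qquad q>\beta_{d-\ell}(\alpha-\ell)+1 .$$ Then there is a constant $C$, depending only on $d,\alpha,\ell,\gamma,p,q$, such that the following holds. Let $\mu$ be a positive Borel measure on $\mathbb R^d$ supported in the unit ball $B(0,1)$ for which there is $C_\mu<\infty$ with $\mu(B(x,r))\le C_\mu r^\alpha$ for all $x\in\mathbb R^d$, $r>0$, and put $\langle\mu\rangle_\alpha=\sup_{x\in\mathbb R^d,\,r>0}r^{-\alpha}\mu(B(x,r))$.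 Let $a:\mathbb R^d\to\mathbb C$ be a measurable function supported in $B(0,1)$ with $\sup_x|a(x)|\le1$, let $\lambda\ge1$, and let $$\mathcal E^\gamma_\lambda f(x)=a(x)\int_I e^{i\lambda x\cdot\gamma(t)}f(t)\,dt .$$ Then for all $f\in L^p(I)$, $$\|\mathcal E^\gamma_\lambda f\|_{L^q(d\mu)}\le C\,\langle\mu\rangle_\alpha^{1/q}\,\lambda^{-(\alpha-\ell)/q}\,\|f\|_{L^p(I)} .$$ -/

import Mathlib

open MeasureTheory Set
open scoped ENNReal NNReal

noncomputable section

/-- The curve `γ : [0,1] → ℝ^d` is of class `C^{d+1}` on `[0,1]` (with one-sided derivatives at the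
endpoints) and `det(γ'(t), γ''(t), …, γ^{(d)}(t)) ≠ 0` for every `t ∈ [0,1]`. -/
structure IsNondegenerateCurve {d : ℕ} (γ : ℝ → EuclideanSpace ℝ (Fin d)) : Prop where
  contDiffOn : ContDiffOn ℝ ((d + 1 : ℕ) : WithTop ℕ∞) γ (Icc (0 : ℝ) 1)
  det_ne_zero : ∀ t ∈ Icc (0 : ℝ) 1,
    (Matrix.of fun i j : Fin d =>
      iteratedDerivWithin ((j : ℕ) + 1) γ (Icc (0 : ℝ) 1) t i).det ≠ 0

/-- The growth condition `μ(B(x,r)) ≤ C_μ r^α` for all `x` and all `r > 0`. -/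
def HasGrowth {d : ℕ} (α : ℝ) (μ : Measure (EuclideanSpace ℝ (Fin d))) : Prop :=
  ∃ Cμ : ℝ≥0, ∀ (x : EuclideanSpace ℝ (Fin d)) (r : ℝ), 0 < r →
    μ (Metric.ball x r) ≤ (Cμ : ℝ≥0∞) * ENNReal.ofReal (r ^ α)

/-- `⟨μ⟩_α = sup_{x, r > 0} r^{-α} μ(B(x,r))`. -/
def growthConst {d : ℕ} (α : ℝ) (μ : Measure (EuclideanSpace ℝ (Fin d))) : ℝ≥0∞ :=
  ⨆ (x : EuclideanSpace ℝ (Fin d)) (r : ℝ) (_ : 0 < r),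
    ENNReal.ofReal (r ^ (-α)) * μ (Metric.ball x r)

/-- `β_j(α) = ([j-α]+1) α + (j-1-[j-α]) (j-[j-α]) / 2`, where `0 < α ≤ j`. -/
def betaExp (j : ℕ) (α : ℝ) : ℝ :=
  ((⌊(j : ℝ) - α⌋₊ : ℝ) + 1) * α
    + ((j : ℝ) - 1 - (⌊(j : ℝ) - α⌋₊ : ℝ)) * ((j : ℝ) - (⌊(j : ℝ) - α⌋₊ : ℝ)) / 2

/-- The oscillatory integral operator
`E f (x) = a(x) ∫_{[0,1]} exp(i lam x·γ(t)) f(t) dt`. -/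
def oscOp {d : ℕ} (γ : ℝ → EuclideanSpace ℝ (Fin d)) (a : EuclideanSpace ℝ (Fin d) → ℂ)
    (lam : ℝ) (f : ℝ → ℂ) (x : EuclideanSpace ℝ (Fin d)) : ℂ :=
  a x * ∫ t in Icc (0 : ℝ) 1,
    Complex.exp (Complex.I * ((lam * inner ℝ x (γ t) : ℝ) : ℂ)) * f t

end

/-! ### Orthogonality of exponentials and a Bessel inequality after a change of variables. -/

section TrigPolynomials

/-! Put k = d − ℓ and β = β_k(α − ℓ). The core is a k-linear estimate. Over k separated short pieces
of an interval of length h, the product of the k extension operators is one oscillatory integral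
over a box in ℝ^k with phase x·(γ(t_1) + … + γ(t_k)). In coordinates dual to γ'(a), …, γ^(d)(a),
after anisotropic rescaling, γ is C¹-close to the moment curve
(`IsNondegenerateCurve.exists_frame`), so by Vandermonde the first k coordinates of the sum form an
injective map with Jacobian bounded below (`sumMap_box`). Bessel's inequality over a frequency
lattice then handles k of the d frequency directions, the other ℓ are merely counted, and a Taylor
expansion passes from lattice points to whole cells (`lintegral_sq_oscillatory_le`).

What remains is geometric: the μ-mass of an anisotropic cell times the number of cells in the ℓ free
directions is O(⟨μ⟩_α λ^{-(α-ℓ)} h^{-β}) (`exists_cell_bound`). Cells are covered by cubes of side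
about λ^{-1} h^{-j}. Direction e ≤ k costs h^{-(e-j)_+} cubes and each free direction one inverse
side, so h appears to the power −j(α−ℓ) − Σ_{e≤k} (e−j)_+. The choice j = [d−α] + 1 is the most
economical, and gives exactly −β.

Interpolating with the trivial L¹ → L^∞ bound gives L^{r'} → L^r for the k-fold integral. With q =
kr, the condition q ≥ 2k says r ≥ 2, and k/q + 1/p ≤ 1 says r' ≤ p.

The linear bound follows by a broad/narrow induction on scales. Cut an interval of length h into N
equal parts. At each x, either one part dominates the whole up to the factor 6k, which is
independent of N, or k non-adjacent parts are each comparable to the whole up to 2N, and the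
k-linear estimate applies (`exists_narrow_or_broad`). The target bound carries h^θ with θ = q(1 −
1/p) − β > 0, so passing to length h/N gains N^{-θ}, which beats (6k)^q for a fixed large N. Summing
over the parts uses p ≤ q. The descent ends where Hölder's inequality and the total mass of μ
suffice, with a constant independent of the number of steps
(`IsNondegenerateCurve.exists_local_bound`). Exponents p > q reduce to p = q because [0,1] has
measure one; here q > β + 1 is needed. -/

theorem integral_exp_int_mul (m : ℤ) :
    ∫ θ in Icc (-Real.pi) Real.pi, Complex.exp (Complex.I * ((m * θ : ℝ) : ℂ))
      = if m = 0 then (2 * Real.pi : ℂ) else 0 := by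
  rw [integral_Icc_eq_integral_Ioc, ← intervalIntegral.integral_of_le (by linarith [Real.pi_pos])]
  split_ifs with h
  · subst h
    simp
    ring
  · have hc : (Complex.I * (m : ℂ)) ≠ 0 := by simp [h]
    have e : ∀ θ : ℝ, Complex.exp (Complex.I * ((m * θ : ℝ) : ℂ))
        = Complex.exp ((Complex.I * (m : ℂ)) * (θ : ℂ)) := by
      intro θ; congr 1; push_cast; ring
    simp_rw [e]
    rw [integral_exp_mul_complex hc]
    have : Complex.exp (Complex.I * (m : ℂ) * ((Real.pi : ℝ) : ℂ))
        = Complex.exp (Complex.I * (m : ℂ) * ((-Real.pi : ℝ) : ℂ)) := by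
      rw [Complex.exp_eq_exp_iff_exists_int]
      exact ⟨m, by push_cast; ring⟩
    rw [this, sub_self, zero_div]

variable {ι : Type*} [Fintype ι]

theorem integral_exp_int_dot [DecidableEq ι] (m : ι → ℤ) :
    ∫ θ in Set.pi univ (fun _ : ι => Icc (-Real.pi) Real.pi),
        Complex.exp (Complex.I * ((∑ j, m j * θ j : ℝ) : ℂ))
      = if m = 0 then ((2 * Real.pi) ^ Fintype.card ι : ℂ) else 0 := by
  rw [volume_pi, Measure.restrict_pi_pi]
  have e : ∀ θ : ι → ℝ, Complex.exp (Complex.I * ((∑ j, m j * θ j : ℝ) : ℂ))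
      = ∏ j, Complex.exp (Complex.I * ((m j * θ j : ℝ) : ℂ)) := by
    intro θ
    rw [← Complex.exp_sum]
    congr 1
    push_cast
    rw [Finset.mul_sum]
  simp_rw [e]
  rw [integral_fintype_prod_eq_prod (𝕜 := ℂ)
    (f := fun j (t : ℝ) => Complex.exp (Complex.I * ((m j * t : ℝ) : ℂ)))]
  simp_rw [integral_exp_int_mul]
  split_ifs with h
  · subst h
    simp
  · obtain ⟨j, hj⟩ : ∃ j, m j ≠ 0 := by
      by_contra! hc
      exact h (funext hc)
    exact Finset.prod_eq_zero (Finset.mem_univ j) (by simp [hj])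

theorem continuous_exp_dot (m : ι → ℝ) :
    Continuous fun θ : ι → ℝ => Complex.exp (Complex.I * ((∑ j, m j * θ j : ℝ) : ℂ)) := by
  fun_prop

theorem norm_exp_I_mul (x : ℝ) : ‖Complex.exp (Complex.I * (x : ℂ))‖ = 1 := by
  rw [mul_comm, Complex.norm_exp_ofReal_mul_I]

theorem conj_exp_I_mul (x : ℝ) :
    (starRingEnd ℂ) (Complex.exp (Complex.I * (x : ℂ))) = Complex.exp (Complex.I * ((-x : ℝ) : ℂ)) := by
  rw [← Complex.exp_conj]
  simp

theorem integral_normSq_trigPoly (S : Finset (ι → ℤ)) (b : (ι → ℤ) → ℂ) :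
    ∫ θ in Set.pi univ (fun _ : ι => Icc (-Real.pi) Real.pi),
        ‖∑ n ∈ S, b n * Complex.exp (Complex.I * ((∑ j, n j * θ j : ℝ) : ℂ))‖ ^ 2
      = (2 * Real.pi) ^ Fintype.card ι * ∑ n ∈ S, ‖b n‖ ^ 2 := by
  classical
  have hcomp : IsCompact (Set.pi univ (fun _ : ι => Icc (-Real.pi) Real.pi)) :=
    isCompact_univ_pi fun _ => isCompact_Icc
  have key : (∫ θ in Set.pi univ (fun _ : ι => Icc (-Real.pi) Real.pi),
        ((‖∑ n ∈ S, b n * Complex.exp (Complex.I * ((∑ j, n j * θ j : ℝ) : ℂ))‖ ^ 2 : ℝ) : ℂ))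
      = (((2 * Real.pi) ^ Fintype.card ι * ∑ n ∈ S, ‖b n‖ ^ 2 : ℝ) : ℂ) := by
    have e : ∀ θ : ι → ℝ,
        ((‖∑ n ∈ S, b n * Complex.exp (Complex.I * ((∑ j, n j * θ j : ℝ) : ℂ))‖ ^ 2 : ℝ) : ℂ)
        = ∑ n ∈ S, ∑ m ∈ S, (b n * (starRingEnd ℂ) (b m)) *
            Complex.exp (Complex.I * ((∑ j, ((n - m) j : ℤ) * θ j : ℝ) : ℂ)) := by
      intro θ
      push_cast
      rw [← Complex.mul_conj', map_sum, Finset.sum_mul_sum]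
      refine Finset.sum_congr rfl fun n _ => Finset.sum_congr rfl fun m _ => ?_
      have h1 := conj_exp_I_mul (∑ j, m j * θ j)
      push_cast at h1
      rw [map_mul, h1]
      have h2 : Complex.exp (Complex.I * ∑ j, ((n j : ℂ) - (m j : ℂ)) * (θ j : ℂ))
          = Complex.exp (Complex.I * ∑ j, (n j : ℂ) * (θ j : ℂ))
            * Complex.exp (Complex.I * -∑ j, (m j : ℂ) * (θ j : ℂ)) := by
        rw [← Complex.exp_add]
        congr 1
        simp_rw [sub_mul]
        rw [Finset.sum_sub_distrib]
        ring
      simp only [Pi.sub_apply, Int.cast_sub] at *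
      rw [h2]
      ring
    simp_rw [e]
    have hint : ∀ n m : ι → ℤ, IntegrableOn (fun θ : ι → ℝ => (b n * (starRingEnd ℂ) (b m)) *
            Complex.exp (Complex.I * ((∑ j, ((n - m) j : ℤ) * θ j : ℝ) : ℂ)))
            (Set.pi univ (fun _ : ι => Icc (-Real.pi) Real.pi)) := fun n m =>
      ContinuousOn.integrableOn_compact hcomp
        ((continuous_const.mul (continuous_exp_dot fun j => ((n - m) j : ℝ))).continuousOn)
    rw [integral_finsetSum _ fun n _ => integrable_finsetSum _ fun m _ => hint n m]
    simp_rw [integral_finsetSum _ fun m (_ : m ∈ S) => hint _ m, integral_const_mul,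
      integral_exp_int_dot, sub_eq_zero]
    push_cast
    rw [Finset.mul_sum]
    refine Finset.sum_congr rfl fun n hn => ?_
    simp only [mul_ite, mul_zero]
    rw [Finset.sum_ite_eq S n, if_pos hn, Complex.mul_conj']
    ring
  rw [integral_complex_ofReal] at key
  exact_mod_cast key

/-- Bessel's inequality for the exponentials `exp (i n·Θ(s))` on a set where `Θ` is injective with
Jacobian bounded below. -/
theorem bessel_comp {Θ : (ι → ℝ) → ι → ℝ} {Θ' : (ι → ℝ) → (ι → ℝ) →L[ℝ] (ι → ℝ)}
    {B : Set (ι → ℝ)} (hB : MeasurableSet B)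
    (hd : ∀ s ∈ B, HasFDerivWithinAt Θ (Θ' s) B s) (hinj : InjOn Θ B)
    {c : ℝ} (hc : 0 < c) (hdet : ∀ s ∈ B, c ≤ |(Θ' s).det|)
    (hmaps : ∀ s ∈ B, ∀ j, Θ s j ∈ Icc (-Real.pi) Real.pi)
    {F : (ι → ℝ) → ℂ} (hF : IntegrableOn F B) (S : Finset (ι → ℤ)) :
    ∑ n ∈ S, ‖∫ s in B, Complex.exp (Complex.I * ((∑ j, n j * Θ s j : ℝ) : ℂ)) * F s‖ₑ ^ 2
      ≤ ENNReal.ofReal ((2 * Real.pi) ^ Fintype.card ι / c) * ∫⁻ s in B, ‖F s‖ₑ ^ 2 := by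
  classical
  set β : (ι → ℤ) → ℂ := fun n =>
    ∫ s in B, Complex.exp (Complex.I * ((∑ j, n j * Θ s j : ℝ) : ℂ)) * F s with hβ
  set P : (ι → ℝ) → ℂ := fun θ =>
    ∑ n ∈ S, (starRingEnd ℂ) (β n) * Complex.exp (Complex.I * ((∑ j, n j * θ j : ℝ) : ℂ)) with hP
  have hPc : Continuous P := by
    refine continuous_finsetSum _ fun n _ => continuous_const.mul ?_
    exact continuous_exp_dot fun j => (n j : ℝ)
  have hΘm : AEMeasurable Θ (volume.restrict B) := by
    have : ContinuousOn Θ B := fun s hs => (hd s hs).continuousWithinAt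
    exact this.aemeasurable hB
  have hPm : AEMeasurable (fun s => P (Θ s)) (volume.restrict B) :=
    hPc.measurable.comp_aemeasurable hΘm
  set T2 : ℝ := ∑ n ∈ S, ‖β n‖ ^ 2 with hT2
  have hTnn : 0 ≤ T2 := Finset.sum_nonneg fun _ _ => sq_nonneg _
  have hTe : ∑ n ∈ S, ‖β n‖ₑ ^ 2 = ENNReal.ofReal T2 := by
    rw [hT2, ENNReal.ofReal_sum_of_nonneg fun _ _ => sq_nonneg _]
    refine Finset.sum_congr rfl fun n _ => ?_
    rw [ENNReal.ofReal_pow (norm_nonneg _), ofReal_norm]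
  change ∑ n ∈ S, ‖β n‖ₑ ^ 2 ≤ _
  have hexpint : ∀ n : ι → ℤ, IntegrableOn
      (fun s => Complex.exp (Complex.I * ((∑ j, n j * Θ s j : ℝ) : ℂ)) * F s) B := by
    intro n
    refine hF.bdd_mul (c := 1) ?_ (Filter.Eventually.of_forall fun s => (norm_exp_I_mul _).le)
    exact ((continuous_exp_dot fun j => (n j : ℝ)).measurable.comp_aemeasurable
      hΘm).aestronglyMeasurable
  -- duality
  have hdual : ((T2 : ℝ) : ℂ) = ∫ s in B, P (Θ s) * F s := by
    have e : ∀ s, P (Θ s) * F s = ∑ n ∈ S, (starRingEnd ℂ) (β n) *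
        (Complex.exp (Complex.I * ((∑ j, n j * Θ s j : ℝ) : ℂ)) * F s) := by
      intro s
      simp only [hP]
      rw [Finset.sum_mul]
      exact Finset.sum_congr rfl fun n _ => mul_assoc _ _ _
    simp_rw [e]
    rw [integral_finsetSum _ fun n _ => (hexpint n).const_mul _]
    simp_rw [integral_const_mul]
    rw [hT2]
    push_cast
    refine Finset.sum_congr rfl fun n _ => ?_
    rw [← Complex.conj_mul']
    simp only [hβ]
    push_cast
    rfl
  -- The change of variables θ = Θ(s) costs 1/c. Its image lies in one period cube, where
  -- orthogonality evaluates the integral of |P|² in terms of `T2` itself.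
  have hP2 : ∫⁻ s in B, ‖P (Θ s)‖ₑ ^ 2
      ≤ ENNReal.ofReal ((2 * Real.pi) ^ Fintype.card ι / c) * ENNReal.ofReal T2 := by
    have h1 : ∫⁻ s in B, ENNReal.ofReal c * ‖P (Θ s)‖ₑ ^ 2
        ≤ ∫⁻ s in B, ENNReal.ofReal |(Θ' s).det| * ‖P (Θ s)‖ₑ ^ 2 := by
      refine setLIntegral_mono' hB fun s hs => ?_
      gcongr
      exact hdet s hs
    rw [← lintegral_image_eq_lintegral_abs_det_fderiv_mul volume hB hd hinj
      (fun θ => ‖P θ‖ₑ ^ 2)] at h1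
    have h2 : ∫⁻ θ in Θ '' B, ‖P θ‖ₑ ^ 2
        ≤ ∫⁻ θ in Set.pi univ (fun _ : ι => Icc (-Real.pi) Real.pi), ‖P θ‖ₑ ^ 2 := by
      refine lintegral_mono_set ?_
      rintro _ ⟨s, hs, rfl⟩ j _
      exact hmaps s hs j
    have h3 : ∫⁻ θ in Set.pi univ (fun _ : ι => Icc (-Real.pi) Real.pi), ‖P θ‖ₑ ^ 2
        = ENNReal.ofReal ((2 * Real.pi) ^ Fintype.card ι * T2) := by
      have := integral_normSq_trigPoly S (fun n => (starRingEnd ℂ) (β n))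
      simp only [RCLike.norm_conj] at this
      rw [← hT2] at this
      rw [← this, ofReal_integral_eq_lintegral_ofReal]
      · refine lintegral_congr fun θ => ?_
        rw [ENNReal.ofReal_pow (norm_nonneg _), ofReal_norm]
      · exact ContinuousOn.integrableOn_compact (isCompact_univ_pi fun _ => isCompact_Icc)
          ((hPc.norm.pow 2).continuousOn)
      · exact Filter.Eventually.of_forall fun _ => sq_nonneg _
    rw [lintegral_const_mul' _ _ ENNReal.ofReal_ne_top] at h1
    have h4 := (h1.trans h2).trans_eq h3
    have hc' : ENNReal.ofReal c ≠ 0 := by simpa using hc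
    rw [mul_comm, ← ENNReal.le_div_iff_mul_le (Or.inl hc') (Or.inl ENNReal.ofReal_ne_top)] at h4
    refine h4.trans_eq ?_
    rw [← ENNReal.ofReal_div_of_pos hc, ← ENNReal.ofReal_mul (by positivity)]
    congr 1
    ring
  have hCS : ENNReal.ofReal T2 ≤ (∫⁻ s in B, ‖P (Θ s)‖ₑ ^ 2) ^ (1 / 2 : ℝ)
      * (∫⁻ s in B, ‖F s‖ₑ ^ 2) ^ (1 / 2 : ℝ) := by
    have h1 : ENNReal.ofReal T2 ≤ ∫⁻ s in B, ‖P (Θ s) * F s‖ₑ := by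
      refine le_trans (le_of_eq ?_) (enorm_integral_le_lintegral_enorm _)
      rw [← hdual, ← ofReal_norm, Complex.norm_real, Real.norm_of_nonneg hTnn]
    simp_rw [enorm_mul] at h1
    have h2 := ENNReal.lintegral_mul_le_Lp_mul_Lq (volume.restrict B)
      (Real.HolderConjugate.two_two) hPm.enorm hF.aestronglyMeasurable.enorm
    simp only [Pi.mul_apply, ENNReal.rpow_two] at h2
    exact h1.trans h2
  have hsq : ENNReal.ofReal T2 ^ 2 ≤ (∫⁻ s in B, ‖P (Θ s)‖ₑ ^ 2) * (∫⁻ s in B, ‖F s‖ₑ ^ 2) := by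
    refine (pow_le_pow_left' hCS 2).trans_eq ?_
    rw [mul_pow, ← ENNReal.rpow_natCast, ← ENNReal.rpow_mul, ← ENNReal.rpow_natCast,
      ← ENNReal.rpow_mul]
    norm_num
  rw [hTe]
  -- The inequality so far is quadratic in `T2` on the left and linear on the right. `T2` is finite
  -- because `S` is, so one factor cancels once it is nonzero.
  rcases eq_or_ne (ENNReal.ofReal T2) 0 with h0 | h0
  · rw [h0]; exact zero_le
  have := hsq.trans (mul_le_mul_left hP2 _)
  rw [pow_two, mul_right_comm] at this
  exact (ENNReal.mul_le_mul_iff_left h0 ENNReal.ofReal_ne_top).1 this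

end TrigPolynomials

/-! ### Sums of k points on a curve close to the moment curve. -/

section SumMap

/-- Up to the row factors 1/j! this is a transposed Vandermonde matrix. -/
theorem det_moment_ne_zero {k : ℕ} (s : Fin k → ℝ) (hs : Function.Injective s) :
    (Matrix.of fun j i : Fin k => s i ^ (j : ℕ) / ((j : ℕ).factorial : ℝ)).det ≠ 0 := by
  have e : (Matrix.of fun j i : Fin k => s i ^ (j : ℕ) / ((j : ℕ).factorial : ℝ))
      = Matrix.of fun j i : Fin k =>
        (((j : ℕ).factorial : ℝ)⁻¹) * (Matrix.vandermonde s).transpose j i := by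
    ext j i
    simp [Matrix.vandermonde_apply, div_eq_inv_mul]
  rw [e, Matrix.det_mul_column, Matrix.det_transpose]
  refine mul_ne_zero (Finset.prod_ne_zero_iff.2 fun j _ => by positivity) ?_
  exact Matrix.det_vandermonde_ne_zero_iff.2 hs

/-- Matrices close to a Vandermonde-type matrix with separated nodes have determinant bounded
away from zero. -/
theorem exists_det_stable (k : ℕ) {δ : ℝ} (hδ : 0 < δ) :
    ∃ η > 0, ∃ c > 0, ∀ s : Fin k → ℝ, (∀ i, s i ∈ Icc (0 : ℝ) 1) →
      (∀ i j, i ≠ j → δ ≤ |s i - s j|) → ∀ W : Fin k → Fin k → ℝ,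
      (∀ j i, |W j i - s i ^ (j : ℕ) / ((j : ℕ).factorial : ℝ)| ≤ η) →
      c ≤ |(Matrix.of W).det| := by
  set K : Set (Fin k → ℝ) := (Set.pi univ fun _ => Icc (0 : ℝ) 1) ∩
    ⋂ i, ⋂ j, ⋂ (_ : i ≠ j), {s | δ ≤ |s i - s j|} with hK
  have hKc : IsCompact K := by
    refine (isCompact_univ_pi fun _ => isCompact_Icc).inter_right ?_
    refine isClosed_iInter fun i => isClosed_iInter fun j => isClosed_iInter fun _ => ?_
    exact isClosed_le continuous_const (by fun_prop)
  set V : (Fin k → ℝ) → Fin k → Fin k → ℝ :=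
    fun s j i => s i ^ (j : ℕ) / ((j : ℕ).factorial : ℝ) with hV
  have hVc : Continuous V := by
    simp only [hV]
    fun_prop
  have hdetc : Continuous fun W : Fin k → Fin k → ℝ => (Matrix.of W).det :=
    Continuous.matrix_det (A := fun W : Fin k → Fin k → ℝ => Matrix.of W) continuous_id
  have hopen : IsOpen {W : Fin k → Fin k → ℝ | (Matrix.of W).det ≠ 0} :=
    isOpen_ne_fun hdetc continuous_const
  have hsub : V '' K ⊆ {W : Fin k → Fin k → ℝ | (Matrix.of W).det ≠ 0} := by
    rintro _ ⟨s, hs, rfl⟩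
    refine det_moment_ne_zero s fun i j hij => ?_
    by_contra hne
    have := hs.2
    simp only [mem_iInter, mem_ofPred_eq] at this
    have h := this i j hne
    rw [hij, sub_self, abs_zero] at h
    linarith
  -- Nonvanishing of the determinant is an open condition on a compact set of matrices, so it
  -- persists on a closed η-neighbourhood. That neighbourhood is again compact, and c is the minimum
  -- of |det| there.
  obtain ⟨η, hη, hηsub⟩ := (hKc.image hVc).exists_cthickening_subset_open hopen hsub
  have hTc : IsCompact (Metric.cthickening η (V '' K)) := (hKc.image hVc).cthickening
  obtain ⟨c, hc, hcle⟩ : ∃ c > 0, ∀ W ∈ Metric.cthickening η (V '' K),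
      c ≤ |(Matrix.of W).det| := by
    rcases (Metric.cthickening η (V '' K)).eq_empty_or_nonempty with he | hne
    · exact ⟨1, one_pos, by simp [he]⟩
    · obtain ⟨W0, hW0, hmin⟩ := hTc.exists_isMinOn hne (hdetc.abs.continuousOn)
      exact ⟨_, abs_pos.2 (hηsub hW0), fun W hW => hmin hW⟩
  refine ⟨η, hη, c, hc, fun s hs hsep W hW => hcle W ?_⟩
  refine Metric.mem_cthickening_of_dist_le W (V s) η _ ⟨s, ⟨fun i _ => hs i, ?_⟩, rfl⟩ ?_
  · simp only [mem_iInter, mem_ofPred_eq]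
    exact hsep
  · refine (dist_pi_le_iff hη.le).2 fun j => (dist_pi_le_iff hη.le).2 fun i => ?_
    rw [Real.dist_eq]
    exact hW j i

/-- Telescoping gives the Lipschitz constant j for t^j, and j ≤ j! absorbs it, so the bound is
uniform in j. -/
theorem abs_pow_div_factorial_sub_le {s t : ℝ} (hs : s ∈ Icc (0 : ℝ) 1) (ht : t ∈ Icc (0 : ℝ) 1)
    (j : ℕ) : |t ^ j / (j.factorial : ℝ) - s ^ j / (j.factorial : ℝ)| ≤ |t - s| := by
  have h : |t ^ j - s ^ j| ≤ j * |t - s| := by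
    induction j with
    | zero => simp
    | succ j ih =>
      have e : t ^ (j + 1) - s ^ (j + 1) = t * (t ^ j - s ^ j) + (t - s) * s ^ j := by ring
      rw [e]
      refine (abs_add_le _ _).trans ?_
      rw [abs_mul, abs_mul, abs_of_nonneg ht.1, abs_of_nonneg (pow_nonneg hs.1 j)]
      have h1 : t * |t ^ j - s ^ j| ≤ 1 * |t ^ j - s ^ j| := by gcongr; exact ht.2
      have h2 : |t - s| * s ^ j ≤ |t - s| * 1 := by gcongr; exact pow_le_one₀ hs.1 hs.2
      push_cast
      linarith
  have hj : (j : ℝ) ≤ j.factorial := by exact_mod_cast Nat.self_le_factorial j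
  have hf : (0 : ℝ) < j.factorial := by positivity
  rw [← sub_div, abs_div, abs_of_pos hf, div_le_iff₀ hf]
  nlinarith [abs_nonneg (t - s)]

/-- The map `s ↦ ∑ i, g (s i)` from `ℝ^k` to `ℝ^k`. -/
def sumMap {k : ℕ} (g : ℝ → Fin k → ℝ) (s : Fin k → ℝ) : Fin k → ℝ :=
  fun j => ∑ i, g (s i) j

/-- The derivative of `sumMap`. -/
noncomputable def sumMapDeriv {k : ℕ} (g' : ℝ → Fin k → ℝ) (s : Fin k → ℝ) :
    (Fin k → ℝ) →L[ℝ] (Fin k → ℝ) :=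
  LinearMap.toContinuousLinearMap (Matrix.toLin' (Matrix.of fun j i => g' (s i) j))

theorem det_sumMapDeriv {k : ℕ} (g' : ℝ → Fin k → ℝ) (s : Fin k → ℝ) :
    (sumMapDeriv g' s).det = (Matrix.of fun j i => g' (s i) j).det := by
  rw [sumMapDeriv, ContinuousLinearMap.det, LinearMap.coe_toContinuousLinearMap,
    LinearMap.det_toLin']

theorem hasFDerivWithinAt_sumMap {k : ℕ} {g g' : ℝ → Fin k → ℝ} {B : Set (Fin k → ℝ)}
    {J : Fin k → Set ℝ} (hB : ∀ s ∈ B, ∀ i, s i ∈ J i) {s : Fin k → ℝ}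
    (hg : ∀ i j, HasDerivWithinAt (fun t => g t j) (g' (s i) j) (J i) (s i)) :
    HasFDerivWithinAt (sumMap g) (sumMapDeriv g' s) B s := by
  rw [hasFDerivWithinAt_pi']
  intro j
  have h : HasFDerivWithinAt (fun s : Fin k → ℝ => ∑ i, g (s i) j)
      (∑ i, g' (s i) j • (ContinuousLinearMap.proj i : (Fin k → ℝ) →L[ℝ] ℝ)) B s := by
    refine HasFDerivWithinAt.fun_sum fun i _ => ?_
    exact HasDerivWithinAt.comp_hasFDerivWithinAt (f := fun u : Fin k → ℝ => u i) s (hg i j)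
      (hasFDerivWithinAt_apply i s B) (fun u hu => hB u hu i)
  refine h.congr_fderiv ?_
  ext v
  simp [sumMapDeriv, Matrix.mulVec, dotProduct]

theorem exists_slope {g g' : ℝ → ℝ}
    (hg : ∀ s ∈ Icc (0 : ℝ) 1, HasDerivWithinAt g (g' s) (Icc 0 1) s) {a b : ℝ} (ha : 0 ≤ a)
    (hb : b ≤ 1) {u v : ℝ} (hu : u ∈ Ioc a b) (hv : v ∈ Ioc a b) :
    ∃ ξ ∈ Ioc a b, g u - g v = g' ξ * (u - v) := by
  wlog huv : v ≤ u generalizing u v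
  · obtain ⟨ξ, h1, h2⟩ := this hv hu (le_of_not_ge huv)
    exact ⟨ξ, h1, by linarith⟩
  rcases huv.eq_or_lt with rfl | hlt
  · exact ⟨v, hv, by simp⟩
  have hsub : Icc v u ⊆ Icc (0 : ℝ) 1 := Icc_subset_Icc (ha.trans hv.1.le) (hu.2.trans hb)
  obtain ⟨ξ, hξ, h⟩ := exists_hasDerivAt_eq_slope g g' hlt
    (fun s hs => ((hg s (hsub hs)).continuousWithinAt).mono hsub)
    (fun s hs => (hg s (hsub (Ioo_subset_Icc_self hs))).hasDerivAt
      (Icc_mem_nhds (by linarith [hs.1, hv.1]) (by linarith [hs.2, hu.2])))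
  refine ⟨ξ, ⟨hv.1.trans hξ.1, hξ.2.le.trans hu.2⟩, ?_⟩
  rw [h]
  field_simp [sub_ne_zero.2 hlt.ne']

/-- If `g` is `C¹`-close to the moment curve, `sumMap g` is injective with Jacobian bounded below
on small boxes with separated sides. -/
theorem sumMap_box {k : ℕ} {δ η c : ℝ}
    (hstab : ∀ s : Fin k → ℝ, (∀ i, s i ∈ Icc (0 : ℝ) 1) →
      (∀ i j, i ≠ j → δ ≤ |s i - s j|) → ∀ W : Fin k → Fin k → ℝ,
      (∀ j i, |W j i - s i ^ (j : ℕ) / ((j : ℕ).factorial : ℝ)| ≤ η) →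
      c ≤ |(Matrix.of W).det|) (hc : 0 < c)
    {g g' : ℝ → Fin k → ℝ}
    (hg : ∀ j, ∀ s ∈ Icc (0 : ℝ) 1, HasDerivWithinAt (fun t => g t j) (g' s j) (Icc 0 1) s)
    (hg' : ∀ j : Fin k, ∀ s ∈ Icc (0 : ℝ) 1,
      |g' s j - s ^ (j : ℕ) / ((j : ℕ).factorial : ℝ)| ≤ η / 2)
    {s₀ : Fin k → ℝ} {τ : ℝ} (hτ : τ ≤ η / 2) (hs₀ : ∀ i, 0 ≤ s₀ i) (hs₁ : ∀ i, s₀ i + τ ≤ 1)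
    (hτ0 : 0 ≤ τ) (hsep : ∀ i j, i ≠ j → δ ≤ |s₀ i - s₀ j|) :
    InjOn (sumMap g) (Set.pi univ fun i => Ioc (s₀ i) (s₀ i + τ)) ∧
    (∀ s ∈ Set.pi univ fun i => Ioc (s₀ i) (s₀ i + τ), c ≤ |(sumMapDeriv g' s).det|) ∧
    (∀ s ∈ Set.pi univ fun i => Ioc (s₀ i) (s₀ i + τ),
      HasFDerivWithinAt (sumMap g) (sumMapDeriv g' s)
        (Set.pi univ fun i => Ioc (s₀ i) (s₀ i + τ)) s) := by
  have h01 : ∀ i, s₀ i ∈ Icc (0 : ℝ) 1 := fun i => ⟨hs₀ i, by linarith [hs₁ i]⟩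
  have hsub : ∀ i, Ioc (s₀ i) (s₀ i + τ) ⊆ Icc (0 : ℝ) 1 := fun i t ht =>
    ⟨(hs₀ i).trans ht.1.le, ht.2.trans (hs₁ i)⟩
  -- The nodes depend on the row j as well as on i, because the mean value theorem is applied
  -- coordinate by coordinate. One half of η pays for replacing `g'` by the moment curve, the other
  -- for moving the nodes to the corner `s₀`.
  have hW : ∀ ξ : Fin k → Fin k → ℝ, (∀ j i, ξ j i ∈ Ioc (s₀ i) (s₀ i + τ)) →
      c ≤ |(Matrix.of fun j i => g' (ξ j i) j).det| := by
    intro ξ hξ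
    refine hstab s₀ h01 hsep _ fun j i => ?_
    have h1 := hg' j (ξ j i) (hsub i (hξ j i))
    have h2 := abs_pow_div_factorial_sub_le (h01 i) (hsub i (hξ j i)) j
    have h3 : |ξ j i - s₀ i| ≤ τ := by
      rw [abs_le]; constructor <;> linarith [(hξ j i).1, (hξ j i).2]
    have h4 := abs_sub_le (g' (ξ j i) j) ((ξ j i) ^ (j : ℕ) / ((j : ℕ).factorial : ℝ))
      (s₀ i ^ (j : ℕ) / ((j : ℕ).factorial : ℝ))
    linarith
  refine ⟨?_, ?_, ?_⟩
  · intro s hs t ht hst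
    have hex : ∀ j i, ∃ ξ ∈ Ioc (s₀ i) (s₀ i + τ), g (s i) j - g (t i) j = g' ξ j * (s i - t i) :=
      fun j i => exists_slope (g := fun u => g u j) (g' := fun u => g' u j) (hg j)
        (hs₀ i) (hs₁ i) (hs i (mem_univ i)) (ht i (mem_univ i))
    choose ξ hξ1 hξ2 using hex
    have hmul : (Matrix.of fun j i => g' (ξ j i) j).mulVec (fun i => s i - t i) = 0 := by
      funext j
      have := congrFun hst j
      simp only [sumMap] at this
      simp only [Matrix.mulVec, dotProduct, Matrix.of_apply, Pi.zero_apply]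
      simp_rw [← hξ2]
      rw [Finset.sum_sub_distrib, this, sub_self]
    have hdet : (Matrix.of fun j i => g' (ξ j i) j).det ≠ 0 := by
      have := hW ξ hξ1
      intro h
      rw [h, abs_zero] at this
      linarith
    have := Matrix.eq_zero_of_mulVec_eq_zero hdet hmul
    funext i
    have h := congrFun this i
    simp only [Pi.zero_apply] at h
    linarith
  · intro s hs
    rw [det_sumMapDeriv]
    exact hW (fun _ i => s i) fun _ i => hs i (mem_univ i)
  · intro s hs
    refine hasFDerivWithinAt_sumMap (B := Set.pi univ fun i => Ioc (s₀ i) (s₀ i + τ))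
      (J := fun i => Ioc (s₀ i) (s₀ i + τ))
      (fun u hu i => hu i (mem_univ i)) fun i j => ?_
    exact (hg j (s i) (hsub i (hs i (mem_univ i)))).mono (hsub i)

end SumMap

/-! ### Controlling an oscillatory integral on a unit cube of frequencies by its centre. -/

section TaylorWords

/-- Cauchy–Schwarz for counting measure, with each weight split as a^{1/2}·a^{1/2}. -/
theorem ENNReal.sq_tsum_mul_le {ι : Type*} (a b : ι → ℝ≥0∞) :
    (∑' i, a i * b i) ^ 2 ≤ (∑' i, a i) * ∑' i, a i * b i ^ 2 := by
  let _ : MeasurableSpace ι := ⊤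
  have : MeasurableSingletonClass ι := ⟨fun _ => trivial⟩
  have h := ENNReal.lintegral_mul_le_Lp_mul_Lq (Measure.count : Measure ι)
    (Real.HolderConjugate.two_two) (f := fun i => a i ^ (1 / 2 : ℝ))
    (g := fun i => a i ^ (1 / 2 : ℝ) * b i) (measurable_from_top.aemeasurable)
    (measurable_from_top.aemeasurable)
  simp only [lintegral_count, Pi.mul_apply] at h
  have e0 : ∀ x : ℝ≥0∞, x ^ (1 / 2 : ℝ) * x ^ (1 / 2 : ℝ) = x := by
    intro x
    rw [← ENNReal.rpow_add_of_nonneg _ _ (by norm_num) (by norm_num)]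
    norm_num
  have e1 : ∀ i, a i ^ (1 / 2 : ℝ) * (a i ^ (1 / 2 : ℝ) * b i) = a i * b i := by
    intro i
    rw [← mul_assoc, e0]
  have e2 : ∀ i, (a i ^ (1 / 2 : ℝ)) ^ (2 : ℝ) = a i := by
    intro i
    rw [← ENNReal.rpow_mul]
    norm_num
  have e3 : ∀ i, (a i ^ (1 / 2 : ℝ) * b i) ^ (2 : ℝ) = a i * b i ^ 2 := by
    intro i
    rw [ENNReal.mul_rpow_of_nonneg _ _ (by norm_num), e2, ENNReal.rpow_two]
  simp_rw [e1, e2, e3] at h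
  calc (∑' i, a i * b i) ^ 2
      ≤ ((∑' i, a i) ^ (1 / 2 : ℝ) * (∑' i, a i * b i ^ 2) ^ (1 / 2 : ℝ)) ^ 2 :=
        pow_le_pow_left' h 2
    _ = _ := by rw [mul_pow, pow_two, pow_two, e0, e0]

variable {X : Type*} [MeasurableSpace X] {κ : Type*} [Fintype κ]

/-- A pair (n, σ) is a word of length n over the alphabet κ. There are (card κ)^n of them, so the
sum is an exponential series. -/
theorem tsum_word_weight (x : ℝ) (hx : 0 ≤ x) :
    ∑' p : (Σ n : ℕ, (Fin n → κ)), ENNReal.ofReal (1 / (p.1.factorial : ℝ))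
        * ENNReal.ofReal (x ^ p.1)
      = ENNReal.ofReal (Real.exp (Fintype.card κ * x)) := by
  rw [ENNReal.tsum_sigma (fun (n : ℕ) (_ : Fin n → κ) =>
    ENNReal.ofReal (1 / (n.factorial : ℝ)) * ENNReal.ofReal (x ^ n))]
  have e : ∀ n : ℕ, ∑' _ : Fin n → κ, ENNReal.ofReal (1 / (n.factorial : ℝ))
      * ENNReal.ofReal (x ^ n)
      = ENNReal.ofReal ((Fintype.card κ * x) ^ n / (n.factorial : ℝ)) := by
    intro n
    rw [tsum_fintype, Finset.sum_const, Finset.card_univ, Fintype.card_fun, Fintype.card_fin,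
      nsmul_eq_mul, ← ENNReal.ofReal_mul (by positivity), ← ENNReal.ofReal_natCast,
      ← ENNReal.ofReal_mul (by positivity)]
    congr 1
    push_cast
    rw [mul_pow]
    ring
  simp_rw [e]
  rw [← ENNReal.ofReal_tsum_of_nonneg (fun n => by positivity)
    (Real.summable_pow_div_factorial _), Real.exp_eq_exp_ℝ, NormedSpace.exp_eq_tsum_div]

/-- Expanding exp(i(w − w₀)·Φ) into words separates w from s: each word carries a coefficient of
modulus at most 1/n! and an integral at the frequency w₀. Cauchy–Schwarz against these weights costs
exp(card κ). The right side does not involve w, so it bounds a whole cell of frequencies at once. -/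
theorem enorm_sq_integral_exp_le {ν : Measure X} {Φ : X → κ → ℝ}
    (hΦ : ∀ j, AEMeasurable (fun s => Φ s j) ν) {R : ℝ}
    (hR : ∀ᵐ s ∂ν, ∀ j, |Φ s j| ≤ R) {F : X → ℂ} (hF : Integrable F ν)
    {w w₀ : κ → ℝ} (hw : ∀ j, |w j - w₀ j| ≤ 1) :
    ‖∫ s, Complex.exp (Complex.I * ((∑ j, w j * Φ s j : ℝ) : ℂ)) * F s ∂ν‖ₑ ^ 2
      ≤ ENNReal.ofReal (Real.exp (Fintype.card κ)) *
        ∑' p : (Σ n : ℕ, (Fin n → κ)), ENNReal.ofReal (1 / (p.1.factorial : ℝ)) *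
          ‖∫ s, Complex.exp (Complex.I * ((∑ j, w₀ j * Φ s j : ℝ) : ℂ)) *
            (((∏ i, Φ s (p.2 i) : ℝ) : ℂ) * F s) ∂ν‖ₑ ^ 2 := by
  set A : (Σ n : ℕ, (Fin n → κ)) → ℂ := fun p =>
    ∫ s, Complex.exp (Complex.I * ((∑ j, w₀ j * Φ s j : ℝ) : ℂ)) *
            (((∏ i, Φ s (p.2 i) : ℝ) : ℂ) * F s) ∂ν with hA
  have hexpm : ∀ v : κ → ℝ, AEStronglyMeasurable
      (fun s => Complex.exp (Complex.I * ((∑ j, v j * Φ s j : ℝ) : ℂ))) ν := by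
    intro v
    have : AEMeasurable (fun s => ∑ j, v j * Φ s j) ν :=
      Finset.aemeasurable_fun_sum _ fun j _ => (hΦ j).const_mul _
    have h2 : Measurable fun x : ℝ => Complex.exp (Complex.I * (x : ℂ)) := by fun_prop
    exact (h2.comp_aemeasurable this).aestronglyMeasurable
  have hAint : ∀ p : (Σ n : ℕ, (Fin n → κ)), Integrable (fun s =>
      Complex.exp (Complex.I * ((∑ j, w₀ j * Φ s j : ℝ) : ℂ)) *
            (((∏ i, Φ s (p.2 i) : ℝ) : ℂ) * F s)) ν := by
    intro p
    refine Integrable.bdd_mul (c := 1) ?_ (hexpm w₀)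
      (Filter.Eventually.of_forall fun s => (norm_exp_I_mul _).le)
    refine hF.bdd_mul (c := R ^ p.1) ?_ ?_
    · have : AEMeasurable (fun s => ∏ i, Φ s (p.2 i)) ν :=
        Finset.aemeasurable_fun_prod _ fun i _ => hΦ (p.2 i)
      exact (Complex.measurable_ofReal.comp_aemeasurable this).aestronglyMeasurable
    · filter_upwards [hR] with s hs
      rw [Complex.norm_real, Real.norm_eq_abs, Finset.abs_prod]
      calc ∏ i, |Φ s (p.2 i)| ≤ ∏ _i : Fin p.1, R :=
            Finset.prod_le_prod (fun _ _ => abs_nonneg _) fun i _ => hs _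
        _ = R ^ p.1 := by simp
  set u : κ → ℝ := fun j => w j - w₀ j with hu
  set H : ℕ → X → ℂ := fun n s => Complex.exp (Complex.I * ((∑ j, w₀ j * Φ s j : ℝ) : ℂ)) *
    ((Complex.I * ((∑ j, u j * Φ s j : ℝ) : ℂ)) ^ n / (n.factorial : ℂ) * F s) with hH
  have hHexp : ∀ n s, H n s = ∑ σ : Fin n → κ,
      (Complex.I ^ n / (n.factorial : ℂ) * ((∏ i, u (σ i) : ℝ) : ℂ)) *
      (Complex.exp (Complex.I * ((∑ j, w₀ j * Φ s j : ℝ) : ℂ)) *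
            (((∏ i, Φ s (σ i) : ℝ) : ℂ) * F s)) := by
    intro n s
    simp only [hH]
    rw [mul_pow]
    have : (((∑ j, u j * Φ s j : ℝ) : ℂ)) ^ n
        = ∑ σ : Fin n → κ, ((∏ i, u (σ i) : ℝ) : ℂ) * ((∏ i, Φ s (σ i) : ℝ) : ℂ) := by
      rw [← Complex.ofReal_pow, Fintype.sum_pow]
      push_cast
      refine Finset.sum_congr rfl fun σ _ => ?_
      rw [← Finset.prod_mul_distrib]
    rw [this, Finset.mul_sum, Finset.sum_div, Finset.sum_mul, Finset.mul_sum]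
    exact Finset.sum_congr rfl fun σ _ => by ring
  have hHint : ∀ n, Integrable (H n) ν := by
    intro n
    have : H n = fun s => _ := funext (hHexp n)
    rw [this]
    exact integrable_finsetSum _ fun σ _ => (hAint ⟨n, σ⟩).const_mul _
  have hHI : ∀ n, ∫ s, H n s ∂ν = ∑ σ : Fin n → κ,
      (Complex.I ^ n / (n.factorial : ℂ) * ((∏ i, u (σ i) : ℝ) : ℂ)) * A ⟨n, σ⟩ := by
    intro n
    simp_rw [hHexp]
    rw [integral_finsetSum _ fun σ _ => (hAint ⟨n, σ⟩).const_mul _]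
    simp_rw [integral_const_mul]
    rfl
  have hHnorm : ∀ n, ∀ᵐ s ∂ν, ‖H n s‖ ≤ (Fintype.card κ * R) ^ n / n.factorial * ‖F s‖ := by
    intro n
    filter_upwards [hR] with s hs
    simp only [hH]
    rw [norm_mul, norm_exp_I_mul, one_mul, norm_mul]
    gcongr
    rw [norm_div, norm_pow, norm_mul, Complex.norm_I, one_mul, Complex.norm_real,
      Complex.norm_natCast]
    gcongr
    refine (norm_sum_le _ _).trans ?_
    calc ∑ j, ‖u j * Φ s j‖ ≤ ∑ _j : κ, R := by
          refine Finset.sum_le_sum fun j _ => ?_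
          rw [norm_mul, Real.norm_eq_abs, Real.norm_eq_abs]
          calc |u j| * |Φ s j| ≤ 1 * R := by gcongr; exacts [hw j, hs j]
            _ = R := one_mul R
      _ = Fintype.card κ * R := by simp
  have hsumm : Summable fun n => ∫ s, ‖H n s‖ ∂ν := by
    refine Summable.of_nonneg_of_le (fun n => integral_nonneg fun s => norm_nonneg _)
      (fun n => ?_) ((Real.summable_pow_div_factorial (Fintype.card κ * R)).mul_right
        (∫ s, ‖F s‖ ∂ν))
    rw [← integral_const_mul]
    exact integral_mono_ae (hHint n).norm (hF.norm.const_mul _) (hHnorm n)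
  have hsum := hasSum_integral_of_summable_integral_norm hHint hsumm
  have hpt : ∀ s, ∑' n, H n s = Complex.exp (Complex.I * ((∑ j, w j * Φ s j : ℝ) : ℂ)) * F s := by
    intro s
    simp only [hH]
    rw [tsum_mul_left, tsum_mul_right, ← congrFun (NormedSpace.exp_eq_tsum_div (𝔸 := ℂ)) _,
      ← Complex.exp_eq_exp_ℂ, ← mul_assoc, ← Complex.exp_add, ← mul_add, ← Complex.ofReal_add,
      ← Finset.sum_add_distrib]
    have e : ∑ j, (w₀ j * Φ s j + u j * Φ s j) = ∑ j, w j * Φ s j :=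
      Finset.sum_congr rfl fun j _ => by simp only [hu]; ring
    rw [e]
  simp_rw [hpt] at hsum
  have hle : ‖∫ s, Complex.exp (Complex.I * ((∑ j, w j * Φ s j : ℝ) : ℂ)) * F s ∂ν‖ₑ
      ≤ ∑' p : (Σ n : ℕ, (Fin n → κ)), ENNReal.ofReal (1 / (p.1.factorial : ℝ)) * ‖A p‖ₑ := by
    rw [← hsum.tsum_eq]
    refine enorm_tsum_le_tsum_enorm.trans ?_
    rw [ENNReal.tsum_sigma (fun (n : ℕ) (σ : Fin n → κ) =>
      ENNReal.ofReal (1 / (n.factorial : ℝ)) * ‖A ⟨n, σ⟩‖ₑ)]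
    refine ENNReal.tsum_le_tsum fun n => ?_
    rw [hHI, tsum_fintype]
    refine (enorm_sum_le _ _).trans (Finset.sum_le_sum fun σ _ => ?_)
    rw [enorm_mul]
    gcongr
    rw [← ofReal_norm]
    refine ENNReal.ofReal_le_ofReal ?_
    rw [norm_mul, norm_div, norm_pow, Complex.norm_I, one_pow, Complex.norm_natCast,
      Complex.norm_real, Real.norm_eq_abs, Finset.abs_prod]
    calc 1 / (n.factorial : ℝ) * ∏ i, |u (σ i)| ≤ 1 / (n.factorial : ℝ) * 1 := by
          gcongr
          exact Finset.prod_le_one (fun _ _ => abs_nonneg _) fun i _ => hw _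
      _ = _ := mul_one _
  refine (pow_le_pow_left' hle 2).trans ((ENNReal.sq_tsum_mul_le _ _).trans_eq ?_)
  congr 1
  have := tsum_word_weight (κ := κ) 1 zero_le_one
  simpa using this

end TaylorWords

/-! ### The L² estimate: Bessel in the ι-directions, counting in the κ-directions. -/

section LocalL2

variable {X : Type*} [MeasurableSpace X] {ι κ : Type*} [Fintype ι] [Fintype κ]

/-- Bessel's inequality with the extra modulation `exp (i ρ m·Ψ)` and the weight `∏ Φ`, for
frequencies in the lattice `ρ ℤ^ι`. -/
theorem bessel_comp_scaled {Θ : (ι → ℝ) → ι → ℝ} {Θ' : (ι → ℝ) → (ι → ℝ) →L[ℝ] (ι → ℝ)}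
    {B : Set (ι → ℝ)} (hB : MeasurableSet B)
    (hd : ∀ s ∈ B, HasFDerivWithinAt Θ (Θ' s) B s) (hinj : InjOn Θ B)
    {c : ℝ} (hc : 0 < c) (hdet : ∀ s ∈ B, c ≤ |(Θ' s).det|) {ρ R : ℝ} (hρ : 0 < ρ)
    (hρR : ρ * R ≤ Real.pi) (hR : ∀ s ∈ B, ∀ j, |Θ s j| ≤ R)
    {F : (ι → ℝ) → ℂ} (hF : IntegrableOn F B) (S : Finset (ι → ℤ)) :
    ∑ n ∈ S, ‖∫ s in B, Complex.exp (Complex.I * ((∑ j, ρ * n j * Θ s j : ℝ) : ℂ)) * F s‖ₑ ^ 2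
      ≤ ENNReal.ofReal ((2 * Real.pi) ^ Fintype.card ι / (ρ ^ Fintype.card ι * c))
        * ∫⁻ s in B, ‖F s‖ₑ ^ 2 := by
  -- Frequencies in ρℤ^ι against Θ are integer frequencies against ρΘ, and `hρR` keeps ρΘ inside the
  -- period cube.
  have h := bessel_comp (Θ := ρ • Θ) (Θ' := ρ • Θ') (c := ρ ^ Fintype.card ι * c) hB
    (fun s hs => (hd s hs).const_smul ρ) (fun s hs t ht hst => hinj hs ht (by
      simpa [hρ.ne'] using hst)) (by positivity) (fun s hs => by
      have : ((ρ • Θ') s).det = ρ ^ Fintype.card ι * (Θ' s).det := by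
        rw [Pi.smul_apply, ContinuousLinearMap.det, ContinuousLinearMap.det,
          ContinuousLinearMap.toLinearMap_smul, LinearMap.det_smul, Module.finrank_fintype_fun_eq_card]
      rw [this, abs_mul, abs_of_pos (by positivity : 0 < ρ ^ Fintype.card ι)]
      gcongr
      exact hdet s hs) (fun s hs j => by
      refine abs_le.1 ?_
      simp only [Pi.smul_apply, smul_eq_mul]
      rw [abs_mul, abs_of_pos hρ]
      exact (mul_le_mul_of_nonneg_left (hR s hs j) hρ.le).trans hρR) hF S
  refine le_trans (le_of_eq ?_) h
  refine Finset.sum_congr rfl fun n _ => ?_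
  simp only [Pi.smul_apply, smul_eq_mul]
  congr 3
  funext s
  have : ∑ j, ρ * n j * Θ s j = ∑ j, n j * (ρ * Θ s j) :=
    Finset.sum_congr rfl fun j _ => by ring
  simp only [this]

theorem card_Icc_floor_le {x : ℝ} (hx : 0 ≤ x) :
    ((Finset.Icc ⌊-x⌋ ⌊x⌋).card : ℝ≥0∞) ≤ ENNReal.ofReal (2 * x + 2) := by
  rw [Int.card_Icc, ← ENNReal.ofReal_natCast]
  refine ENNReal.ofReal_le_ofReal ?_
  have h1 := Int.floor_le x
  have h2 := Int.lt_floor_add_one (-x)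
  have h3 : ⌊-x⌋ ≤ ⌊x⌋ := Int.floor_le_floor (by linarith)
  have h4 : (((⌊x⌋ + 1 - ⌊-x⌋).toNat : ℤ) : ℝ) = ((⌊x⌋ + 1 - ⌊-x⌋ : ℤ) : ℝ) := by
    rw [Int.toNat_of_nonneg (by omega)]
  rw [Int.cast_natCast] at h4
  rw [h4]
  push_cast
  linarith

theorem abs_sub_mul_floor_le {ρ : ℝ} (hρ : 0 < ρ) (y : ℝ) : |y - ρ * ⌊y / ρ⌋| ≤ ρ := by
  have h1 := Int.floor_le (y / ρ)
  have h2 := Int.lt_floor_add_one (y / ρ)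
  rw [le_div_iff₀ hρ] at h1
  rw [div_lt_iff₀ hρ] at h2
  rw [abs_le]
  constructor <;> nlinarith

theorem floor_div_mem_Icc {ρ L y : ℝ} (hρ : 0 < ρ) (hy : |y| ≤ L) :
    ⌊y / ρ⌋ ∈ Finset.Icc ⌊-(L / ρ)⌋ ⌊L / ρ⌋ := by
  have := abs_le.1 hy
  refine Finset.mem_Icc.2 ⟨Int.floor_le_floor ?_, Int.floor_le_floor ?_⟩
  · rw [← neg_div]
    exact div_le_div_of_nonneg_right this.1 hρ.le
  · exact div_le_div_of_nonneg_right this.2 hρ.le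

/-- The `L²` estimate for `F ↦ ∫_B exp (i w(x)·Φ(s)) F(s) ds` with respect to a measure for which
the cells of side `ρ` in the `w`-space have measure at most `D`. -/
theorem lintegral_sq_oscillatory_le {μ : Measure X} {w : X → ι ⊕ κ → ℝ}
    {Φ : (ι → ℝ) → ι ⊕ κ → ℝ} {Θ' : (ι → ℝ) → (ι → ℝ) →L[ℝ] (ι → ℝ)}
    {B : Set (ι → ℝ)} (hB : MeasurableSet B)
    (hd : ∀ s ∈ B, HasFDerivWithinAt (fun s j => Φ s (Sum.inl j)) (Θ' s) B s)
    (hinj : InjOn (fun s j => Φ s (Sum.inl j)) B)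
    {c : ℝ} (hc : 0 < c) (hdet : ∀ s ∈ B, c ≤ |(Θ' s).det|) {ρ R : ℝ} (hρ : 0 < ρ) (hρ1 : ρ ≤ 1)
    (hρR : ρ * R ≤ Real.pi) (hR : ∀ s ∈ B, ∀ j, |Φ s j| ≤ R)
    (hΦm : ∀ j, AEMeasurable (fun s => Φ s j) (volume.restrict B))
    {L : ι ⊕ κ → ℝ} (hL0 : ∀ j, 0 ≤ L j) (hL : ∀ᵐ x ∂μ, ∀ j, |w x j| ≤ L j) {D : ℝ≥0∞}
    (hD : ∀ n : ι ⊕ κ → ℤ, μ {x | ∀ j, |w x j - ρ * n j| ≤ ρ} ≤ D)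
    {F : (ι → ℝ) → ℂ} (hF : IntegrableOn F B) :
    ∫⁻ x, ‖∫ s in B, Complex.exp (Complex.I * ((∑ j, w x j * Φ s j : ℝ) : ℂ)) * F s‖ₑ ^ 2 ∂μ
      ≤ ENNReal.ofReal (Real.exp (Fintype.card (ι ⊕ κ)) *
          Real.exp (Fintype.card (ι ⊕ κ) * R ^ 2) *
          ((2 * Real.pi) ^ Fintype.card ι / (ρ ^ Fintype.card ι * c))) *
        ((∏ j : κ, ENNReal.ofReal (2 * L (Sum.inr j) / ρ + 2)) * D) * ∫⁻ s in B, ‖F s‖ₑ ^ 2 := by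
  classical
  set N : ι ⊕ κ → Finset ℤ := fun j => Finset.Icc ⌊-(L j / ρ)⌋ ⌊L j / ρ⌋ with hN
  set S₁ : Finset (ι → ℤ) := Fintype.piFinset fun j => N (Sum.inl j) with hS₁
  set S₂ : Finset (κ → ℤ) := Fintype.piFinset fun j => N (Sum.inr j) with hS₂
  -- The cells overlap, which is harmless: only their covering the support of μ is used.
  set Q : (ι → ℤ) × (κ → ℤ) → Set X :=
    fun p => {x | ∀ j, |w x j - ρ * (Sum.elim p.1 p.2 j : ℤ)| ≤ ρ} with hQ
  set T : X → ℂ := fun x =>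
    ∫ s in B, Complex.exp (Complex.I * ((∑ j, w x j * Φ s j : ℝ) : ℂ)) * F s with hT
  set W := Σ n : ℕ, (Fin n → ι ⊕ κ) with hW
  set G : W → (ι → ℝ) → ℂ := fun p s => ((∏ i, Φ s (p.2 i) : ℝ) : ℂ) * F s with hG
  set M : (ι → ℤ) × (κ → ℤ) → ℝ≥0∞ := fun q => ∑' p : W, ENNReal.ofReal (1 / (p.1.factorial : ℝ)) *
    ‖∫ s in B, Complex.exp (Complex.I * ((∑ j, ρ * (Sum.elim q.1 q.2 j : ℤ) * Φ s j : ℝ) : ℂ)) *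
      G p s‖ₑ ^ 2 with hM
  set E₁ := ENNReal.ofReal (Real.exp (Fintype.card (ι ⊕ κ))) with hE₁
  have hRae : ∀ᵐ s ∂(volume.restrict B), ∀ j, |Φ s j| ≤ R := by
    filter_upwards [ae_restrict_mem hB] with s hs
    exact hR s hs
  have hcover : ∀ᵐ x ∂μ, x ∈ ⋃ p ∈ S₁ ×ˢ S₂, Q p := by
    filter_upwards [hL] with x hx
    have hmem : ∀ j, ⌊w x j / ρ⌋ ∈ N j := fun j => floor_div_mem_Icc hρ (hx j)
    refine mem_iUnion₂.2 ⟨(fun j => ⌊w x (Sum.inl j) / ρ⌋, fun j => ⌊w x (Sum.inr j) / ρ⌋),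
      Finset.mem_product.2 ⟨Fintype.mem_piFinset.2 fun j => hmem _,
        Fintype.mem_piFinset.2 fun j => hmem _⟩, ?_⟩
    rintro (j | j)
    · exact abs_sub_mul_floor_le hρ _
    · exact abs_sub_mul_floor_le hρ _
  have hcell : ∀ p, ∀ x ∈ Q p, ‖T x‖ₑ ^ 2 ≤ E₁ * M p := by
    intro p x hx
    exact enorm_sq_integral_exp_le (w := w x) (w₀ := fun j => ρ * (Sum.elim p.1 p.2 j : ℤ)) hΦm
      hRae hF fun j => (hx j).trans hρ1
  have hstep1 : ∫⁻ x, ‖T x‖ₑ ^ 2 ∂μ ≤ ∑ p ∈ S₁ ×ˢ S₂, E₁ * M p * D := by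
    calc ∫⁻ x, ‖T x‖ₑ ^ 2 ∂μ = ∫⁻ x in ⋃ p ∈ S₁ ×ˢ S₂, Q p, ‖T x‖ₑ ^ 2 ∂μ := by
          rw [Measure.restrict_eq_self_of_ae_mem hcover]
      _ ≤ ∑ p ∈ S₁ ×ˢ S₂, ∫⁻ x in Q p, ‖T x‖ₑ ^ 2 ∂μ := by
          rw [← lintegral_finsetSum_measure]
          refine lintegral_mono' ?_ le_rfl
          have e : (⋃ p ∈ S₁ ×ˢ S₂, Q p) = ⋃ p : (S₁ ×ˢ S₂ : Finset _), Q p := by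
            ext x; simp only [mem_iUnion, Subtype.exists, exists_prop]
          rw [← Measure.sum_coe_finset, e]
          exact Measure.restrict_iUnion_le
      _ ≤ ∑ p ∈ S₁ ×ˢ S₂, E₁ * M p * D := by
          refine Finset.sum_le_sum fun p _ => ?_
          calc ∫⁻ x in Q p, ‖T x‖ₑ ^ 2 ∂μ ≤ ∫⁻ _ in Q p, E₁ * M p ∂μ :=
                setLIntegral_mono measurable_const (hcell p)
            _ = E₁ * M p * μ (Q p) := by rw [setLIntegral_const]
            _ ≤ E₁ * M p * D := by
                gcongr
                exact hD _
  set bc : ℝ≥0∞ := ENNReal.ofReal ((2 * Real.pi) ^ Fintype.card ι / (ρ ^ Fintype.card ι * c))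
    with hbc
  have hGint : ∀ p : W, IntegrableOn (G p) B := by
    intro p
    refine hF.bdd_mul (c := R ^ p.1) ?_ ?_
    · have : AEMeasurable (fun s => ∏ i, Φ s (p.2 i)) (volume.restrict B) :=
        Finset.aemeasurable_fun_prod _ fun i _ => hΦm (p.2 i)
      exact (Complex.measurable_ofReal.comp_aemeasurable this).aestronglyMeasurable
    · filter_upwards [hRae] with s hs
      rw [Complex.norm_real, Real.norm_eq_abs, Finset.abs_prod]
      calc ∏ i, |Φ s (p.2 i)| ≤ ∏ _i : Fin p.1, R :=
            Finset.prod_le_prod (fun _ _ => abs_nonneg _) fun i _ => hs _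
        _ = R ^ p.1 := by simp
  -- For fixed n₂ the κ-part of the phase is a unimodular factor of s and can be absorbed into the
  -- amplitude. A word of length n costs at most R^{2n} in the squared norm.
  have hbes : ∀ p : W, ∀ n₂ : κ → ℤ, ∑ n₁ ∈ S₁,
      ‖∫ s in B, Complex.exp (Complex.I * ((∑ j, ρ * (Sum.elim n₁ n₂ j : ℤ) * Φ s j : ℝ) : ℂ)) *
        G p s‖ₑ ^ 2 ≤ bc * (ENNReal.ofReal ((R ^ 2) ^ p.1) * ∫⁻ s in B, ‖F s‖ₑ ^ 2) := by
    intro p n₂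
    set H : (ι → ℝ) → ℂ := fun s =>
      Complex.exp (Complex.I * ((∑ j, ρ * n₂ j * Φ s (Sum.inr j) : ℝ) : ℂ)) * G p s with hH
    have hHint : IntegrableOn H B := by
      refine (hGint p).bdd_mul (c := 1) ?_ (Filter.Eventually.of_forall fun s =>
        (norm_exp_I_mul _).le)
      have h1 : AEMeasurable (fun s => ∑ j, ρ * n₂ j * Φ s (Sum.inr j)) (volume.restrict B) :=
        Finset.aemeasurable_fun_sum _ fun j _ => (hΦm _).const_mul _
      have h2 : Measurable fun x : ℝ => Complex.exp (Complex.I * (x : ℂ)) := by fun_prop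
      exact (h2.comp_aemeasurable h1).aestronglyMeasurable
    have hb := bessel_comp_scaled hB hd hinj hc hdet hρ hρR (fun s hs j => hR s hs _) hHint S₁
    have hHle : ∫⁻ s in B, ‖H s‖ₑ ^ 2
        ≤ ENNReal.ofReal ((R ^ 2) ^ p.1) * ∫⁻ s in B, ‖F s‖ₑ ^ 2 := by
      rw [← lintegral_const_mul' _ _ ENNReal.ofReal_ne_top]
      refine lintegral_mono_ae ?_
      filter_upwards [hRae] with s hs
      simp only [hH, hG]
      rw [enorm_mul, enorm_mul, ← ofReal_norm, norm_exp_I_mul, ENNReal.ofReal_one, one_mul,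
        mul_pow]
      gcongr
      rw [← ofReal_norm, ← ENNReal.ofReal_pow (norm_nonneg _)]
      refine ENNReal.ofReal_le_ofReal ?_
      rw [← pow_mul, mul_comm, pow_mul]
      gcongr
      rw [Complex.norm_real, Real.norm_eq_abs, Finset.abs_prod]
      calc ∏ i, |Φ s (p.2 i)| ≤ ∏ _i : Fin p.1, R :=
            Finset.prod_le_prod (fun _ _ => abs_nonneg _) fun i _ => hs _
        _ = R ^ p.1 := by simp
    refine le_trans (le_of_eq ?_) (hb.trans (mul_le_mul_right hHle _))
    refine Finset.sum_congr rfl fun n₁ _ => ?_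
    congr 2
    refine integral_congr_ae (Filter.Eventually.of_forall fun s => ?_)
    simp only [hH]
    rw [← mul_assoc (Complex.exp _) (Complex.exp _), ← Complex.exp_add, ← mul_add,
      ← Complex.ofReal_add, Fintype.sum_sum_type]
    simp only [Sum.elim_inl, Sum.elim_inr]
  -- The Bessel bound is uniform in n₂, so the κ-directions cost only the number of admissible n₂.
  -- Summing R^{2n}/n! over words gives the second exponential.
  have hMsum : ∑ q ∈ S₁ ×ˢ S₂, M q ≤ (S₂.card : ℝ≥0∞) * (bc *
      (ENNReal.ofReal (Real.exp (Fintype.card (ι ⊕ κ) * R ^ 2)) * ∫⁻ s in B, ‖F s‖ₑ ^ 2)) := by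
    rw [Finset.sum_product_right, ← nsmul_eq_mul]
    refine Finset.sum_le_card_nsmul _ _ _ fun n₂ _ => ?_
    simp only [hM]
    rw [← Summable.tsum_finsetSum fun _ _ => ENNReal.summable]
    rw [← tsum_word_weight (κ := ι ⊕ κ) (R ^ 2) (sq_nonneg R), ← ENNReal.tsum_mul_right,
      ← ENNReal.tsum_mul_left]
    refine ENNReal.tsum_le_tsum fun p => ?_
    rw [← Finset.mul_sum]
    calc _ ≤ _ := mul_le_mul_right (hbes p n₂) _
      _ = _ := by ring
  have hcard : (S₂.card : ℝ≥0∞) ≤ ∏ j : κ, ENNReal.ofReal (2 * L (Sum.inr j) / ρ + 2) := by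
    rw [hS₂, Fintype.card_piFinset]
    push_cast
    refine Finset.prod_le_prod' fun j _ => ?_
    rw [mul_div_assoc]
    exact card_Icc_floor_le (div_nonneg (hL0 _) hρ.le)
  calc ∫⁻ x, ‖T x‖ₑ ^ 2 ∂μ ≤ ∑ p ∈ S₁ ×ˢ S₂, E₁ * M p * D := hstep1
    _ = E₁ * (∑ p ∈ S₁ ×ˢ S₂, M p) * D := by rw [Finset.mul_sum, Finset.sum_mul]
    _ ≤ E₁ * ((∏ j : κ, ENNReal.ofReal (2 * L (Sum.inr j) / ρ + 2)) * (bc *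
      (ENNReal.ofReal (Real.exp (Fintype.card (ι ⊕ κ) * R ^ 2)) * ∫⁻ s in B, ‖F s‖ₑ ^ 2))) * D := by
        gcongr
        refine hMsum.trans ?_
        gcongr
    _ = _ := by
        rw [ENNReal.ofReal_mul (by positivity), ENNReal.ofReal_mul (by positivity)]
        ring

end LocalL2

/-! ### Real interpolation between L¹ → L^∞ and L² → L²(μ). -/

section Interpolation

theorem lintegral_Ioc_rpow {a b : ℝ} (ha : -1 < a) (hb : 0 ≤ b) :
    ∫⁻ s in Ioc 0 b, ENNReal.ofReal (s ^ a) = ENNReal.ofReal (b ^ (a + 1) / (a + 1)) := by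
  rw [← ofReal_integral_eq_lintegral_ofReal]
  · rw [← intervalIntegral.integral_of_le hb, integral_rpow (Or.inl ha),
      Real.zero_rpow (by linarith), sub_zero]
  · exact (intervalIntegrable_iff_integrableOn_Ioc_of_le hb).1
      (intervalIntegral.intervalIntegrable_rpow' ha)
  · filter_upwards [ae_restrict_mem measurableSet_Ioc] with s hs
    exact Real.rpow_nonneg hs.1.le _

variable {X Y : Type*} [MeasurableSpace X] [MeasurableSpace Y]

/-- Where |F| > t one has |F| ≤ t^{1−q} |F|^q. -/
theorem lintegral_norm_gt_le {ν : Measure X} {F : X → ℂ} {q t : ℝ} (hq : 1 ≤ q) (ht : 0 < t) :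
    ∫⁻ x, {x | t < ‖F x‖}.indicator (fun x => ‖F x‖ₑ) x ∂ν
      ≤ ENNReal.ofReal (t ^ (1 - q)) * ∫⁻ x, ‖F x‖ₑ ^ q ∂ν := by
  rw [← lintegral_const_mul' _ _ ENNReal.ofReal_ne_top]
  refine lintegral_mono fun x => ?_
  by_cases hx : t < ‖F x‖
  · rw [indicator_of_mem (by exact hx), ← ofReal_norm,
      ENNReal.ofReal_rpow_of_pos (ht.trans hx), ← ENNReal.ofReal_mul (by positivity)]
    refine ENNReal.ofReal_le_ofReal ?_
    have h0 : 0 < ‖F x‖ := ht.trans hx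
    have h1 : ‖F x‖ ^ q = ‖F x‖ ^ (q - 1) * ‖F x‖ := by
      rw [← Real.rpow_add_one h0.ne']; congr 1; ring
    have h2 : t ^ (1 - q) * t ^ (q - 1) = 1 := by
      rw [← Real.rpow_add ht]; simp
    have h3 : t ^ (q - 1) ≤ ‖F x‖ ^ (q - 1) :=
      Real.rpow_le_rpow ht.le hx.le (by linarith)
    rw [h1, ← mul_assoc]
    have h4 : 1 ≤ t ^ (1 - q) * ‖F x‖ ^ (q - 1) := by
      exact h2.symm.le.trans (mul_le_mul_of_nonneg_left h3 (by positivity))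
    nlinarith
  · rw [indicator_of_notMem (by exact hx)]
    exact zero_le

/-- Interpolation between the trivial `L¹ → L^∞` bound and an `L² → L²(μ)` bound for an integral
operator with kernel bounded by one. -/
theorem lintegral_rpow_interpolation {ν : Measure X} [IsFiniteMeasure ν] {μ : Measure Y}
    {K : Y → X → ℂ} (hK : ∀ y, AEStronglyMeasurable (K y) ν) (hK1 : ∀ y x, ‖K y x‖ ≤ 1)
    (hm : ∀ F : X → ℂ, Measurable F → Integrable F ν →
      Measurable fun y => ∫ x, K y x * F x ∂ν)
    {A : ℝ≥0∞} (h2 : ∀ F : X → ℂ, Measurable F → Integrable F ν →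
      ∫⁻ y, ‖∫ x, K y x * F x ∂ν‖ₑ ^ 2 ∂μ ≤ A * ∫⁻ x, ‖F x‖ₑ ^ 2 ∂ν)
    {r : ℝ} (hr : 2 < r) {F : X → ℂ} (hF : Measurable F) (hFi : Integrable F ν)
    (hfin : ∫⁻ x, ‖F x‖ₑ ^ (r / (r - 1)) ∂ν ≠ ∞) :
    ∫⁻ y, ‖∫ x, K y x * F x ∂ν‖ₑ ^ r ∂μ
      ≤ ENNReal.ofReal (r * 2 ^ r / (r - 2)) * A
        * (∫⁻ x, ‖F x‖ₑ ^ (r / (r - 1)) ∂ν) ^ (r - 1) := by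
  set q := r / (r - 1) with hq
  have hr1 : 0 < r - 1 := by linarith
  have hr2 : 0 < r - 2 := by linarith
  have hq1 : 1 ≤ q := by rw [hq, le_div_iff₀ hr1]; linarith
  have hqsub : 1 - q = -(1 / (r - 1)) := by rw [hq]; field_simp; ring
  have hq0 : 0 < q := by linarith
  set T : (X → ℂ) → Y → ℂ := fun F y => ∫ x, K y x * F x ∂ν with hT
  change ∫⁻ y, ‖T F y‖ₑ ^ r ∂μ ≤ _
  set Λ := ∫⁻ x, ‖F x‖ₑ ^ q ∂ν with hΛ
  rcases eq_or_ne Λ 0 with h0 | h0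
  · have hF0 : F =ᵐ[ν] 0 := by
      have := (lintegral_eq_zero_iff (by fun_prop)).1 h0
      filter_upwards [this] with x hx
      simpa [ENNReal.rpow_eq_zero_iff, hq0, hq0.not_gt] using hx
    have hTF : ∀ y, T F y = 0 := by
      intro y
      refine integral_eq_zero_of_ae ?_
      filter_upwards [hF0] with x hx
      simp [hx]
    simp [hTF, ENNReal.zero_rpow_of_pos (by linarith : 0 < r)]
  set l := Λ.toReal with hl
  have hl0 : 0 < l := ENNReal.toReal_pos h0 hfin
  have hΛl : Λ = ENNReal.ofReal l := (ENNReal.ofReal_toReal hfin).symm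
  -- With q = r' one has 1 − q = −1/(r−1), so τ(s)^{1−q} = s/(2l). Hence the part of F above height
  -- τ(s) has L¹ norm at most s/2, and only the truncation remains for the L² bound at level s.
  set τ : ℝ → ℝ := fun s => (2 * l / s) ^ (r - 1) with hτ
  have hτpos : ∀ s, 0 < s → 0 < τ s := fun s hs => by positivity
  set Fs : ℝ → X → ℂ := fun s => {x | ‖F x‖ ≤ τ s}.indicator F with hFs
  have hmeas : ∀ s, MeasurableSet {x | ‖F x‖ ≤ τ s} := fun s =>
    measurableSet_le hF.norm measurable_const
  have hFsm : ∀ s, Measurable (Fs s) := fun s => hF.indicator (hmeas s)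
  have hFsi : ∀ s, Integrable (Fs s) ν := fun s => hFi.indicator (hmeas s)
  have hKi : ∀ G : X → ℂ, Integrable G ν → ∀ y, Integrable (fun x => K y x * G x) ν :=
    fun G hG y => hG.bdd_mul (hK y) (Filter.Eventually.of_forall (hK1 y))
  -- the large part of `F` contributes at most `s / 2`
  have hlarge : ∀ s, 0 < s → ∀ y, ‖T F y‖ ≤ ‖T (Fs s) y‖ + s / 2 := by
    intro s hs y
    have e : T F y = T (Fs s) y + ∫ x, K y x * (F x - Fs s x) ∂ν := by
      simp only [hT]
      rw [← integral_add (hKi _ (hFsi s) y) (hKi (fun x => F x - Fs s x) (hFi.sub (hFsi s)) y)]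
      refine integral_congr_ae (Filter.Eventually.of_forall fun x => ?_)
      simp only []
      ring
    rw [e]
    refine (norm_add_le _ _).trans (add_le_add le_rfl ?_)
    have h1 : ‖∫ x, K y x * (F x - Fs s x) ∂ν‖ₑ ≤ ENNReal.ofReal (s / 2) := by
      refine (enorm_integral_le_lintegral_enorm _).trans ?_
      have h3 : ∀ x, ‖K y x * (F x - Fs s x)‖ₑ
          ≤ {x | τ s < ‖F x‖}.indicator (fun x => ‖F x‖ₑ) x := by
        intro x
        by_cases hx : ‖F x‖ ≤ τ s
        · simp [hFs, hx]
        · have hx2 : τ s < ‖F x‖ := not_le.1 hx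
          rw [indicator_of_mem (by exact hx2), enorm_mul]
          have : Fs s x = 0 := indicator_of_notMem (by exact hx) _
          rw [this, sub_zero]
          calc ‖K y x‖ₑ * ‖F x‖ₑ ≤ 1 * ‖F x‖ₑ := by
                gcongr
                rw [← ofReal_norm]
                exact ENNReal.ofReal_le_one.2 (hK1 y x)
            _ = _ := one_mul _
      refine (lintegral_mono h3).trans ((lintegral_norm_gt_le hq1 (hτpos s hs)).trans_eq ?_)
      rw [← hΛ, hΛl, ← ENNReal.ofReal_mul (Real.rpow_nonneg (hτpos s hs).le _)]
      congr 1
      rw [hqsub, hτ]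
      simp only []
      rw [← Real.rpow_mul (by positivity)]
      have : (r - 1) * -(1 / (r - 1)) = -1 := by field_simp
      rw [this, Real.rpow_neg_one]
      field_simp
    rw [← ofReal_norm] at h1
    exact (ENNReal.ofReal_le_ofReal_iff (by positivity)).1 h1
  have hweak : ∀ s ∈ Ioi (0 : ℝ), μ {y | s < ‖T F y‖} * ENNReal.ofReal (s ^ (r - 1))
      ≤ A * ∫⁻ x, {x | ‖F x‖ ≤ τ s}.indicator
          (fun x => ENNReal.ofReal (4 * s ^ (r - 3)) * ‖F x‖ₑ ^ 2) x ∂ν := by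
    intro s hs
    have hs : 0 < s := hs
    have hsub : {y | s < ‖T F y‖} ⊆ {y | ENNReal.ofReal (s ^ 2 / 4) ≤ ‖T (Fs s) y‖ₑ ^ 2} := by
      intro y hy
      have hy : s < ‖T F y‖ := hy
      have h1 : s / 2 ≤ ‖T (Fs s) y‖ := by linarith [hlarge s hs y]
      change ENNReal.ofReal (s ^ 2 / 4) ≤ ‖T (Fs s) y‖ₑ ^ 2
      rw [← ofReal_norm, ← ENNReal.ofReal_pow (norm_nonneg _)]
      refine ENNReal.ofReal_le_ofReal ?_
      nlinarith
    have hmk := mul_meas_ge_le_lintegral (μ := μ) (f := fun y => ‖T (Fs s) y‖ₑ ^ 2)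
      ((hm _ (hFsm s) (hFsi s)).enorm.pow_const 2) (ENNReal.ofReal (s ^ 2 / 4))
    have h3 := hmk.trans (h2 _ (hFsm s) (hFsi s))
    have e1 : ENNReal.ofReal (s ^ (r - 1))
        = ENNReal.ofReal (4 * s ^ (r - 3)) * ENNReal.ofReal (s ^ 2 / 4) := by
      rw [← ENNReal.ofReal_mul (by positivity)]
      congr 1
      have : s ^ (r - 1) = s ^ (r - 3) * s ^ 2 := by
        rw [← Real.rpow_natCast s 2, ← Real.rpow_add hs]; norm_num; congr 1; ring
      rw [this]; ring
    calc μ {y | s < ‖T F y‖} * ENNReal.ofReal (s ^ (r - 1))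
        ≤ μ {y | ENNReal.ofReal (s ^ 2 / 4) ≤ ‖T (Fs s) y‖ₑ ^ 2} * ENNReal.ofReal (s ^ (r - 1)) := by
          gcongr
      _ = ENNReal.ofReal (4 * s ^ (r - 3)) * (ENNReal.ofReal (s ^ 2 / 4) *
          μ {y | ENNReal.ofReal (s ^ 2 / 4) ≤ ‖T (Fs s) y‖ₑ ^ 2}) := by
          rw [e1]; ring
      _ ≤ ENNReal.ofReal (4 * s ^ (r - 3)) * (A * ∫⁻ x, ‖Fs s x‖ₑ ^ 2 ∂ν) := by gcongr
      _ = A * ∫⁻ x, {x | ‖F x‖ ≤ τ s}.indicator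
          (fun x => ENNReal.ofReal (4 * s ^ (r - 3)) * ‖F x‖ₑ ^ 2) x ∂ν := by
          rw [mul_left_comm, ← lintegral_const_mul' _ _ ENNReal.ofReal_ne_top]
          congr 1
          refine lintegral_congr fun x => ?_
          by_cases hx : ‖F x‖ ≤ τ s
          · rw [indicator_of_mem (by exact hx)]
            simp [hFs, hx]
          · rw [indicator_of_notMem (by exact hx)]
            simp [hFs, hx]
  have hinner : ∀ x, ∫⁻ s in Ioi (0 : ℝ), {x | ‖F x‖ ≤ τ s}.indicator
          (fun x => ENNReal.ofReal (4 * s ^ (r - 3)) * ‖F x‖ₑ ^ 2) x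
        ≤ ENNReal.ofReal (4 * (2 * l) ^ (r - 2) / (r - 2)) * ‖F x‖ₑ ^ q := by
    intro x
    rcases eq_or_ne (F x) 0 with hx0 | hx0
    · refine le_trans (le_of_eq ?_) zero_le
      rw [← lintegral_zero]
      refine lintegral_congr fun s => ?_
      by_cases hx : ‖F x‖ ≤ τ s
      · rw [indicator_of_mem (by exact hx)]; simp [hx0]
      · rw [indicator_of_notMem (by exact hx)]
    set v := ‖F x‖ with hv
    have hv0 : 0 < v := norm_pos_iff.2 hx0
    -- The condition ‖F x‖ ≤ τ(s) is equivalent to s ≤ b for s > 0. The integral of s^{r−3} over (0,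
    -- b] converges because r > 2, and v² b^{r−2} is a multiple of v^q.
    set b := 2 * l * v ^ (-(1 / (r - 1))) with hb
    have hb0 : 0 < b := by positivity
    have hpt : ∀ s ∈ Ioi (0 : ℝ), {x | ‖F x‖ ≤ τ s}.indicator
          (fun x => ENNReal.ofReal (4 * s ^ (r - 3)) * ‖F x‖ₑ ^ 2) x
        ≤ (Ioc 0 b).indicator (fun s => ENNReal.ofReal (4 * v ^ 2) * ENNReal.ofReal (s ^ (r - 3))) s := by
      intro s hs
      have hs : 0 < s := hs
      by_cases hx : ‖F x‖ ≤ τ s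
      · have hsb : s ≤ b := by
          have h1 : v ^ (1 / (r - 1)) ≤ 2 * l / s := by
            have := Real.rpow_le_rpow hv0.le hx (by positivity : 0 ≤ 1 / (r - 1))
            simp only [hτ] at this
            rwa [← Real.rpow_mul (by positivity), mul_one_div_cancel hr1.ne', Real.rpow_one]
              at this
          rw [hb, Real.rpow_neg hv0.le, ← div_eq_mul_inv, le_div_iff₀ (by positivity)]
          rw [le_div_iff₀ hs] at h1
          linarith
        rw [indicator_of_mem (by exact hx), indicator_of_mem (by exact ⟨hs, hsb⟩)]
        rw [← ofReal_norm, ← hv, ← ENNReal.ofReal_pow hv0.le, ← ENNReal.ofReal_mul (by positivity),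
          ← ENNReal.ofReal_mul (by positivity)]
        exact ENNReal.ofReal_le_ofReal (le_of_eq (by ring))
      · rw [indicator_of_notMem (by exact hx)]
        exact zero_le
    refine (setLIntegral_mono' measurableSet_Ioi hpt).trans ?_
    refine (setLIntegral_le_lintegral _ _).trans ?_
    rw [lintegral_indicator measurableSet_Ioc, lintegral_const_mul' _ _ ENNReal.ofReal_ne_top,
      lintegral_Ioc_rpow (by linarith) hb0.le, ← ofReal_norm, ← hv, ENNReal.ofReal_rpow_of_pos hv0,
      ← ENNReal.ofReal_mul (by positivity), ← ENNReal.ofReal_mul (by positivity)]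
    refine ENNReal.ofReal_le_ofReal (le_of_eq ?_)
    have e1 : r - 3 + 1 = r - 2 := by ring
    have e2 : v ^ q = v ^ 2 * (v ^ (-(1 / (r - 1)))) ^ (r - 2) := by
      rw [← Real.rpow_mul hv0.le, ← Real.rpow_natCast v 2, ← Real.rpow_add hv0, hq]
      congr 1
      push_cast
      field_simp
      ring
    rw [e1, hb, Real.mul_rpow (by positivity) (by positivity), e2]
    ring
  have hlayer : ∫⁻ y, ‖T F y‖ₑ ^ r ∂μ = ENNReal.ofReal r *
      ∫⁻ s in Ioi (0 : ℝ), μ {y | s < ‖T F y‖} * ENNReal.ofReal (s ^ (r - 1)) := by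
    rw [← lintegral_rpow_eq_lintegral_meas_lt_mul μ
      (Filter.Eventually.of_forall fun y => norm_nonneg (T F y))
      (hm F hF hFi).norm.aemeasurable (by linarith)]
    refine lintegral_congr fun y => ?_
    rw [← ofReal_norm, ENNReal.ofReal_rpow_of_nonneg (norm_nonneg _) (by linarith)]
  have hjoint : Measurable (Function.uncurry fun (s : ℝ) (x : X) => {x | ‖F x‖ ≤ τ s}.indicator
          (fun x => ENNReal.ofReal (4 * s ^ (r - 3)) * ‖F x‖ₑ ^ 2) x) := by
    have hset : MeasurableSet {p : ℝ × X | ‖F p.2‖ ≤ τ p.1} := by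
      refine measurableSet_le (hF.comp measurable_snd).norm ?_
      simp only [hτ]
      fun_prop
    have hfun : Measurable fun p : ℝ × X =>
        ENNReal.ofReal (4 * p.1 ^ (r - 3)) * ‖F p.2‖ₑ ^ 2 := by fun_prop
    exact hfun.indicator hset
  calc ∫⁻ y, ‖T F y‖ₑ ^ r ∂μ
      ≤ ENNReal.ofReal r * ∫⁻ s in Ioi (0 : ℝ), A * ∫⁻ x, {x | ‖F x‖ ≤ τ s}.indicator
          (fun x => ENNReal.ofReal (4 * s ^ (r - 3)) * ‖F x‖ₑ ^ 2) x ∂ν := by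
        rw [hlayer]
        exact mul_le_mul_right (setLIntegral_mono' measurableSet_Ioi hweak) _
    _ = ENNReal.ofReal r * (A * ∫⁻ x, (∫⁻ s in Ioi (0 : ℝ), {x | ‖F x‖ ≤ τ s}.indicator
          (fun x => ENNReal.ofReal (4 * s ^ (r - 3)) * ‖F x‖ₑ ^ 2) x) ∂ν) := by
        rw [lintegral_const_mul _ (Measurable.lintegral_prod_right hjoint),
          lintegral_lintegral_swap hjoint.aemeasurable]
    _ ≤ ENNReal.ofReal r * (A * ∫⁻ x, ENNReal.ofReal (4 * (2 * l) ^ (r - 2) / (r - 2))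
          * ‖F x‖ₑ ^ q ∂ν) := by
        gcongr with x
        exact hinner x
    _ = ENNReal.ofReal (r * 2 ^ r / (r - 2)) * A * Λ ^ (r - 1) := by
        rw [lintegral_const_mul' _ _ ENNReal.ofReal_ne_top, ← hΛ, hΛl,
          ENNReal.ofReal_rpow_of_pos hl0, mul_left_comm, ← ENNReal.ofReal_mul (by positivity),
          ← ENNReal.ofReal_mul (by positivity), mul_comm _ A, mul_assoc,
          ← ENNReal.ofReal_mul (by positivity)]
        congr 2
        rw [Real.mul_rpow (by norm_num) hl0.le]
        have e1 : (2 : ℝ) ^ r = 2 ^ (r - 2) * 4 := by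
          rw [Real.rpow_sub (by norm_num)]; norm_num
        have e2 : l ^ (r - 1) = l ^ (r - 2) * l := by
          rw [← Real.rpow_add_one hl0.ne']; congr 1; ring
        rw [e1, e2]
        ring

end Interpolation

/-! ### Anisotropic rescaling of a nondegenerate curve to a near-moment curve. -/

section Frame

/-- Differentiating the Taylor remainder once gives the remainder of order one less for the
derivative, and the mean value inequality supplies one more factor b − a. The factorial in the
denominator is not needed. -/
theorem taylor_bound_of_hasDerivWithinAt {E : Type*} [NormedAddCommGroup E] [NormedSpace ℝ E]
    (n : ℕ) {C : ℝ} (D : ℕ → ℝ → E)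
    (hD : ∀ j < n, ∀ t ∈ Icc (0 : ℝ) 1, HasDerivWithinAt (D j) (D (j + 1) t) (Icc 0 1) t)
    (hC : ∀ t ∈ Icc (0 : ℝ) 1, ‖D n t‖ ≤ C) {a b : ℝ} (ha : 0 ≤ a) (hab : a ≤ b) (hb : b ≤ 1) :
    ‖D 0 b - ∑ j ∈ Finset.range n, ((b - a) ^ j / (j.factorial : ℝ)) • D j a‖
      ≤ C * (b - a) ^ n := by
  induction n generalizing D b with
  | zero => simpa using hC b ⟨ha.trans hab, hb⟩
  | succ n ih =>
    have hC0 : 0 ≤ C := (norm_nonneg _).trans (hC 0 (by simp))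
    set φ : ℝ → E := fun t =>
      D 0 t - ∑ j ∈ Finset.range (n + 1), ((t - a) ^ j / (j.factorial : ℝ)) • D j a with hφ
    have hsub : Icc a b ⊆ Icc (0 : ℝ) 1 := Icc_subset_Icc ha hb
    have hder : ∀ t ∈ Icc a b, HasDerivWithinAt φ
        (D 1 t - ∑ j ∈ Finset.range n, ((t - a) ^ j / (j.factorial : ℝ)) • D (j + 1) a)
        (Icc a b) t := by
      intro t ht
      refine ((hD 0 (Nat.succ_pos n) t (hsub ht)).mono hsub).sub ?_
      have hs : ∀ j : ℕ, HasDerivWithinAt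
          (fun t => ((t - a) ^ j / (j.factorial : ℝ)) • D j a)
          (((j : ℝ) * (t - a) ^ (j - 1) / (j.factorial : ℝ)) • D j a) (Icc a b) t := by
        intro j
        have h1 : HasDerivAt (fun t : ℝ => (t - a) ^ j) ((j : ℝ) * (t - a) ^ (j - 1)) t := by
          simpa using ((hasDerivAt_id t).sub_const a).fun_pow j
        exact ((h1.div_const _).smul_const _).hasDerivWithinAt
      have := HasDerivWithinAt.fun_sum (u := Finset.range (n + 1)) fun j _ => hs j
      refine this.congr_deriv ?_
      rw [Finset.sum_range_succ']
      simp only [Nat.cast_zero, zero_mul, zero_div, zero_smul, add_zero]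
      refine Finset.sum_congr rfl fun j _ => ?_
      congr 1
      rw [Nat.factorial_succ]
      push_cast
      have : ((j : ℝ) + 1) ≠ 0 := by positivity
      field_simp
    have hbd : ∀ t ∈ Ico a b,
        ‖D 1 t - ∑ j ∈ Finset.range n, ((t - a) ^ j / (j.factorial : ℝ)) • D (j + 1) a‖
          ≤ C * (b - a) ^ n := by
      intro t ht
      have := ih (fun j => D (j + 1)) (fun j hj => hD (j + 1) (by omega)) hC ht.1
        (ht.2.le.trans hb)
      refine this.trans ?_
      have h1 : 0 ≤ t - a := by linarith [ht.1]
      have h2 : t - a ≤ b - a := by linarith [ht.2]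
      gcongr
    have hfin := norm_image_sub_le_of_norm_deriv_le_segment' hder hbd b ⟨hab, le_rfl⟩
    have hφa : φ a = 0 := by
      simp only [hφ, sub_self]
      rw [Finset.sum_range_succ']
      simp
    rw [hφa, sub_zero] at hfin
    refine hfin.trans (le_of_eq ?_)
    ring

theorem EuclideanSpace.abs_apply_le_norm {d : ℕ} (x : EuclideanSpace ℝ (Fin d)) (i : Fin d) :
    |x i| ≤ ‖x‖ := by
  simpa using PiLp.norm_apply_le x i

theorem EuclideanSpace.norm_le_sum_abs {d : ℕ} (x : EuclideanSpace ℝ (Fin d)) :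
    ‖x‖ ≤ ∑ i, |x i| := by
  rw [EuclideanSpace.norm_eq]
  refine Real.sqrt_le_iff.2 ⟨Finset.sum_nonneg fun _ _ => abs_nonneg _, ?_⟩
  exact Finset.sum_sq_le_sq_sum_of_nonneg fun _ _ => abs_nonneg _

/-- In the coordinates `Y` the curve `γ` on `[a, a + h]` is, after anisotropic rescaling, the curve
`g` on `[0, 1]`, which is `C¹`-close to the moment curve. -/
structure CurveFrame {d : ℕ} (γ : ℝ → EuclideanSpace ℝ (Fin d)) (C₀ a h : ℝ)
    (g g' : ℝ → Fin d → ℝ) (Y : EuclideanSpace ℝ (Fin d) → Fin d → ℝ) : Prop where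
  inner_eq : ∀ x s, inner ℝ x (γ (a + h * s)) =
    inner ℝ x (γ a) + ∑ j : Fin d, h ^ ((j : ℕ) + 1) * Y x j * g s j
  hasDeriv : ∀ j, ∀ s ∈ Icc (0 : ℝ) 1, HasDerivWithinAt (fun t => g t j) (g' s j) (Icc 0 1) s
  deriv_close : ∀ j : Fin d, ∀ s ∈ Icc (0 : ℝ) 1,
    |g' s j - s ^ (j : ℕ) / ((j : ℕ).factorial : ℝ)| ≤ C₀ * h
  bounded : ∀ j, ∀ s ∈ Icc (0 : ℝ) 1, |g s j| ≤ C₀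
  coord_le : ∀ x j, |Y x j| ≤ C₀ * ‖x‖
  dist_le : ∀ x x' τ, 0 ≤ τ → (∀ j, |Y x j - Y x' j| ≤ τ) → dist x x' ≤ C₀ * τ
  continuous_coord : ∀ j, Continuous fun x => Y x j

/-- Along every interval `[a, a + h]` a nondegenerate curve is, in the coordinates dual to
`γ'(a), …, γ^{(d)}(a)` and after anisotropic rescaling, `C¹`-close to the moment curve. -/
theorem IsNondegenerateCurve.exists_frame {d : ℕ} {γ : ℝ → EuclideanSpace ℝ (Fin d)}
    (hγ : IsNondegenerateCurve γ) :
    ∃ C₀ : ℝ, 1 ≤ C₀ ∧ ∀ a h : ℝ, 0 ≤ a → 0 < h → a + h ≤ 1 →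
      ∃ g g' Y, CurveFrame γ C₀ a h g g' Y := by
  set D : ℕ → ℝ → EuclideanSpace ℝ (Fin d) := fun j => iteratedDerivWithin j γ (Icc (0 : ℝ) 1)
    with hDdef
  have hu : UniqueDiffOn ℝ (Icc (0 : ℝ) 1) := uniqueDiffOn_Icc one_pos
  have hDcont : ∀ j ≤ d + 1, ContinuousOn (D j) (Icc 0 1) := fun j hj =>
    hγ.contDiffOn.continuousOn_iteratedDerivWithin (by exact_mod_cast hj) hu
  have hDder : ∀ j ≤ d, ∀ t ∈ Icc (0 : ℝ) 1,
      HasDerivWithinAt (D j) (D (j + 1) t) (Icc 0 1) t := by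
    intro j hj t ht
    have h1 : DifferentiableWithinAt ℝ (D j) (Icc 0 1) t :=
      hγ.contDiffOn.differentiableOn_iteratedDerivWithin (by exact_mod_cast Nat.lt_succ_of_le hj)
        hu t ht
    have := h1.hasDerivWithinAt
    simpa only [hDdef, iteratedDerivWithin_succ] using this
  have hD0 : D 0 = γ := by
    simp only [hDdef, iteratedDerivWithin_zero]
  set M : ℝ → Matrix (Fin d) (Fin d) ℝ := fun t => Matrix.of fun i j : Fin d => D ((j : ℕ) + 1) t i
    with hM
  have hMdet : ∀ t ∈ Icc (0 : ℝ) 1, (M t).det ≠ 0 := hγ.det_ne_zero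
  have hMcont : ContinuousOn M (Icc 0 1) := by
    refine continuousOn_pi.2 fun i => continuousOn_pi.2 fun j => ?_
    have h1 := hDcont ((j : ℕ) + 1) (by omega)
    exact (EuclideanSpace.proj (𝕜 := ℝ) i).continuous.comp_continuousOn h1
  have hNcont : ContinuousOn (fun t => (M t)⁻¹) (Icc 0 1) := by
    have hdetc : ContinuousOn (fun t => (M t).det) (Icc 0 1) :=
      Continuous.comp_continuousOn (continuous_id.matrix_det) hMcont
    have hadj : ContinuousOn (fun t => (M t).adjugate) (Icc 0 1) :=
      Continuous.comp_continuousOn (g := Matrix.adjugate) (continuous_id.matrix_adjugate) hMcont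
    have e : ∀ t, (M t)⁻¹ = ((M t).det)⁻¹ • (M t).adjugate := fun t => by
      rw [Matrix.inv_def, Ring.inverse_eq_inv']
    simp_rw [e]
    exact (hdetc.inv₀ hMdet).smul hadj
  have hbound : ∀ A : ℝ → Matrix (Fin d) (Fin d) ℝ, ContinuousOn A (Icc 0 1) →
      ∃ C : ℝ, 0 ≤ C ∧ ∀ t ∈ Icc (0 : ℝ) 1, ∀ i j, |A t i j| ≤ C := by
    intro A hA
    have h1 : ContinuousOn (fun t => ∑ i, ∑ j, |A t i j|) (Icc 0 1) := by
      refine continuousOn_finsetSum _ fun i _ => continuousOn_finsetSum _ fun j _ => ?_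
      exact (continuousOn_pi.1 (continuousOn_pi.1 hA i) j).abs
    obtain ⟨C, hC⟩ := isCompact_Icc.exists_bound_of_continuousOn h1
    have hle : ∀ t ∈ Icc (0 : ℝ) 1, ∀ i j, |A t i j| ≤ C := by
      intro t ht i j
      calc |A t i j| ≤ ∑ j, |A t i j| :=
            Finset.single_le_sum (f := fun j => |A t i j|) (fun _ _ => abs_nonneg _)
              (Finset.mem_univ j)
        _ ≤ ∑ i, ∑ j, |A t i j| :=
            Finset.single_le_sum (f := fun i => ∑ j, |A t i j|)
              (fun _ _ => Finset.sum_nonneg fun _ _ => abs_nonneg _) (Finset.mem_univ i)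
        _ ≤ ‖∑ i, ∑ j, |A t i j|‖ := le_abs_self _
        _ ≤ C := hC t ht
    exact ⟨C, (norm_nonneg _).trans (hC 0 (by simp)), hle⟩
  obtain ⟨C₁, hC₁0, hC₁⟩ := hbound _ hMcont
  obtain ⟨C₂, hC₂0, hC₂⟩ := hbound _ hNcont
  obtain ⟨C₃, hC₃⟩ := isCompact_Icc.exists_bound_of_continuousOn (hDcont (d + 1) le_rfl)
  have hC₃0 : 0 ≤ C₃ := (norm_nonneg _).trans (hC₃ 0 (by simp))
  -- The four summands control, in order: the speed of the moment curve, the size of `Y`, the Taylor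
  -- error of `g'`, and the inverse of `Y`.
  set C₀ : ℝ := 1 + d * C₁ + d * C₂ * C₃ + d * (d * C₂) with hC₀
  have hp1 : 0 ≤ d * C₁ := by positivity
  have hp2 : 0 ≤ d * C₂ * C₃ := by positivity
  have hp3 : 0 ≤ d * (d * C₂) := by positivity
  refine ⟨C₀, by linarith, fun a h ha hh hah => ?_⟩
  have haI : a ∈ Icc (0 : ℝ) 1 := ⟨ha, by linarith⟩
  have hh1 : h ≤ 1 := by linarith
  set N := (M a)⁻¹ with hN
  have hNM : N * M a = 1 := Matrix.nonsing_inv_mul _ (isUnit_iff_ne_zero.2 (hMdet a haI))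
  have hMN : M a * N = 1 := Matrix.mul_nonsing_inv _ (isUnit_iff_ne_zero.2 (hMdet a haI))
  have hsI : ∀ s ∈ Icc (0 : ℝ) 1, a + h * s ∈ Icc (0 : ℝ) 1 := fun s hs =>
    ⟨by nlinarith [hs.1], by nlinarith [hs.2]⟩
  -- `N` expresses γ(a + hs) − γ(a) in the basis γ'(a), …, γ^(d)(a). Index j, counted from zero,
  -- belongs to γ^(j+1) and is rescaled by h^{j+1}; `Y` pairs x with the same basis.
  set g : ℝ → Fin d → ℝ := fun s j =>
    (h ^ ((j : ℕ) + 1))⁻¹ * ∑ i, N j i * (γ (a + h * s) i - γ a i) with hg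
  set g' : ℝ → Fin d → ℝ := fun s j => (h ^ (j : ℕ))⁻¹ * ∑ i, N j i * D 1 (a + h * s) i with hg'
  set Y : EuclideanSpace ℝ (Fin d) → Fin d → ℝ := fun x j => ∑ i, x i * M a i j with hY
  have hgder : ∀ j, ∀ s ∈ Icc (0 : ℝ) 1,
      HasDerivWithinAt (fun t => g t j) (g' s j) (Icc 0 1) s := by
    intro j s hs
    have h1 : HasDerivWithinAt (fun t : ℝ => a + h * t) h (Icc 0 1) s := by
      simpa using ((hasDerivAt_id s).const_mul h |>.const_add a).hasDerivWithinAt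
    have h2 : HasDerivWithinAt (fun t => γ (a + h * t)) (h • D 1 (a + h * s)) (Icc 0 1) s := by
      have := hDder 0 (Nat.zero_le _) (a + h * s) (hsI s hs)
      rw [hD0] at this
      exact this.scomp s h1 hsI
    have h3 : ∀ i, HasDerivWithinAt (fun t => γ (a + h * t) i) (h * D 1 (a + h * s) i)
        (Icc 0 1) s := fun i => by
      have := (EuclideanSpace.proj (𝕜 := ℝ) i).hasFDerivAt.comp_hasDerivWithinAt s h2
      exact this.congr_deriv (by simp)
    have h4 : HasDerivWithinAt (fun t => g t j)
        ((h ^ ((j : ℕ) + 1))⁻¹ * ∑ i, N j i * (h * D 1 (a + h * s) i)) (Icc 0 1) s :=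
      (HasDerivWithinAt.fun_sum fun i _ => ((h3 i).sub_const _).const_mul _).const_mul _
    refine h4.congr_deriv ?_
    simp only [hg']
    rw [Finset.mul_sum, Finset.mul_sum]
    refine Finset.sum_congr rfl fun i _ => ?_
    field_simp
    ring
  have hclose : ∀ j : Fin d, ∀ s ∈ Icc (0 : ℝ) 1,
      |g' s j - s ^ (j : ℕ) / ((j : ℕ).factorial : ℝ)| ≤ d * C₂ * C₃ * h := by
    intro j s hs
    set rem := D 1 (a + h * s) - ∑ m ∈ Finset.range d,
      ((h * s) ^ m / (m.factorial : ℝ)) • D (m + 1) a with hrem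
    have hremle : ‖rem‖ ≤ C₃ * (h * s) ^ d := by
      have := taylor_bound_of_hasDerivWithinAt d (C := C₃) (fun j => D (j + 1))
        (fun j hj => hDder (j + 1) hj) hC₃ (a := a) (b := a + h * s) ha
        (by nlinarith [hs.1]) (hsI s hs).2
      simpa [hrem] using this
    have hcomp : ∀ i, D 1 (a + h * s) i = rem i + ∑ m : Fin d,
        M a i m * ((h * s) ^ (m : ℕ) / ((m : ℕ).factorial : ℝ)) := by
      intro i
      have : D 1 (a + h * s) = rem + ∑ m ∈ Finset.range d,
        ((h * s) ^ m / (m.factorial : ℝ)) • D (m + 1) a := by rw [hrem]; abel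
      rw [this, Finset.sum_range]
      simp only [PiLp.add_apply, WithLp.ofLp_sum, Finset.sum_apply, PiLp.smul_apply, smul_eq_mul,
        hM, Matrix.of_apply]
      congr 1
      exact Finset.sum_congr rfl fun m _ => mul_comm _ _
    have hsum : ∑ i, N j i * D 1 (a + h * s) i = ∑ i, N j i * rem i +
        (h * s) ^ (j : ℕ) / ((j : ℕ).factorial : ℝ) := by
      simp_rw [hcomp, mul_add, Finset.sum_add_distrib]
      congr 1
      have h1 := congrFun (congrArg (fun A : Matrix (Fin d) (Fin d) ℝ =>
        A.mulVec fun m : Fin d => (h * s) ^ (m : ℕ) / ((m : ℕ).factorial : ℝ)) hNM) j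
      simp only [← Matrix.mulVec_mulVec, Matrix.one_mulVec] at h1
      exact h1
    have heq : g' s j - s ^ (j : ℕ) / ((j : ℕ).factorial : ℝ)
        = (h ^ (j : ℕ))⁻¹ * ∑ i, N j i * rem i := by
      simp only [hg']
      rw [hsum, mul_pow]
      field_simp
      ring
    have hsle : |∑ i, N j i * rem i| ≤ d * C₂ * C₃ * h ^ d := by
      refine (Finset.abs_sum_le_sum_abs _ _).trans ?_
      calc ∑ i, |N j i * rem i| ≤ ∑ _i : Fin d, C₂ * (C₃ * h ^ d) := by
            refine Finset.sum_le_sum fun i _ => ?_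
            rw [abs_mul]
            refine mul_le_mul (hC₂ a haI j i) ?_ (abs_nonneg _) hC₂0
            refine (EuclideanSpace.abs_apply_le_norm rem i).trans (hremle.trans ?_)
            have : h * s ≤ h := by nlinarith [hs.2]
            have h0 : 0 ≤ h * s := by nlinarith [hs.1]
            gcongr
        _ = _ := by simp; ring
    rw [heq, abs_mul, abs_inv, abs_of_pos (by positivity : 0 < h ^ (j : ℕ)),
      inv_mul_le_iff₀ (by positivity)]
    refine hsle.trans ?_
    -- As j + 1 ≤ d, a remainder of size h^d divided by h^j is still O(h) in every coordinate.
    have : h ^ d ≤ h ^ ((j : ℕ) + 1) := pow_le_pow_of_le_one hh.le hh1 j.2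
    calc d * C₂ * C₃ * h ^ d ≤ d * C₂ * C₃ * h ^ ((j : ℕ) + 1) := by gcongr
      _ = _ := by ring
  refine ⟨g, g', Y, ?_, hgder, ?_, ?_, ?_, ?_, fun j => by simp only [hY]; fun_prop⟩
  · intro x s
    have h1 : ∀ j : Fin d, h ^ ((j : ℕ) + 1) * Y x j * g s j
        = ∑ i', ∑ i, x i' * (M a i' j * N j i) * (γ (a + h * s) i - γ a i) := by
      intro j
      simp only [hg, hY]
      have : h ^ ((j : ℕ) + 1) ≠ 0 := by positivity
      rw [mul_assoc, mul_left_comm, mul_inv_cancel_left₀ this, Finset.sum_mul_sum]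
      refine Finset.sum_congr rfl fun i' _ => Finset.sum_congr rfl fun i _ => by ring
    simp_rw [h1]
    rw [Finset.sum_comm]
    have h2 : ∀ i', ∑ j, ∑ i, x i' * (M a i' j * N j i) * (γ (a + h * s) i - γ a i)
        = x i' * (γ (a + h * s) i' - γ a i') := by
      intro i'
      rw [Finset.sum_comm]
      have h3 : ∀ i, ∑ j, x i' * (M a i' j * N j i) * (γ (a + h * s) i - γ a i)
          = x i' * (1 : Matrix (Fin d) (Fin d) ℝ) i' i * (γ (a + h * s) i - γ a i) := by
        intro i
        rw [← Finset.sum_mul, ← Finset.mul_sum, ← hMN, Matrix.mul_apply]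
      simp_rw [h3, Matrix.one_apply]
      simp
    simp_rw [h2, mul_sub]
    rw [Finset.sum_sub_distrib]
    simp only [PiLp.inner_apply, RCLike.inner_apply, conj_trivial]
    simp_rw [mul_comm (x _)]
    ring
  · intro j s hs
    refine (hclose j s hs).trans ?_
    gcongr
    linarith
  · intro j s hs
    have hg0 : g 0 j = 0 := by simp [hg]
    have hb : ∀ t ∈ Ico (0 : ℝ) 1, ‖g' t j‖ ≤ 1 + d * C₂ * C₃ := by
      intro t ht
      have h1 := hclose j t ⟨ht.1, ht.2.le⟩
      have h2 : |t ^ (j : ℕ) / ((j : ℕ).factorial : ℝ)| ≤ 1 := by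
        rw [abs_of_nonneg (by have := ht.1; positivity), div_le_one (by positivity)]
        exact (pow_le_one₀ ht.1 ht.2.le).trans (by exact_mod_cast Nat.succ_le_of_lt (Nat.factorial_pos _))
      have h3 := abs_sub_abs_le_abs_sub (g' t j) (t ^ (j : ℕ) / ((j : ℕ).factorial : ℝ))
      rw [Real.norm_eq_abs]
      have h4 : d * C₂ * C₃ * h ≤ d * C₂ * C₃ := mul_le_of_le_one_right hp2 hh1
      linarith
    have := norm_image_sub_le_of_norm_deriv_le_segment' (hgder j) hb s hs
    rw [hg0, sub_zero, sub_zero, Real.norm_eq_abs] at this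
    have h5 : (1 + d * C₂ * C₃) * s ≤ 1 + d * C₂ * C₃ :=
      mul_le_of_le_one_right (by linarith) hs.2
    linarith
  · intro x j
    simp only [hY]
    refine (Finset.abs_sum_le_sum_abs _ _).trans ?_
    calc ∑ i, |x i * M a i j| ≤ ∑ _i : Fin d, ‖x‖ * C₁ := by
          refine Finset.sum_le_sum fun i _ => ?_
          rw [abs_mul]
          exact mul_le_mul (EuclideanSpace.abs_apply_le_norm x i) (hC₁ a haI i j) (abs_nonneg _)
            (norm_nonneg _)
      _ = d * C₁ * ‖x‖ := by simp; ring
      _ ≤ C₀ * ‖x‖ := by gcongr; linarith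
  · intro x x' τ hτ0 hτ
    have hx : ∀ i, (x - x') i = ∑ j, (Y x j - Y x' j) * N j i := by
      intro i
      have h1 := congrFun (congrArg (fun A : Matrix (Fin d) (Fin d) ℝ =>
        A.vecMul fun m : Fin d => (x - x') m) hMN) i
      simp only [← Matrix.vecMul_vecMul, Matrix.vecMul_one] at h1
      rw [← h1]
      simp only [Matrix.vecMul, dotProduct, hY]
      refine Finset.sum_congr rfl fun j _ => ?_
      rw [← Finset.sum_sub_distrib]
      congr 1
      refine Finset.sum_congr rfl fun m _ => ?_
      simp only [PiLp.sub_apply]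
      ring
    rw [dist_eq_norm]
    refine (EuclideanSpace.norm_le_sum_abs _).trans ?_
    calc ∑ i, |(x - x') i| ≤ ∑ _i : Fin d, ∑ _j : Fin d, τ * C₂ := by
          refine Finset.sum_le_sum fun i _ => ?_
          rw [hx]
          refine (Finset.abs_sum_le_sum_abs _ _).trans (Finset.sum_le_sum fun j _ => ?_)
          rw [abs_mul]
          exact mul_le_mul (hτ j) (hC₂ a haI j i) (abs_nonneg _) hτ0
      _ = d * (d * C₂) * τ := by simp; ring
      _ ≤ C₀ * τ := by gcongr; linarith

end Frame

/-! ### Measure and number of the anisotropic cells: the origin of β. -/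

section Cells

/-- The box is cut into cubes on which `Y` varies by at most 2ρ in each coordinate. Such a cube lies
within 2C₀ρ of any of its points, and the radius 3C₀ρ leaves room because the balls are open. -/
theorem measure_box_le {d : ℕ} {Y : EuclideanSpace ℝ (Fin d) → Fin d → ℝ} {C₀ : ℝ} (hC₀ : 1 ≤ C₀)
    (hY : ∀ x x' τ, 0 ≤ τ → (∀ j, |Y x j - Y x' j| ≤ τ) → dist x x' ≤ C₀ * τ)
    {μ : Measure (EuclideanSpace ℝ (Fin d))} {G : ℝ≥0∞} {α : ℝ}
    (hμ : ∀ x r, 0 < r → μ (Metric.ball x r) ≤ G * ENNReal.ofReal (r ^ α))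
    {ρ : ℝ} (hρ : 0 < ρ) (c L : Fin d → ℝ) (hL : ∀ j, 0 ≤ L j) :
    μ {x | ∀ j, |Y x j - c j| ≤ L j}
      ≤ ENNReal.ofReal (∏ j, (2 * (L j / ρ) + 2)) * (G * ENNReal.ofReal ((3 * C₀ * ρ) ^ α)) := by
  classical
  set S : Finset (Fin d → ℤ) := Fintype.piFinset fun j => Finset.Icc ⌊-(L j / ρ)⌋ ⌊L j / ρ⌋ with hS
  set Q : (Fin d → ℤ) → Set (EuclideanSpace ℝ (Fin d)) :=
    fun m => {x | ∀ j, |(Y x j - c j) - ρ * m j| ≤ ρ} with hQ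
  have hcov : {x | ∀ j, |Y x j - c j| ≤ L j} ⊆ ⋃ m ∈ S, Q m := by
    intro x hx
    refine mem_iUnion₂.2 ⟨fun j => ⌊(Y x j - c j) / ρ⌋,
      Fintype.mem_piFinset.2 fun j => floor_div_mem_Icc hρ (hx j), fun j => ?_⟩
    exact abs_sub_mul_floor_le hρ _
  have hQle : ∀ m, μ (Q m) ≤ G * ENNReal.ofReal ((3 * C₀ * ρ) ^ α) := by
    intro m
    rcases (Q m).eq_empty_or_nonempty with he | ⟨x₀, hx₀⟩
    · simp [he]
    · refine (measure_mono fun x hx => ?_).trans (hμ x₀ (3 * C₀ * ρ) (by positivity))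
      have := hY x x₀ (2 * ρ) (by positivity) fun j => by
        have h1 := abs_sub_le_iff.1 (hx j)
        have h2 := abs_sub_le_iff.1 (hx₀ j)
        rw [abs_le]
        constructor <;> linarith [h1.1, h1.2, h2.1, h2.2]
      rw [Metric.mem_ball]
      nlinarith
  calc μ {x | ∀ j, |Y x j - c j| ≤ L j} ≤ ∑ m ∈ S, μ (Q m) :=
        (measure_mono hcov).trans (measure_biUnion_finset_le _ _)
    _ ≤ S.card • (G * ENNReal.ofReal ((3 * C₀ * ρ) ^ α)) :=
        Finset.sum_le_card_nsmul _ _ _ fun m _ => hQle m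
    _ ≤ _ := by
        rw [nsmul_eq_mul, ENNReal.ofReal_prod_of_nonneg fun j _ => by
          have := div_nonneg (hL j) hρ.le; positivity]
        gcongr
        rw [hS, Fintype.card_piFinset]
        push_cast
        exact Finset.prod_le_prod' fun j _ => card_Icc_floor_le (div_nonneg (hL j) hρ.le)

/-- Truncated subtraction kills the terms with e < m, leaving 1 + … + n. -/
theorem sum_tsub_mul_two (m n : ℕ) :
    (∑ e ∈ Finset.range (m + n), (e + 1 - m)) * 2 = n * (n + 1) := by
  induction n with
  | zero =>
    have h : ∀ e ∈ Finset.range (m + 0), e + 1 - m = 0 := fun e he => by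
      have := Finset.mem_range.1 he
      omega
    rw [Finset.sum_eq_zero h, zero_mul, zero_mul]
  | succ n ih =>
    rw [← add_assoc, Finset.sum_range_succ, add_mul, ih]
    have : m + n + 1 - m = n + 1 := by omega
    rw [this]
    ring

/-- This is the form in which β appears in the count: j₀(α − ℓ) comes from the side of the covering
cubes, and the sum of (e − j₀)_+ over e = 1, …, k from their number. Raising j₀ by one changes the
total by j₀ − (d − α), so j₀ = [d − α] + 1 is a minimiser. -/
theorem betaExp_sub_eq {k ℓ : ℕ} {α : ℝ} {j₀ : ℕ} (hj : j₀ = ⌊((k + ℓ : ℕ) : ℝ) - α⌋₊ + 1)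
    (hjk : j₀ ≤ k) :
    betaExp k (α - ℓ) = j₀ * (α - ℓ) + ((∑ e : Fin k, ((e : ℕ) + 1 - j₀) : ℕ) : ℝ) := by
  have h1 : (k : ℝ) - (α - ℓ) = ((k + ℓ : ℕ) : ℝ) - α := by push_cast; ring
  obtain ⟨n, rfl⟩ := Nat.exists_eq_add_of_le hjk
  have h2 : (((∑ e : Fin (j₀ + n), ((e : ℕ) + 1 - j₀) : ℕ) : ℝ)) * 2 = n * (n + 1) := by
    rw [Fin.sum_univ_eq_sum_range (fun e => e + 1 - j₀)]
    exact_mod_cast sum_tsub_mul_two j₀ n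
  have h3 : (⌊((j₀ + n : ℕ) : ℝ) - (α - ℓ)⌋₊ : ℝ) = j₀ - 1 := by
    have : (j₀ : ℝ) = ⌊((j₀ + n + ℓ : ℕ) : ℝ) - α⌋₊ + 1 := by exact_mod_cast hj
    rw [h1]
    linarith
  rw [betaExp, h3]
  have h4 : (((∑ e : Fin (j₀ + n), ((e : ℕ) + 1 - j₀) : ℕ) : ℝ)) = n * (n + 1) / 2 := by linarith
  rw [h4]
  push_cast
  ring

/-- Number of cubes of side ρ₀ = r h^{-j₀} needed across a cell of half-width r h^{-e}. The
truncated exponent e − j₀ records that O(1) cubes suffice when e ≤ j₀. -/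
theorem cell_factor_low {C₀ h r ρ₀ : ℝ} (hh : 0 < h) (hh1 : h ≤ 1) (hr : 0 < r) {j₀ e : ℕ}
    (hρ₀ : ρ₀ = r * (h ^ j₀)⁻¹) :
    2 * (min C₀ (r * (h ^ e)⁻¹) / ρ₀) + 2 ≤ 4 * (h ^ (e - j₀))⁻¹ := by
  have hρpos : 0 < ρ₀ := by rw [hρ₀]; positivity
  have h1 : min C₀ (r * (h ^ e)⁻¹) / ρ₀ ≤ (h ^ (e - j₀))⁻¹ := by
    rw [div_le_iff₀ hρpos]
    refine (min_le_right _ _).trans ?_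
    rw [hρ₀, mul_left_comm, ← mul_inv, ← pow_add]
    gcongr _ * ?_
    exact inv_anti₀ (by positivity) (pow_le_pow_of_le_one hh.le hh1 (by omega))
  have h2 : 1 ≤ (h ^ (e - j₀))⁻¹ := (one_le_inv₀ (by positivity)).2 (pow_le_one₀ hh.le hh1)
  linarith

/-- In a free direction the number of lattice cells multiplies the number of cubes per cell.
Together they count cubes of side ρ₀ across a range of length about C₀, whence ρ₀^{-1} in both
regimes: many narrow cells if r ≤ h^e, boundedly many cells if r ≥ h^e. -/
theorem cell_factor_high {C₀ h r ρ₀ : ℝ} (hC₀ : 1 ≤ C₀) (hh : 0 < h) (hh1 : h ≤ 1) (hr : 0 < r)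
    {j₀ e : ℕ} (hje : j₀ ≤ e) (hρ₀ : ρ₀ = r * (h ^ j₀)⁻¹) (hle : ρ₀ ≤ 1) :
    (2 * (C₀ * h ^ e / r) + 2) * (2 * (min C₀ (r * (h ^ e)⁻¹) / ρ₀) + 2)
      ≤ 16 * C₀ ^ 2 * ρ₀⁻¹ := by
  have hρpos : 0 < ρ₀ := by rw [hρ₀]; positivity
  have hinv : 1 ≤ ρ₀⁻¹ := (one_le_inv₀ hρpos).2 hle
  have hmin0 : 0 ≤ min C₀ (r * (h ^ e)⁻¹) := le_min (by linarith) (by positivity)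
  rcases le_total r (h ^ e) with hcase | hcase
  · have h1 := cell_factor_low (C₀ := C₀) hh hh1 hr (e := e) hρ₀
    have h2 : 1 ≤ h ^ e / r := (one_le_div hr).2 hcase
    have h3 : 2 * (C₀ * h ^ e / r) + 2 ≤ 4 * C₀ * (h ^ e / r) := by
      have : 2 * (C₀ * h ^ e / r) + 2 = 2 * C₀ * (h ^ e / r) + 2 := by ring
      nlinarith
    have h4 : h ^ e / r * (h ^ (e - j₀))⁻¹ = ρ₀⁻¹ := by
      rw [hρ₀]
      have : h ^ e = h ^ (e - j₀) * h ^ j₀ := by rw [← pow_add]; congr 1; omega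
      rw [this]
      field_simp
    calc _ ≤ (4 * C₀ * (h ^ e / r)) * (4 * (h ^ (e - j₀))⁻¹) := by gcongr
      _ = 16 * C₀ * (h ^ e / r * (h ^ (e - j₀))⁻¹) := by ring
      _ = 16 * C₀ * ρ₀⁻¹ := by rw [h4]
      _ ≤ 16 * C₀ ^ 2 * ρ₀⁻¹ := by gcongr; nlinarith
  · have h1 : 2 * (C₀ * h ^ e / r) + 2 ≤ 4 * C₀ := by
      have : C₀ * h ^ e / r ≤ C₀ := by
        rw [div_le_iff₀ hr]; gcongr
      linarith
    have h2 : 2 * (min C₀ (r * (h ^ e)⁻¹) / ρ₀) + 2 ≤ 4 * C₀ * ρ₀⁻¹ := by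
      have : min C₀ (r * (h ^ e)⁻¹) / ρ₀ ≤ C₀ * ρ₀⁻¹ := by
        rw [div_eq_mul_inv]
        gcongr
        exact min_le_left _ _
      nlinarith
    calc _ ≤ (4 * C₀) * (4 * C₀ * ρ₀⁻¹) := by gcongr
      _ = _ := by ring

/-- The measure of a cell of side `ρ` in the rescaled coordinates, times the number of cells in
the last `ℓ` coordinates. -/
theorem exists_cell_bound {k ℓ : ℕ} {α : ℝ} (hα : 0 < α) (hℓ : ⌊((k + ℓ : ℕ) : ℝ) - α⌋₊ + 1 ≤ k)
    {C₀ : ℝ} (hC₀ : 1 ≤ C₀) {ρ h lam : ℝ} (hρ : 0 < ρ) (hρ1 : ρ ≤ 1) (hh : 0 < h) (hh1 : h ≤ 1)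
    (hlam : 1 ≤ lam) {Y : EuclideanSpace ℝ (Fin (k + ℓ)) → Fin (k + ℓ) → ℝ}
    (hY1 : ∀ x j, |Y x j| ≤ C₀ * ‖x‖)
    (hY2 : ∀ x x' τ, 0 ≤ τ → (∀ j, |Y x j - Y x' j| ≤ τ) → dist x x' ≤ C₀ * τ)
    {μ : Measure (EuclideanSpace ℝ (Fin (k + ℓ)))} {G : ℝ≥0∞}
    (hμ : ∀ x r, 0 < r → μ (Metric.ball x r) ≤ G * ENNReal.ofReal (r ^ α))
    (hsupp : μ (Metric.closedBall 0 1)ᶜ = 0) :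
    ∃ D : ℝ≥0∞, (∀ n : Fin k ⊕ Fin ℓ → ℤ, μ {x | ∀ j : Fin k ⊕ Fin ℓ,
        |lam * h ^ ((finSumFinEquiv j : ℕ) + 1) * Y x (finSumFinEquiv j) - ρ * n j| ≤ ρ} ≤ D) ∧
      (∏ j : Fin ℓ, ENNReal.ofReal (2 * (lam * h ^ ((finSumFinEquiv (Sum.inr j : Fin k ⊕ Fin ℓ) : ℕ)
        + 1) * C₀) / ρ + 2)) * D
      ≤ ENNReal.ofReal (4 ^ k * (16 * C₀ ^ 2) ^ ℓ * (3 * C₀) ^ α) * G *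
        ENNReal.ofReal (lam ^ (-(α - ℓ)) * h ^ (-betaExp k (α - ℓ))) := by
  set j₀ : ℕ := ⌊((k + ℓ : ℕ) : ℝ) - α⌋₊ + 1 with hj₀
  have hαℓ : 0 < α - ℓ := by
    have h1 := Nat.lt_floor_add_one (((k + ℓ : ℕ) : ℝ) - α)
    have h2 : ((j₀ : ℕ) : ℝ) ≤ k := by exact_mod_cast hℓ
    rw [hj₀] at h2
    push_cast at h1 h2
    linarith
  have hlam0 : 0 < lam := by linarith
  set r : ℝ := ρ / lam with hr
  have hr0 : 0 < r := by positivity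
  have hrlam : r ≤ lam⁻¹ := by
    rw [hr, div_eq_mul_inv]
    exact mul_le_of_le_one_left (by positivity) hρ1
  set ρ₀ : ℝ := r * (h ^ j₀)⁻¹ with hρ₀
  have hρ₀pos : 0 < ρ₀ := by positivity
  have hβ := betaExp_sub_eq hj₀ hℓ
  set s : ℕ := ∑ e : Fin k, ((e : ℕ) + 1 - j₀) with hs
  have hfac : ∀ e : ℕ, 2 * (lam * h ^ e * C₀) / ρ + 2 = 2 * (C₀ * h ^ e / r) + 2 := by
    intro e
    rw [hr]
    field_simp
  have hfac0 : ∀ e : ℕ, 0 ≤ 2 * (C₀ * h ^ e / r) + 2 := fun e => by positivity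
  have hinr : ∀ j : Fin ℓ, ((finSumFinEquiv (Sum.inr j : Fin k ⊕ Fin ℓ) : ℕ)) = k + j := fun j => by
    simp
  have hinl : ∀ j : Fin k, ((finSumFinEquiv (Sum.inl j : Fin k ⊕ Fin ℓ) : ℕ)) = j := fun j => by
    simp
  simp_rw [hfac, hinr]
  rw [← ENNReal.ofReal_prod_of_nonneg fun j _ => hfac0 _]
  -- One cube has mass O(ρ₀^α), and the ℓ free directions cost ρ₀^{-ℓ}. The resulting power α − ℓ is
  -- positive, so r ≤ 1/λ can be inserted.
  have hscale : ρ₀ ^ (α - ℓ) * (h ^ s)⁻¹ ≤ lam ^ (-(α - ℓ)) * h ^ (-betaExp k (α - ℓ)) := by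
    have e1 : h ^ (-betaExp k (α - ℓ)) = ((h ^ j₀)⁻¹) ^ (α - ℓ) * (h ^ s)⁻¹ := by
      rw [hβ, neg_add, Real.rpow_add hh, Real.rpow_neg hh.le, Real.rpow_neg hh.le,
        Real.rpow_natCast, Real.inv_rpow (by positivity), ← Real.rpow_natCast h j₀,
        ← Real.rpow_mul hh.le]
    rw [e1, hρ₀, Real.mul_rpow hr0.le (by positivity), Real.rpow_neg hlam0.le,
      ← Real.inv_rpow hlam0.le, mul_assoc]
    gcongr
  rcases le_or_gt ρ₀ 1 with hcase | hcase
  · refine ⟨ENNReal.ofReal (∏ j : Fin (k + ℓ),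
      (2 * (min C₀ (r * (h ^ ((j : ℕ) + 1))⁻¹) / ρ₀) + 2)) *
        (G * ENNReal.ofReal ((3 * C₀ * ρ₀) ^ α)), fun n => ?_, ?_⟩
    · set c : Fin (k + ℓ) → ℝ := fun j => if C₀ ≤ r * (h ^ ((j : ℕ) + 1))⁻¹ then 0 else
        ρ * n (finSumFinEquiv.symm j) / (lam * h ^ ((j : ℕ) + 1)) with hc
      refine le_trans ?_ (measure_box_le hC₀ hY2 hμ hρ₀pos c
        (fun j => min C₀ (r * (h ^ ((j : ℕ) + 1))⁻¹)) fun j => le_min (by linarith) (by positivity))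
      refine (measure_mono_ae ?_)
      have : ∀ᵐ x ∂μ, x ∈ Metric.closedBall (0 : EuclideanSpace ℝ (Fin (k + ℓ))) 1 := by
        rw [ae_iff]
        exact hsupp
      filter_upwards [this] with x hx hxn
      have hx1 : ‖x‖ ≤ 1 := by simpa using hx
      intro j
      simp only [hc]
      split_ifs with hcj
      · rw [sub_zero, min_eq_left hcj]
        exact (hY1 x j).trans (mul_le_of_le_one_right (by linarith) hx1)
      · rw [min_eq_right (not_le.1 hcj).le]
        have h1 := hxn (finSumFinEquiv.symm j)
        rw [Equiv.apply_symm_apply] at h1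
        have hpos : 0 < lam * h ^ ((j : ℕ) + 1) := by positivity
        have e : lam * h ^ ((j : ℕ) + 1) * Y x j - ρ * n (finSumFinEquiv.symm j)
            = (lam * h ^ ((j : ℕ) + 1)) * (Y x j -
              ρ * n (finSumFinEquiv.symm j) / (lam * h ^ ((j : ℕ) + 1))) := by
          field_simp
        rw [e, abs_mul, abs_of_pos hpos, ← le_div_iff₀' hpos] at h1
        refine h1.trans (le_of_eq ?_)
        rw [hr]
        field_simp
    · have hprod : (∏ j : Fin ℓ, (2 * (C₀ * h ^ (k + (j : ℕ) + 1) / r) + 2)) *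
          ∏ j : Fin (k + ℓ), (2 * (min C₀ (r * (h ^ ((j : ℕ) + 1))⁻¹) / ρ₀) + 2)
          ≤ (4 ^ k * (h ^ s)⁻¹) * ((16 * C₀ ^ 2) ^ ℓ * (ρ₀ ^ ℓ)⁻¹) := by
        have hmin0 : ∀ e : ℕ, 0 ≤ 2 * (min C₀ (r * (h ^ e)⁻¹) / ρ₀) + 2 := fun e => by
          have : 0 ≤ min C₀ (r * (h ^ e)⁻¹) := le_min (by linarith) (by positivity)
          positivity
        rw [Fin.prod_univ_add, mul_left_comm, ← Finset.prod_mul_distrib]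
        simp only [Fin.val_castAdd, Fin.val_natAdd]
        refine mul_le_mul ?_ ?_ (Finset.prod_nonneg fun j _ => mul_nonneg (hfac0 _) (hmin0 _))
          (by positivity)
        · calc ∏ j : Fin k, (2 * (min C₀ (r * (h ^ ((j : ℕ) + 1))⁻¹) / ρ₀) + 2)
              ≤ ∏ j : Fin k, (4 * (h ^ ((j : ℕ) + 1 - j₀))⁻¹) :=
                Finset.prod_le_prod (fun j _ => hmin0 _) fun j _ => cell_factor_low hh hh1 hr0 hρ₀
            _ = 4 ^ k * (h ^ s)⁻¹ := by
                rw [Finset.prod_mul_distrib, Finset.prod_inv_distrib, Finset.prod_pow_eq_pow_sum]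
                simp [hs]
        · calc _ ≤ ∏ _j : Fin ℓ, (16 * C₀ ^ 2 * ρ₀⁻¹) :=
                Finset.prod_le_prod (fun j _ => mul_nonneg (hfac0 _) (hmin0 _)) fun j _ =>
                  cell_factor_high hC₀ hh hh1 hr0 (by omega) hρ₀ hcase
            _ = _ := by simp [mul_pow]
      rw [← mul_assoc, ← ENNReal.ofReal_mul (Finset.prod_nonneg fun j _ => hfac0 _)]
      calc _ ≤ ENNReal.ofReal ((4 ^ k * (h ^ s)⁻¹) * ((16 * C₀ ^ 2) ^ ℓ * (ρ₀ ^ ℓ)⁻¹)) *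
            (G * ENNReal.ofReal ((3 * C₀ * ρ₀) ^ α)) := by gcongr
        _ = G * ENNReal.ofReal ((4 ^ k * (16 * C₀ ^ 2) ^ ℓ * (3 * C₀) ^ α) *
            (ρ₀ ^ (α - ℓ) * (h ^ s)⁻¹)) := by
            rw [mul_left_comm, ← ENNReal.ofReal_mul (by positivity)]
            congr 2
            rw [Real.mul_rpow (by positivity) hρ₀pos.le, Real.rpow_sub hρ₀pos, Real.rpow_natCast]
            ring
        _ ≤ _ := by
            rw [mul_comm (ENNReal.ofReal _) G, mul_assoc G, ← ENNReal.ofReal_mul (by positivity)]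
            gcongr
  -- If ρ₀ > 1 then h^{j₀} < r, so each free direction has boundedly many cells. The total mass then
  -- suffices, since the target is bounded below.
  · refine ⟨G * ENNReal.ofReal (2 ^ α), fun n => ?_, ?_⟩
    · refine le_trans ?_ (hμ 0 2 (by norm_num))
      refine measure_mono_ae ?_
      have : ∀ᵐ x ∂μ, x ∈ Metric.closedBall (0 : EuclideanSpace ℝ (Fin (k + ℓ))) 1 := by
        rw [ae_iff]
        exact hsupp
      filter_upwards [this] with x hx _
      exact Metric.closedBall_subset_ball (by norm_num) hx
    · have hhr : h ^ j₀ ≤ r := by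
        rw [hρ₀, ← div_eq_mul_inv, lt_div_iff₀ (by positivity)] at hcase
        linarith
      have hprod : ∏ j : Fin ℓ, (2 * (C₀ * h ^ (k + (j : ℕ) + 1) / r) + 2)
          ≤ (16 * C₀ ^ 2) ^ ℓ := by
        calc _ ≤ ∏ _j : Fin ℓ, (16 * C₀ ^ 2) := by
              refine Finset.prod_le_prod (fun j _ => hfac0 _) fun j _ => ?_
              have h1 : h ^ (k + (j : ℕ) + 1) ≤ r :=
                (pow_le_pow_of_le_one hh.le hh1 (by omega)).trans hhr
              have h2 : C₀ * h ^ (k + (j : ℕ) + 1) / r ≤ C₀ := by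
                rw [div_le_iff₀ hr0]; gcongr
              nlinarith
          _ = _ := by simp
      rw [mul_left_comm, ← ENNReal.ofReal_mul (Finset.prod_nonneg fun j _ => hfac0 _),
        mul_comm _ G, mul_assoc, ← ENNReal.ofReal_mul (by positivity)]
      gcongr G * ENNReal.ofReal ?_
      have h1 : 1 ≤ ρ₀ ^ (α - ℓ) * (h ^ s)⁻¹ := by
        have h2 : 1 ≤ ρ₀ ^ (α - ℓ) := Real.one_le_rpow hcase.le hαℓ.le
        have h3 : 1 ≤ (h ^ s)⁻¹ := (one_le_inv₀ (by positivity)).2 (pow_le_one₀ hh.le hh1)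
        nlinarith
      have h4 : (1 : ℝ) ≤ 4 ^ k := one_le_pow₀ (by norm_num)
      have h5 : (2 : ℝ) ^ α ≤ (3 * C₀) ^ α :=
        Real.rpow_le_rpow (by norm_num) (by linarith) hα.le
      calc _ ≤ (16 * C₀ ^ 2) ^ ℓ * (3 * C₀) ^ α := by gcongr
        _ = (1 * (16 * C₀ ^ 2) ^ ℓ * (3 * C₀) ^ α) * 1 := by ring
        _ ≤ (4 ^ k * (16 * C₀ ^ 2) ^ ℓ * (3 * C₀) ^ α) *
            (lam ^ (-(α - ℓ)) * h ^ (-betaExp k (α - ℓ))) := by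
            gcongr
            exact h1.trans hscale

end Cells

/-! ### The k-fold integral over a box with separated sides. -/

section Multilinear

theorem lintegral_pi_prod_eq {ι : Type*} [Fintype ι] {ν : ι → Measure ℝ} [∀ i, SigmaFinite (ν i)]
    {f : ι → ℝ → ℝ} (hf : ∀ i, Integrable (f i) (ν i)) (hf0 : ∀ i t, 0 ≤ f i t) :
    ∫⁻ s, ENNReal.ofReal (∏ i, f i (s i)) ∂(Measure.pi ν)
      = ∏ i, ∫⁻ t, ENNReal.ofReal (f i t) ∂(ν i) := by
  rw [← ofReal_integral_eq_lintegral_ofReal (Integrable.fintype_prod hf)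
    (Filter.Eventually.of_forall fun s => Finset.prod_nonneg fun i _ => hf0 i _),
    integral_fintype_prod_eq_prod (𝕜 := ℝ),
    ENNReal.ofReal_prod_of_nonneg fun i _ => integral_nonneg (hf0 i)]
  refine Finset.prod_congr rfl fun i _ => ?_
  rw [ofReal_integral_eq_lintegral_ofReal (hf i) (Filter.Eventually.of_forall (hf0 i))]

/-- The phase coordinates associated with a frame and the frequency `lam`. -/
noncomputable def framePhase {k ℓ : ℕ} (lam h : ℝ)
    (Y : EuclideanSpace ℝ (Fin (k + ℓ)) → Fin (k + ℓ) → ℝ) (x : EuclideanSpace ℝ (Fin (k + ℓ)))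
    (j : Fin k ⊕ Fin ℓ) : ℝ :=
  lam * h ^ ((finSumFinEquiv j : ℕ) + 1) * Y x (finSumFinEquiv j)

/-- The sum of `k` points on a curve in `ℝ^{k+ℓ}`. -/
def curveSum {k ℓ : ℕ} (g : ℝ → Fin (k + ℓ) → ℝ) (s : Fin k → ℝ) (j : Fin k ⊕ Fin ℓ) : ℝ :=
  ∑ i, g (s i) (finSumFinEquiv j)

/-- Estimate for the `k`-fold extension operator over a small box with separated sides. -/
theorem exists_box_estimate {k ℓ : ℕ} {α : ℝ} (hα : 0 < α)
    (hℓ : ⌊((k + ℓ : ℕ) : ℝ) - α⌋₊ + 1 ≤ k) {C₀ : ℝ} (hC₀ : 1 ≤ C₀) {δ : ℝ} (hδ : 0 < δ)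
    {r : ℝ} (hr : 2 ≤ r) :
    ∃ η > 0, ∃ K : ℝ≥0, ∀ {γ : ℝ → EuclideanSpace ℝ (Fin (k + ℓ))} {a h : ℝ}
      {g g' : ℝ → Fin (k + ℓ) → ℝ} {Y : EuclideanSpace ℝ (Fin (k + ℓ)) → Fin (k + ℓ) → ℝ},
      CurveFrame γ C₀ a h g g' Y → 0 < h → h ≤ 1 → C₀ * h ≤ η / 2 →
      ∀ {lam : ℝ}, 1 ≤ lam → ∀ {μ : Measure (EuclideanSpace ℝ (Fin (k + ℓ)))} {G : ℝ≥0∞},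
      (∀ x r, 0 < r → μ (Metric.ball x r) ≤ G * ENNReal.ofReal (r ^ α)) →
      μ (Metric.closedBall 0 1)ᶜ = 0 →
      ∀ {s₀ : Fin k → ℝ} {τ : ℝ}, 0 ≤ τ → τ ≤ η / 2 → (∀ i, 0 ≤ s₀ i) → (∀ i, s₀ i + τ ≤ 1) →
      (∀ i j, i ≠ j → δ ≤ |s₀ i - s₀ j|) →
      ∀ {F : (Fin k → ℝ) → ℂ}, Measurable F →
      IntegrableOn F (Set.pi univ fun i => Ioc (s₀ i) (s₀ i + τ)) →
      ∫⁻ s in Set.pi univ fun i => Ioc (s₀ i) (s₀ i + τ), ‖F s‖ₑ ^ (r / (r - 1)) ≠ ∞ →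
      ∫⁻ x, ‖∫ s in Set.pi univ fun i => Ioc (s₀ i) (s₀ i + τ), Complex.exp (Complex.I *
          ((∑ j, framePhase lam h Y x j * curveSum g s j : ℝ) : ℂ)) * F s‖ₑ ^ r ∂μ
        ≤ K * (G * ENNReal.ofReal (lam ^ (-(α - ℓ)) * h ^ (-betaExp k (α - ℓ)))) *
          (∫⁻ s in Set.pi univ fun i => Ioc (s₀ i) (s₀ i + τ), ‖F s‖ₑ ^ (r / (r - 1))) ^ (r - 1) := by
  obtain ⟨η, hη, c, hc, hstab⟩ := exists_det_stable k hδ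
  set R : ℝ := k * C₀ with hRdef
  have hR0 : 0 ≤ R := by positivity
  -- The sum of k curve points is bounded by R, so ρR < 1 and the rescaled map stays inside a single
  -- period.
  set ρ : ℝ := (1 + R)⁻¹ with hρdef
  have hρ : 0 < ρ := by positivity
  have hρ1 : ρ ≤ 1 := inv_le_one_of_one_le₀ (by linarith)
  have hρR : ρ * R ≤ Real.pi := by
    have : ρ * R ≤ 1 := by
      rw [hρdef, inv_mul_le_iff₀ (by positivity)]; linarith
    linarith [Real.pi_gt_three]
  set K₁ : ℝ := Real.exp (Fintype.card (Fin k ⊕ Fin ℓ)) *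
          Real.exp (Fintype.card (Fin k ⊕ Fin ℓ) * R ^ 2) *
          ((2 * Real.pi) ^ Fintype.card (Fin k) / (ρ ^ Fintype.card (Fin k) * c)) with hK₁
  set K₂ : ℝ := 4 ^ k * (16 * C₀ ^ 2) ^ ℓ * (3 * C₀) ^ α with hK₂
  -- At r = 2 the quotient is 0 by the division convention. The value 1 serves this endpoint, where
  -- the L² bound is used directly.
  set K₃ : ℝ := max 1 (r * 2 ^ r / (r - 2)) with hK₃
  refine ⟨η, hη, K₃.toNNReal * (K₁.toNNReal * K₂.toNNReal), ?_⟩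
  intro γ a h g g' Y hfr hh hh1 hhη lam hlam μ G hμ hsupp s₀ τ hτ0 hτ hs₀ hs₁ hsep F hFm hFi hFfin
  set B : Set (Fin k → ℝ) := Set.pi univ fun i => Ioc (s₀ i) (s₀ i + τ) with hB
  have hBm : MeasurableSet B := MeasurableSet.univ_pi fun _ => measurableSet_Ioc
  have hB01 : ∀ s ∈ B, ∀ i, s i ∈ Icc (0 : ℝ) 1 := fun s hs i =>
    ⟨(hs₀ i).trans (hs i (mem_univ i)).1.le, (hs i (mem_univ i)).2.trans (hs₁ i)⟩
  set A : ℝ≥0∞ := (K₁.toNNReal * K₂.toNNReal : ℝ≥0) *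
    (G * ENNReal.ofReal (lam ^ (-(α - ℓ)) * h ^ (-betaExp k (α - ℓ)))) with hA
  obtain ⟨hinj, hdet, hder⟩ := sumMap_box hstab hc
    (g := fun s j => g s (finSumFinEquiv (Sum.inl j : Fin k ⊕ Fin ℓ)))
    (g' := fun s j => g' s (finSumFinEquiv (Sum.inl j : Fin k ⊕ Fin ℓ)))
    (fun j s hs => hfr.hasDeriv _ s hs)
    (fun j s hs => by
      have := hfr.deriv_close (finSumFinEquiv (Sum.inl j : Fin k ⊕ Fin ℓ)) s hs
      simp only [finSumFinEquiv_apply_left, Fin.val_castAdd] at this ⊢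
      exact this.trans hhη) hτ hs₀ hs₁ hτ0 hsep
  have hΦbd : ∀ s ∈ B, ∀ j, |curveSum g s j| ≤ R := by
    intro s hs j
    refine (Finset.abs_sum_le_sum_abs _ _).trans ?_
    calc ∑ i, |g (s i) (finSumFinEquiv j)| ≤ ∑ _i : Fin k, C₀ :=
          Finset.sum_le_sum fun i _ => hfr.bounded _ _ (hB01 s hs i)
      _ = R := by simp [hRdef]
  have hΦc : ∀ j, ContinuousOn (fun s => curveSum g s j) B := by
    intro j
    refine continuousOn_finsetSum _ fun i _ => ?_
    have h1 : ContinuousOn (fun t => g t (finSumFinEquiv j)) (Icc 0 1) := fun t ht =>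
      (hfr.hasDeriv _ t ht).continuousWithinAt
    exact h1.comp (continuous_apply i).continuousOn fun s hs => hB01 s hs i
  have hΦm : ∀ j, AEMeasurable (fun s => curveSum g s j) (volume.restrict B) := fun j =>
    (hΦc j).aemeasurable hBm
  have hKm : ∀ x, AEStronglyMeasurable (fun s => Complex.exp (Complex.I *
      ((∑ j, framePhase lam h Y x j * curveSum g s j : ℝ) : ℂ))) (volume.restrict B) := by
    intro x
    have h1 : AEMeasurable (fun s => ∑ j, framePhase lam h Y x j * curveSum g s j)
      (volume.restrict B) := Finset.aemeasurable_fun_sum _ fun j _ => (hΦm j).const_mul _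
    have h2 : Measurable fun x : ℝ => Complex.exp (Complex.I * (x : ℂ)) := by fun_prop
    exact (h2.comp_aemeasurable h1).aestronglyMeasurable
  have hsuppae : ∀ᵐ x ∂μ, x ∈ Metric.closedBall (0 : EuclideanSpace ℝ (Fin (k + ℓ))) 1 := by
    rw [ae_iff]
    exact hsupp
  obtain ⟨D, hD, hDle⟩ := exists_cell_bound hα hℓ hC₀ hρ hρ1 hh hh1 hlam hfr.coord_le hfr.dist_le
    hμ hsupp
  have hL2 : ∀ F : (Fin k → ℝ) → ℂ, Measurable F → Integrable F (volume.restrict B) →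
      ∫⁻ x, ‖∫ s in B, Complex.exp (Complex.I *
        ((∑ j, framePhase lam h Y x j * curveSum g s j : ℝ) : ℂ)) * F s‖ₑ ^ 2 ∂μ
      ≤ A * ∫⁻ s in B, ‖F s‖ₑ ^ 2 := by
    intro F _ hFi
    have := lintegral_sq_oscillatory_le (μ := μ) (w := framePhase lam h Y) (Φ := curveSum g)
      (Θ' := sumMapDeriv fun s j => g' s (finSumFinEquiv (Sum.inl j : Fin k ⊕ Fin ℓ)))
      hBm hder hinj hc hdet hρ hρ1 hρR hΦbd hΦm
      (L := fun j => lam * h ^ ((finSumFinEquiv j : ℕ) + 1) * C₀) (fun j => by positivity)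
      (by
        filter_upwards [hsuppae] with x hx j
        have hx1 : ‖x‖ ≤ 1 := by simpa using hx
        rw [framePhase, abs_mul, abs_of_pos (by positivity)]
        gcongr
        exact (hfr.coord_le x _).trans (mul_le_of_le_one_right (by linarith) hx1)) hD hFi
    refine this.trans ?_
    gcongr
    rw [hA]
    push_cast
    rw [← hK₁, mul_assoc]
    refine mul_le_mul' le_rfl (hDle.trans (le_of_eq ?_))
    rw [mul_assoc]
    rfl
  have hcont : ∀ F : (Fin k → ℝ) → ℂ, Measurable F → Integrable F (volume.restrict B) →
      Measurable fun x => ∫ s in B, Complex.exp (Complex.I *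
        ((∑ j, framePhase lam h Y x j * curveSum g s j : ℝ) : ℂ)) * F s := by
    intro F _ hFi
    refine Continuous.measurable ?_
    refine continuous_of_dominated (bound := fun s => ‖F s‖)
      (fun x => (hKm x).mul hFi.aestronglyMeasurable)
      (fun x => Filter.Eventually.of_forall fun s => by rw [norm_mul, norm_exp_I_mul, one_mul])
      hFi.norm (Filter.Eventually.of_forall fun s => ?_)
    have hY := hfr.continuous_coord
    simp only [framePhase]
    fun_prop
  have hBfin : IsFiniteMeasure (volume.restrict B) := by
    refine ⟨?_⟩
    rw [Measure.restrict_apply_univ, hB, volume_pi_pi]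
    exact ENNReal.prod_lt_top fun i _ => by simp
  have hAle : (K₃.toNNReal : ℝ≥0∞) * A = ((K₃.toNNReal * (K₁.toNNReal * K₂.toNNReal) : ℝ≥0) : ℝ≥0∞) *
      (G * ENNReal.ofReal (lam ^ (-(α - ℓ)) * h ^ (-betaExp k (α - ℓ)))) := by
    rw [hA]; push_cast; ring
  rw [← hAle]
  rcases hr.eq_or_lt with rfl | hr2
  · have e : (2 : ℝ) / (2 - 1) = 2 := by norm_num
    have e1 : (2 : ℝ) - 1 = 1 := by norm_num
    rw [e, e1, ENNReal.rpow_one]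
    simp only [ENNReal.rpow_two]
    refine (hL2 F hFm hFi).trans ?_
    gcongr
    refine le_mul_of_one_le_left' ?_
    have : (1 : ℝ≥0∞) ≤ ENNReal.ofReal K₃ := ENNReal.one_le_ofReal.2 (le_max_left _ _)
    exact this
  · refine (lintegral_rpow_interpolation hKm (fun x s => (norm_exp_I_mul _).le) hcont hL2 hr2 hFm hFi
      hFfin).trans ?_
    gcongr
    exact ENNReal.ofReal_le_ofReal (le_max_right _ _)

end Multilinear

/-! ### The k-linear estimate for the extension operators. -/

section Multilinear

/-- The extension operator restricted to the interval from `u` to `v`. -/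
noncomputable def oscInt {d : ℕ} (γ : ℝ → EuclideanSpace ℝ (Fin d)) (lam : ℝ) (f : ℝ → ℂ)
    (u v : ℝ) (x : EuclideanSpace ℝ (Fin d)) : ℂ :=
  ∫ t in u..v, Complex.exp (Complex.I * ((lam * inner ℝ x (γ t) : ℝ) : ℂ)) * f t

/-- Substituting t = a + hs produces the Jacobian h. The value of the phase at γ(a) gives a
unimodular constant, which is why only norms are compared. -/
theorem CurveFrame.norm_oscInt {k ℓ : ℕ} {γ : ℝ → EuclideanSpace ℝ (Fin (k + ℓ))} {C₀ a h : ℝ}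
    {g g' : ℝ → Fin (k + ℓ) → ℝ} {Y : EuclideanSpace ℝ (Fin (k + ℓ)) → Fin (k + ℓ) → ℝ}
    (hfr : CurveFrame γ C₀ a h g g' Y) (hh : 0 < h) (lam : ℝ) (f : ℝ → ℂ) {u v : ℝ} (huv : u ≤ v)
    (x : EuclideanSpace ℝ (Fin (k + ℓ))) :
    ‖oscInt γ lam f (a + h * u) (a + h * v) x‖ = h * ‖∫ s in Ioc u v, Complex.exp (Complex.I *
      ((∑ j : Fin k ⊕ Fin ℓ, framePhase lam h Y x j * g s (finSumFinEquiv j) : ℝ) : ℂ))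
        * f (a + h * s)‖ := by
  have h1 : ∀ s, Complex.exp (Complex.I * ((lam * inner ℝ x (γ (a + h * s)) : ℝ) : ℂ))
      = Complex.exp (Complex.I * ((lam * inner ℝ x (γ a) : ℝ) : ℂ)) * Complex.exp (Complex.I *
      ((∑ j : Fin k ⊕ Fin ℓ, framePhase lam h Y x j * g s (finSumFinEquiv j) : ℝ) : ℂ)) := by
    intro s
    rw [← Complex.exp_add, ← mul_add, ← Complex.ofReal_add, hfr.inner_eq, mul_add]
    congr 4
    rw [Finset.mul_sum, ← finSumFinEquiv.sum_comp]
    refine Finset.sum_congr rfl fun j _ => ?_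
    rw [framePhase]
    ring
  rw [oscInt, ← intervalIntegral.smul_integral_comp_add_mul, norm_smul, Real.norm_of_nonneg hh.le,
    intervalIntegral.integral_of_le huv]
  simp_rw [h1, mul_assoc]
  rw [integral_const_mul, norm_mul, norm_exp_I_mul, one_mul]

theorem lintegral_comp_affine {a h : ℝ} (hh : 0 < h) (u : ℝ → ℝ≥0∞) :
    ∫⁻ s in Ioc (0 : ℝ) 1, u (a + h * s) = ENNReal.ofReal h⁻¹ * ∫⁻ t in Ioc a (a + h), u t := by
  have himg : (fun s => a + h * s) '' Ioc (0 : ℝ) 1 = Ioc a (a + h) := by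
    ext t
    constructor
    · rintro ⟨s, hs, rfl⟩
      exact ⟨by nlinarith [hs.1], by nlinarith [hs.2]⟩
    · intro ht
      refine ⟨(t - a) / h, ⟨div_pos (by linarith [ht.1]) hh, ?_⟩, by field_simp; ring⟩
      rw [div_le_one hh]
      linarith [ht.2]
  have h1 := lintegral_image_eq_lintegral_abs_deriv_mul (s := Ioc (0 : ℝ) 1)
    (f := fun s => a + h * s) (f' := fun _ => h) measurableSet_Ioc
    (fun s _ => by simpa using ((hasDerivAt_id s).const_mul h |>.const_add a).hasDerivWithinAt)
    (fun s _ t _ hst => by simpa [hh.ne'] using hst) u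
  rw [himg, abs_of_pos hh, lintegral_const_mul' _ _ ENNReal.ofReal_ne_top] at h1
  rw [h1, ← mul_assoc, ← ENNReal.ofReal_mul (by positivity), inv_mul_cancel₀ hh.ne',
    ENNReal.ofReal_one, one_mul]

theorem lintegral_rpow_le_of_le {φ : ℝ → ℂ} (hφ : Measurable φ) {p q : ℝ} (hq : 0 < q)
    (hqp : q ≤ p) :
    ∫⁻ s in Ioc (0 : ℝ) 1, ‖φ s‖ₑ ^ q ≤ (∫⁻ s in Ioc (0 : ℝ) 1, ‖φ s‖ₑ ^ p) ^ (q / p) := by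
  have hprob : IsProbabilityMeasure ((volume : Measure ℝ).restrict (Ioc 0 1)) := ⟨by simp⟩
  have h1 := eLpNorm'_le_eLpNorm'_of_exponent_le hq hqp ((volume : Measure ℝ).restrict (Ioc 0 1))
    hφ.aestronglyMeasurable
  rw [eLpNorm'_eq_lintegral_enorm, eLpNorm'_eq_lintegral_enorm] at h1
  have h2 := ENNReal.rpow_le_rpow h1 hq.le
  rw [← ENNReal.rpow_mul, ← ENNReal.rpow_mul, one_div_mul_cancel hq.ne', ENNReal.rpow_one] at h2
  refine h2.trans (le_of_eq ?_)
  congr 1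
  ring

/-- The `k`-linear estimate for the extension operators over small separated subintervals of an
interval of length `h`. -/
theorem IsNondegenerateCurve.exists_multilinear {k ℓ : ℕ} {α : ℝ} (hα : 0 < α)
    (hℓ : ⌊((k + ℓ : ℕ) : ℝ) - α⌋₊ + 1 ≤ k) {γ : ℝ → EuclideanSpace ℝ (Fin (k + ℓ))}
    (hγ : IsNondegenerateCurve γ) {δ : ℝ} (hδ : 0 < δ) {r p : ℝ} (hr : 2 ≤ r)
    (hp : r / (r - 1) ≤ p) :
    ∃ h₀ > 0, ∃ τ₀ > 0, ∃ K : ℝ≥0, ∀ {μ : Measure (EuclideanSpace ℝ (Fin (k + ℓ)))} {G : ℝ≥0∞},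
      (∀ x r, 0 < r → μ (Metric.ball x r) ≤ G * ENNReal.ofReal (r ^ α)) →
      μ (Metric.closedBall 0 1)ᶜ = 0 → ∀ {lam : ℝ}, 1 ≤ lam → ∀ {f : ℝ → ℂ}, Measurable f →
      ∀ {a h : ℝ}, 0 ≤ a → 0 < h → h ≤ h₀ → a + h ≤ 1 →
      ∫⁻ t in Ioc a (a + h), ‖f t‖ₑ ^ p ≠ ∞ →
      ∀ {s₀ : Fin k → ℝ} {τ : ℝ}, 0 ≤ τ → τ ≤ τ₀ → (∀ i, 0 ≤ s₀ i) → (∀ i, s₀ i + τ ≤ 1) →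
      (∀ i j, i ≠ j → δ ≤ |s₀ i - s₀ j|) →
      ∫⁻ x, ∏ i, ‖oscInt γ lam f (a + h * s₀ i) (a + h * (s₀ i + τ)) x‖ₑ ^ r ∂μ
        ≤ K * (G * ENNReal.ofReal (lam ^ (-(α - ℓ)) *
            h ^ (k * r * (1 - 1 / p) - betaExp k (α - ℓ)))) *
          (∫⁻ t in Ioc a (a + h), ‖f t‖ₑ ^ p) ^ (k * r / p) := by
  obtain ⟨C₀, hC₀, hframe⟩ := hγ.exists_frame
  obtain ⟨η, hη, K, hK⟩ := exists_box_estimate hα hℓ hC₀ hδ hr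
  refine ⟨η / (2 * C₀), by positivity, η / 2, by positivity, K, ?_⟩
  intro μ G hμ hsupp lam hlam f hf a h ha hh hhη hah hfin s₀ τ hτ0 hτ hs₀ hs₁ hsep
  obtain ⟨g, g', Y, hfr⟩ := hframe a h ha hh hah
  have hh1 : h ≤ 1 := by linarith
  set q : ℝ := r / (r - 1) with hq
  have hr1 : 0 < r - 1 := by linarith
  have hq1 : 1 ≤ q := by rw [hq, le_div_iff₀ hr1]; linarith
  have hq0 : 0 < q := by linarith
  have hp0 : 0 < p := by linarith
  set φ : ℝ → ℂ := fun s => f (a + h * s) with hφ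
  have hφm : Measurable φ := hf.comp (by fun_prop)
  set P : ℝ≥0∞ := ∫⁻ t in Ioc a (a + h), ‖f t‖ₑ ^ p with hP
  have hPφ : ∫⁻ s in Ioc (0 : ℝ) 1, ‖φ s‖ₑ ^ p = ENNReal.ofReal h⁻¹ * P :=
    lintegral_comp_affine hh fun t => ‖f t‖ₑ ^ p
  have hPfin : ∫⁻ s in Ioc (0 : ℝ) 1, ‖φ s‖ₑ ^ p ≠ ∞ := by
    rw [hPφ]
    exact ENNReal.mul_ne_top ENNReal.ofReal_ne_top hfin
  have hqle := lintegral_rpow_le_of_le hφm hq0 hp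
  have hqfin : ∫⁻ s in Ioc (0 : ℝ) 1, ‖φ s‖ₑ ^ q ≠ ∞ :=
    (hqle.trans_lt (ENNReal.rpow_lt_top_of_nonneg (by positivity) hPfin)).ne
  have h1fin : ∫⁻ s in Ioc (0 : ℝ) 1, ‖φ s‖ₑ ≠ ∞ := by
    have := lintegral_rpow_le_of_le hφm one_pos (hq1.trans hp)
    simp only [ENNReal.rpow_one] at this
    exact (this.trans_lt (ENNReal.rpow_lt_top_of_nonneg (by positivity) hPfin)).ne
  set J : Fin k → Set ℝ := fun i => Ioc (s₀ i) (s₀ i + τ) with hJ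
  have hJsub : ∀ i, J i ⊆ Ioc 0 1 := fun i t ht =>
    ⟨(hs₀ i).trans_lt ht.1, ht.2.trans (hs₁ i)⟩
  set B : Set (Fin k → ℝ) := Set.pi univ J with hB
  have hBν : (volume : Measure (Fin k → ℝ)).restrict B
      = Measure.pi fun i => (volume : Measure ℝ).restrict (J i) := by
    rw [volume_pi, hB, Measure.restrict_pi_pi]
  set F : (Fin k → ℝ) → ℂ := fun s => ∏ i, φ (s i) with hF
  have hFm : Measurable F := by
    simp only [hF]
    exact Finset.measurable_fun_prod _ fun i _ => hφm.comp (measurable_pi_apply i)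
  have hφi : IntegrableOn φ (Ioc 0 1) := ⟨hφm.aestronglyMeasurable, h1fin.lt_top⟩
  have hFi : IntegrableOn F B := by
    rw [IntegrableOn, hBν]
    exact Integrable.fintype_prod fun i => (hφi.mono_set (hJsub i))
  have hqi : IntegrableOn (fun s => ‖φ s‖ ^ q) (Ioc 0 1) := by
    refine ⟨(hφm.norm.pow_const q).aestronglyMeasurable, ?_⟩
    rw [HasFiniteIntegral]
    refine lt_of_eq_of_lt (lintegral_congr fun s => ?_) hqfin.lt_top
    rw [Real.enorm_rpow_of_nonneg (norm_nonneg _) hq0.le, enorm_norm]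
  have hFq : ∫⁻ s in B, ‖F s‖ₑ ^ q ≤ (∫⁻ s in Ioc (0 : ℝ) 1, ‖φ s‖ₑ ^ q) ^ k := by
    have e : ∀ s, ‖F s‖ₑ ^ q = ENNReal.ofReal (∏ i, ‖φ (s i)‖ ^ q) := by
      intro s
      rw [Real.finsetProd_rpow _ _ fun i _ => norm_nonneg _, ← norm_prod,
        ← ENNReal.ofReal_rpow_of_nonneg (norm_nonneg _) hq0.le, ofReal_norm]
    simp_rw [e]
    rw [hBν, lintegral_pi_prod_eq (fun i => hqi.mono_set (hJsub i))
      fun i t => Real.rpow_nonneg (norm_nonneg _) _]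
    calc _ ≤ ∏ _i : Fin k, ∫⁻ s in Ioc (0 : ℝ) 1, ‖φ s‖ₑ ^ q := by
          refine Finset.prod_le_prod' fun i _ => ?_
          refine (lintegral_mono_set (hJsub i)).trans (le_of_eq (lintegral_congr fun s => ?_))
          rw [← ENNReal.ofReal_rpow_of_nonneg (norm_nonneg _) hq0.le, ofReal_norm]
      _ = _ := by simp
  have hFqfin : ∫⁻ s in B, ‖F s‖ₑ ^ q ≠ ∞ :=
    (hFq.trans_lt (ENNReal.pow_lt_top hqfin.lt_top)).ne
  have hmain := hK hfr hh hh1 (by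
    rw [le_div_iff₀ (by positivity)] at hhη; linarith) hlam hμ hsupp hτ0 hτ hs₀ hs₁ hsep hFm hFi
    hFqfin
  -- Fubini read backwards: the product of k integrals is one integral of the tensor product `F`,
  -- and the phases add up to `curveSum`.
  have hprod : ∀ x, ∏ i, ‖oscInt γ lam f (a + h * s₀ i) (a + h * (s₀ i + τ)) x‖ₑ ^ r
      = ENNReal.ofReal (h ^ (k * r)) * ‖∫ s in B, Complex.exp (Complex.I *
          ((∑ j, framePhase lam h Y x j * curveSum g s j : ℝ) : ℂ)) * F s‖ₑ ^ r := by
    intro x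
    have e1 : ∀ s : Fin k → ℝ, Complex.exp (Complex.I *
          ((∑ j, framePhase lam h Y x j * curveSum g s j : ℝ) : ℂ)) * F s
        = ∏ i, (Complex.exp (Complex.I * ((∑ j : Fin k ⊕ Fin ℓ,
            framePhase lam h Y x j * g (s i) (finSumFinEquiv j) : ℝ) : ℂ)) * φ (s i)) := by
      intro s
      rw [Finset.prod_mul_distrib, ← Complex.exp_sum, ← Finset.mul_sum, ← Complex.ofReal_sum,
        Finset.sum_comm]
      simp only [curveSum, Finset.mul_sum, hF]
    simp_rw [e1]
    rw [hBν, integral_fintype_prod_eq_prod (𝕜 := ℂ) (f := fun (_ : Fin k) t =>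
      Complex.exp (Complex.I * ((∑ j : Fin k ⊕ Fin ℓ,
            framePhase lam h Y x j * g t (finSumFinEquiv j) : ℝ) : ℂ)) * φ t)]
    have e2 : ∀ i, ‖oscInt γ lam f (a + h * s₀ i) (a + h * (s₀ i + τ)) x‖ₑ
        = ENNReal.ofReal h * ‖∫ t in J i, Complex.exp (Complex.I * ((∑ j : Fin k ⊕ Fin ℓ,
            framePhase lam h Y x j * g t (finSumFinEquiv j) : ℝ) : ℂ)) * φ t‖ₑ := by
      intro i
      rw [← ofReal_norm, hfr.norm_oscInt hh lam f (by linarith) x, ENNReal.ofReal_mul hh.le,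
        ofReal_norm]
    simp_rw [e2]
    rw [ENNReal.prod_rpow_of_nonneg (by linarith), Finset.prod_mul_distrib,
      ENNReal.mul_rpow_of_nonneg _ _ (by linarith)]
    congr 1
    · rw [Finset.prod_const, Finset.card_univ, Fintype.card_fin, ← ENNReal.ofReal_pow hh.le,
        ENNReal.ofReal_rpow_of_pos (by positivity), ← Real.rpow_natCast, ← Real.rpow_mul hh.le]
    · rw [← ofReal_norm, norm_prod, ENNReal.ofReal_prod_of_nonneg fun i _ => norm_nonneg _]
      simp_rw [ofReal_norm]
  have hPpow : (∫⁻ s in B, ‖F s‖ₑ ^ q) ^ (r - 1)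
      ≤ ENNReal.ofReal (h ^ (-(k * r / p))) * P ^ (k * r / p) := by
    calc (∫⁻ s in B, ‖F s‖ₑ ^ q) ^ (r - 1)
        ≤ (((ENNReal.ofReal h⁻¹ * P) ^ (q / p)) ^ k) ^ (r - 1) := by
          refine ENNReal.rpow_le_rpow (hFq.trans ?_) hr1.le
          rw [← hPφ]
          exact pow_le_pow_left' hqle k
      _ = (ENNReal.ofReal h⁻¹ * P) ^ (k * r / p) := by
          rw [← ENNReal.rpow_natCast, ← ENNReal.rpow_mul, ← ENNReal.rpow_mul]
          congr 1
          rw [hq]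
          field_simp
      _ = _ := by
          rw [ENNReal.mul_rpow_of_nonneg _ _ (by positivity),
            ENNReal.ofReal_rpow_of_pos (by positivity), Real.inv_rpow hh.le, Real.rpow_neg hh.le]
  simp_rw [hprod]
  rw [lintegral_const_mul' _ _ ENNReal.ofReal_ne_top]
  -- Powers of h: kr from the k Jacobians, −β from the box estimate, and −kr/p from rescaling the
  -- L^p norms.
  calc _ ≤ ENNReal.ofReal (h ^ (k * r)) * (K * (G * ENNReal.ofReal (lam ^ (-(α - ℓ)) *
          h ^ (-betaExp k (α - ℓ)))) * (ENNReal.ofReal (h ^ (-(k * r / p))) * P ^ (k * r / p))) := by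
        gcongr
        exact hmain.trans (mul_le_mul' le_rfl hPpow)
    _ = K * (G * (ENNReal.ofReal (h ^ (k * r)) * ENNReal.ofReal (lam ^ (-(α - ℓ)) *
          h ^ (-betaExp k (α - ℓ))) * ENNReal.ofReal (h ^ (-(k * r / p))))) * P ^ (k * r / p) := by
        ring
    _ = _ := by
        rw [← ENNReal.ofReal_mul (by positivity), ← ENNReal.ofReal_mul (by positivity)]
        congr 4
        rw [mul_left_comm, mul_assoc, ← Real.rpow_add hh, mul_assoc, ← Real.rpow_add hh]
        congr 2
        field_simp
        ring

end Multilinear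

/-! ### The pointwise broad/narrow dichotomy. -/

section BroadNarrow

/-- A finite set of natural numbers without `k` pairwise non-adjacent elements has at most `3 * k`
elements. -/
theorem exists_separated_or_card_le (S : Finset ℕ) (k : ℕ) :
    (∃ w : Fin k → ℕ, (∀ i, w i ∈ S) ∧ ∀ i j, i ≠ j → w i + 1 < w j ∨ w j + 1 < w i) ∨
      S.card ≤ 3 * k := by
  classical
  set sep : Finset ℕ → Prop := fun T => ∀ i ∈ T, ∀ j ∈ T, i ≠ j → i + 1 < j ∨ j + 1 < i with hsep
  -- Take a largest pairwise non-adjacent subset. By maximality every element of S is within 1 of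
  -- it, and each of its points accounts for at most three elements.
  obtain ⟨T, hT, hmax⟩ := Finset.exists_max_image (S.powerset.filter sep) Finset.card
    ⟨∅, by simp [hsep]⟩
  rw [Finset.mem_filter, Finset.mem_powerset] at hT
  rcases le_or_gt k T.card with hk | hk
  · left
    have e : Fin k ↪ T := (Fin.castLEEmb hk).trans T.equivFin.symm.toEmbedding
    refine ⟨fun i => e i, fun i => hT.1 (e i).2, fun i j hij => hT.2 _ (e i).2 _ (e j).2 ?_⟩
    exact fun h => hij (e.injective (Subtype.ext h))
  · right
    have hsub : S ⊆ T.biUnion fun t => Finset.Icc (t - 1) (t + 1) := by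
      intro i hi
      by_contra hnot
      simp only [Finset.mem_biUnion, Finset.mem_Icc, not_exists, not_and, not_le] at hnot
      have hfar : ∀ t ∈ T, i + 1 < t ∨ t + 1 < i := by
        intro t ht
        by_contra hc
        push Not at hc
        have := hnot t ht (by omega)
        omega
      have hiT : i ∉ T := fun h => by
        have := hfar i h
        omega
      have := hmax (insert i T) (by
        rw [Finset.mem_filter, Finset.mem_powerset]
        refine ⟨Finset.insert_subset hi hT.1, fun a ha b hb hab => ?_⟩
        rcases Finset.mem_insert.1 ha with rfl | ha'
        · rcases Finset.mem_insert.1 hb with rfl | hb'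
          · exact absurd rfl hab
          · exact hfar b hb'
        · rcases Finset.mem_insert.1 hb with rfl | hb'
          · exact (hfar a ha').symm
          · exact hT.2 a ha' b hb' hab)
      rw [Finset.card_insert_of_notMem hiT] at this
      omega
    calc S.card ≤ (T.biUnion fun t => Finset.Icc (t - 1) (t + 1)).card := Finset.card_le_card hsub
      _ ≤ T.card * 3 := Finset.card_biUnion_le_card_mul _ _ _ fun t _ => by
          rw [Nat.card_Icc]; omega
      _ ≤ 3 * k := by omega

/-- Terms of size below M/(2N) contribute at most M/2 in total. If the remaining indices contain no
k non-adjacent ones, there are at most 3k of them, and the largest term is at least M/(6k). That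
this constant is free of N is what lets the induction on scales close. -/
theorem exists_narrow_or_broad {N : ℕ} (hN : 0 < N) (k : ℕ) (z : ℕ → ℂ) :
    (∃ i ∈ Finset.range N, ‖∑ i ∈ Finset.range N, z i‖ ≤ 6 * k * ‖z i‖) ∨
    ∃ w : Fin k → ℕ, (∀ i, w i ∈ Finset.range N) ∧
      (∀ i j, i ≠ j → w i + 1 < w j ∨ w j + 1 < w i) ∧
      ∀ i, ‖∑ i ∈ Finset.range N, z i‖ ≤ 2 * N * ‖z (w i)‖ := by
  set M := ‖∑ i ∈ Finset.range N, z i‖ with hM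
  have hN0 : (0 : ℝ) < N := by exact_mod_cast hN
  set S := (Finset.range N).filter fun i => M ≤ 2 * N * ‖z i‖ with hS
  rcases exists_separated_or_card_le S k with ⟨w, hw, hsep⟩ | hcard
  · exact Or.inr ⟨w, fun i => (Finset.mem_filter.1 (hw i)).1, hsep,
      fun i => (Finset.mem_filter.1 (hw i)).2⟩
  left
  have hsum : M ≤ ∑ i ∈ S, ‖z i‖ + M / 2 := by
    calc M ≤ ∑ i ∈ Finset.range N, ‖z i‖ := norm_sum_le _ _
      _ = ∑ i ∈ S, ‖z i‖ + ∑ i ∈ (Finset.range N).filter (fun i => ¬ M ≤ 2 * N * ‖z i‖), ‖z i‖ :=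
          (Finset.sum_filter_add_sum_filter_not _ _ _).symm
      _ ≤ ∑ i ∈ S, ‖z i‖ + ∑ _i ∈ Finset.range N, M / (2 * N) := by
          gcongr
          refine (Finset.sum_le_sum fun i hi => ?_).trans (Finset.sum_le_sum_of_subset_of_nonneg
            (Finset.filter_subset _ _) fun _ _ _ => by positivity)
          rw [le_div_iff₀ (by positivity)]
          have := (Finset.mem_filter.1 hi).2
          rw [not_le] at this
          linarith
      _ = _ := by
          rw [Finset.sum_const, Finset.card_range, nsmul_eq_mul]
          field_simp
  rcases S.eq_empty_or_nonempty with he | hne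
  · rw [he, Finset.sum_empty, zero_add] at hsum
    have : 0 ≤ M := norm_nonneg _
    refine ⟨0, Finset.mem_range.2 hN, ?_⟩
    have h0 : 0 ≤ 6 * k * ‖z 0‖ := by positivity
    linarith
  · obtain ⟨i, hi, hmax⟩ := Finset.exists_max_image S (fun i => ‖z i‖) hne
    refine ⟨i, (Finset.mem_filter.1 hi).1, ?_⟩
    have h1 : ∑ j ∈ S, ‖z j‖ ≤ S.card • ‖z i‖ := Finset.sum_le_card_nsmul _ _ _ hmax
    rw [nsmul_eq_mul] at h1
    have h2 : (S.card : ℝ) ≤ 3 * k := by exact_mod_cast hcard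
    nlinarith [norm_nonneg (z i)]

theorem exists_norm_sum_le {m : ℕ} (hm : 0 < m) (z : ℕ → ℂ) :
    ∃ v ∈ Finset.range m, ‖∑ v ∈ Finset.range m, z v‖ ≤ m * ‖z v‖ := by
  obtain ⟨v, hv, hmax⟩ := Finset.exists_max_image (Finset.range m) (fun i => ‖z i‖)
    ⟨0, Finset.mem_range.2 hm⟩
  refine ⟨v, hv, (norm_sum_le _ _).trans ?_⟩
  have := Finset.sum_le_card_nsmul _ _ _ hmax
  simpa using this

/-- The set of `k`-tuples of pairwise non-adjacent indices below `N`. -/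
def separatedTuples (N k : ℕ) : Finset (Fin k → ℕ) :=
  (Fintype.piFinset fun _ : Fin k => Finset.range N).filter
    fun w => ∀ i j, i ≠ j → w i + 1 < w j ∨ w j + 1 < w i

/-- In the broad case each selected term is further replaced by its largest sub-piece, since the
k-linear estimate accepts only short pieces. Maxima are bounded by sums over all indices, so that no
choice depends on x after integration. -/
theorem enorm_rpow_sum_le {N m k : ℕ} (hN : 0 < N) (hm : 0 < m) (z : ℕ → ℕ → ℂ) {r : ℝ}
    (hr : 0 ≤ r) :
    ‖∑ i ∈ Finset.range N, ∑ v ∈ Finset.range m, z i v‖ₑ ^ (k * r)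
      ≤ ENNReal.ofReal ((6 * k : ℝ) ^ (k * r)) *
          ∑ i ∈ Finset.range N, ‖∑ v ∈ Finset.range m, z i v‖ₑ ^ (k * r) +
        ENNReal.ofReal ((2 * N * m : ℝ) ^ (k * r)) * ∑ w ∈ separatedTuples N k,
          ∑ v ∈ Fintype.piFinset fun _ : Fin k => Finset.range m,
            ∏ i, ‖z (w i) (v i)‖ₑ ^ r := by
  set M := ‖∑ i ∈ Finset.range N, ∑ v ∈ Finset.range m, z i v‖ with hM
  have hkr : 0 ≤ k * r := by positivity
  rcases exists_narrow_or_broad hN k (fun i => ∑ v ∈ Finset.range m, z i v) with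
    ⟨i, hi, hle⟩ | ⟨w, hw, hsep, hle⟩
  · refine le_add_of_le_of_nonneg ?_ zero_le
    calc _ ≤ (ENNReal.ofReal (6 * k * ‖∑ v ∈ Finset.range m, z i v‖)) ^ (k * r) := by
          rw [← ofReal_norm]
          gcongr
      _ = ENNReal.ofReal ((6 * k : ℝ) ^ (k * r)) * ‖∑ v ∈ Finset.range m, z i v‖ₑ ^ (k * r) := by
          rw [ENNReal.ofReal_mul (by positivity), ENNReal.mul_rpow_of_nonneg _ _ hkr, ofReal_norm,
            ENNReal.ofReal_rpow_of_nonneg (by positivity) hkr]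
      _ ≤ _ := by
          gcongr
          exact Finset.single_le_sum (f := fun i => ‖∑ v ∈ Finset.range m, z i v‖ₑ ^ (k * r))
            (fun _ _ => zero_le) hi
  · refine le_add_of_nonneg_of_le zero_le ?_
    have hex : ∀ i, ∃ v ∈ Finset.range m, ‖∑ v ∈ Finset.range m, z (w i) v‖ ≤ m * ‖z (w i) v‖ :=
      fun i => exists_norm_sum_le hm _
    choose v hv hvle using hex
    have hall : ∀ i, ‖∑ i ∈ Finset.range N, ∑ v ∈ Finset.range m, z i v‖ₑ
        ≤ ENNReal.ofReal (2 * N * m) * ‖z (w i) (v i)‖ₑ := by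
      intro i
      rw [← ofReal_norm, ← ofReal_norm, ← ENNReal.ofReal_mul (by positivity)]
      refine ENNReal.ofReal_le_ofReal ((hle i).trans ?_)
      calc _ ≤ 2 * N * (m * ‖z (w i) (v i)‖) := by gcongr; exact hvle i
        _ = _ := by ring
    calc _ = ∏ _i : Fin k, ‖∑ i ∈ Finset.range N, ∑ v ∈ Finset.range m, z i v‖ₑ ^ r := by
          rw [Finset.prod_const, Finset.card_univ, Fintype.card_fin, ← ENNReal.rpow_natCast,
            ← ENNReal.rpow_mul, mul_comm]
      _ ≤ ∏ i, (ENNReal.ofReal (2 * N * m) * ‖z (w i) (v i)‖ₑ) ^ r :=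
          Finset.prod_le_prod' fun i _ => ENNReal.rpow_le_rpow (hall i) hr
      _ = ENNReal.ofReal ((2 * N * m : ℝ) ^ (k * r)) * ∏ i, ‖z (w i) (v i)‖ₑ ^ r := by
          simp_rw [ENNReal.mul_rpow_of_nonneg _ _ hr]
          rw [Finset.prod_mul_distrib, Finset.prod_const, Finset.card_univ, Fintype.card_fin,
            ← ENNReal.rpow_natCast, ← ENNReal.rpow_mul, mul_comm r,
            ENNReal.ofReal_rpow_of_nonneg (by positivity) hkr]
      _ ≤ _ := by
          gcongr
          refine le_trans ?_ (Finset.single_le_sum (f := fun w : Fin k → ℕ =>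
            ∑ v ∈ Fintype.piFinset fun _ : Fin k => Finset.range m, ∏ i, ‖z (w i) (v i)‖ₑ ^ r)
            (fun _ _ => zero_le) (Finset.mem_filter.2 ⟨Fintype.mem_piFinset.2 hw, hsep⟩))
          exact Finset.single_le_sum (f := fun v : Fin k → ℕ => ∏ i, ‖z (w i) (v i)‖ₑ ^ r)
            (fun _ _ => zero_le) (Fintype.mem_piFinset.2 hv)

end BroadNarrow

/-! ### Additivity and continuity of the operator on subintervals. -/

section Induction

variable {d : ℕ} {γ : ℝ → EuclideanSpace ℝ (Fin d)}

theorem integrableOn_oscInt (hγ : ContinuousOn γ (Icc 0 1)) (lam : ℝ) {f : ℝ → ℂ}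
    (hf : IntegrableOn f (Ioc 0 1)) (x : EuclideanSpace ℝ (Fin d)) :
    IntegrableOn (fun t => Complex.exp (Complex.I * ((lam * inner ℝ x (γ t) : ℝ) : ℂ)) * f t)
      (Ioc 0 1) := by
  refine hf.bdd_mul (c := 1) ?_ (Filter.Eventually.of_forall fun t => (norm_exp_I_mul _).le)
  have h1 : ContinuousOn γ (Ioc 0 1) := hγ.mono Ioc_subset_Icc_self
  have h2 : ContinuousOn
      (fun t => Complex.exp (Complex.I * ((lam * inner ℝ x (γ t) : ℝ) : ℂ))) (Ioc 0 1) := by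
    fun_prop
  exact h2.aestronglyMeasurable measurableSet_Ioc

theorem sum_oscInt (hγ : ContinuousOn γ (Icc 0 1)) (lam : ℝ) {f : ℝ → ℂ}
    (hf : IntegrableOn f (Ioc 0 1)) (x : EuclideanSpace ℝ (Fin d)) {P : ℕ → ℝ} {n : ℕ}
    (hP : ∀ i ≤ n, P i ∈ Icc (0 : ℝ) 1) :
    ∑ i ∈ Finset.range n, oscInt γ lam f (P i) (P (i + 1)) x = oscInt γ lam f (P 0) (P n) x := by
  refine intervalIntegral.sum_integral_adjacent_intervals fun i hi => ?_
  rw [intervalIntegrable_iff]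
  refine (integrableOn_oscInt hγ lam hf x).mono_set ?_
  have h1 := hP i hi.le
  have h2 := hP (i + 1) hi
  intro t ht
  rw [uIoc, mem_Ioc] at ht
  exact ⟨(le_min h1.1 h2.1).trans_lt ht.1, ht.2.trans (max_le h1.2 h2.2)⟩

theorem continuous_oscInt (hγ : ContinuousOn γ (Icc 0 1)) (lam : ℝ) {f : ℝ → ℂ}
    (hf : IntegrableOn f (Ioc 0 1)) {u v : ℝ} (hu : u ∈ Icc (0 : ℝ) 1) (hv : v ∈ Icc (0 : ℝ) 1) :
    Continuous (oscInt γ lam f u v) := by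
  have hsub : uIoc u v ⊆ Ioc 0 1 := by
    intro t ht
    rw [uIoc, mem_Ioc] at ht
    exact ⟨(le_min hu.1 hv.1).trans_lt ht.1, ht.2.trans (max_le hu.2 hv.2)⟩
  refine intervalIntegral.continuous_of_dominated_interval (bound := fun t => ‖f t‖)
    (fun x => ((integrableOn_oscInt hγ lam hf x).mono_set hsub).aestronglyMeasurable)
    (fun x => Filter.Eventually.of_forall fun t _ => by rw [norm_mul, norm_exp_I_mul, one_mul])
    ?_ (Filter.Eventually.of_forall fun t _ => by fun_prop)
  rw [intervalIntegrable_iff]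
  exact (hf.mono_set hsub).norm

theorem ENNReal.sum_rpow_le_rpow_sum {ι : Type*} (s : Finset ι) (u : ι → ℝ≥0∞) {p : ℝ}
    (hp : 1 ≤ p) : ∑ i ∈ s, u i ^ p ≤ (∑ i ∈ s, u i) ^ p := by
  classical
  induction s using Finset.induction_on with
  | empty => simp
  | insert i s hi ih =>
    rw [Finset.sum_insert hi, Finset.sum_insert hi]
    exact (add_le_add le_rfl ih).trans (ENNReal.add_rpow_le_rpow_add _ _ hp)

theorem sum_lintegral_Ioc_le {P : ℕ → ℝ} (hP : Monotone P) (n : ℕ) (u : ℝ → ℝ≥0∞) :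
    ∑ i ∈ Finset.range n, ∫⁻ t in Ioc (P i) (P (i + 1)), u t ≤ ∫⁻ t in Ioc (P 0) (P n), u t := by
  rw [← lintegral_biUnion_finset (t := fun i => Ioc (P i) (P (i + 1))) (fun i _ j _ hij => hP.pairwise_disjoint_on_Ioc_succ hij)
    fun i _ => measurableSet_Ioc]
  refine lintegral_mono_set (iUnion₂_subset fun i hi => Ioc_subset_Ioc (hP (Nat.zero_le _))
    (hP (Finset.mem_range.1 hi)))

end Induction

/-! ### One step of the induction on scales. -/

section Induction

/-- Hölder's inequality in t, ignoring oscillation; it starts the induction at the smallest scale.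
-/
theorem enorm_oscInt_rpow_le {d : ℕ} {γ : ℝ → EuclideanSpace ℝ (Fin d)} (lam : ℝ) {f : ℝ → ℂ}
    (hf : Measurable f) {a h : ℝ} (hh : 0 < h) {p q : ℝ} (hp : 1 ≤ p) (hq : 0 < q)
    (x : EuclideanSpace ℝ (Fin d)) :
    ‖oscInt γ lam f a (a + h) x‖ₑ ^ q
      ≤ ENNReal.ofReal (h ^ (q * (1 - 1 / p))) *
        (∫⁻ t in Ioc a (a + h), ‖f t‖ₑ ^ p) ^ (q / p) := by
  have h1 : ‖oscInt γ lam f a (a + h) x‖ₑ ≤ ∫⁻ t in Ioc a (a + h), ‖f t‖ₑ := by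
    rw [oscInt, intervalIntegral.integral_of_le (by linarith)]
    refine (enorm_integral_le_lintegral_enorm _).trans (lintegral_mono fun t => ?_)
    rw [enorm_mul, ← ofReal_norm, norm_exp_I_mul, ENNReal.ofReal_one, one_mul]
  have h2 : ∫⁻ t in Ioc a (a + h), ‖f t‖ₑ
      ≤ ENNReal.ofReal (h ^ (1 - 1 / p)) * (∫⁻ t in Ioc a (a + h), ‖f t‖ₑ ^ p) ^ (1 / p) := by
    have h3 := lintegral_rpow_le_of_le (φ := fun s => f (a + h * s)) (hf.comp (by fun_prop))
      one_pos hp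
    simp only [ENNReal.rpow_one] at h3
    rw [lintegral_comp_affine hh fun t => ‖f t‖ₑ,
      lintegral_comp_affine hh fun t => ‖f t‖ₑ ^ p] at h3
    have h4 : ∫⁻ t in Ioc a (a + h), ‖f t‖ₑ
        = ENNReal.ofReal h * (ENNReal.ofReal h⁻¹ * ∫⁻ t in Ioc a (a + h), ‖f t‖ₑ) := by
      rw [← mul_assoc, ← ENNReal.ofReal_mul hh.le, mul_inv_cancel₀ hh.ne', ENNReal.ofReal_one,
        one_mul]
    rw [h4]
    refine (mul_le_mul' le_rfl h3).trans (le_of_eq ?_)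
    rw [ENNReal.mul_rpow_of_nonneg _ _ (by positivity), ← mul_assoc,
      ENNReal.ofReal_rpow_of_pos (by positivity), ← ENNReal.ofReal_mul hh.le]
    congr 2
    rw [Real.inv_rpow hh.le, Real.rpow_sub hh, Real.rpow_one]
    rfl
  refine (ENNReal.rpow_le_rpow (h1.trans h2) hq.le).trans (le_of_eq ?_)
  rw [ENNReal.mul_rpow_of_nonneg _ _ hq.le, ENNReal.ofReal_rpow_of_pos (by positivity),
    ← Real.rpow_mul hh.le, ← ENNReal.rpow_mul]
  congr 2
  · congr 1; ring
  · ring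

theorem IsNondegenerateCurve.continuousOn {d : ℕ} {γ : ℝ → EuclideanSpace ℝ (Fin d)}
    (hγ : IsNondegenerateCurve γ) : ContinuousOn γ (Icc 0 1) :=
  hγ.contDiffOn.continuousOn

/-- Reduction of an interval of length `h` to subintervals of length `h / N`. -/
theorem IsNondegenerateCurve.exists_induction_step {k ℓ : ℕ} {α : ℝ} (hα : 0 < α)
    (hℓ : ⌊((k + ℓ : ℕ) : ℝ) - α⌋₊ + 1 ≤ k) {γ : ℝ → EuclideanSpace ℝ (Fin (k + ℓ))}
    (hγ : IsNondegenerateCurve γ) {r p : ℝ} (hr : 2 ≤ r)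
    (hp : r / (r - 1) ≤ p) {N : ℕ} (hN : 0 < N) :
    ∃ h₀ > 0, ∃ K : ℝ≥0, ∀ {μ : Measure (EuclideanSpace ℝ (Fin (k + ℓ)))} {G : ℝ≥0∞},
      (∀ x r, 0 < r → μ (Metric.ball x r) ≤ G * ENNReal.ofReal (r ^ α)) →
      μ (Metric.closedBall 0 1)ᶜ = 0 → ∀ {lam : ℝ}, 1 ≤ lam → ∀ {f : ℝ → ℂ}, Measurable f →
      IntegrableOn f (Ioc 0 1) → ∫⁻ t in Ioc 0 1, ‖f t‖ₑ ^ p ≠ ∞ →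
      ∀ {a h : ℝ}, 0 ≤ a → 0 < h → h ≤ h₀ → a + h ≤ 1 →
      ∫⁻ x, ‖oscInt γ lam f a (a + h) x‖ₑ ^ (k * r) ∂μ
        ≤ ENNReal.ofReal ((6 * k : ℝ) ^ (k * r)) * ∑ i ∈ Finset.range N,
            ∫⁻ x, ‖oscInt γ lam f (a + h * (i / N)) (a + h * (i / N) + h / N) x‖ₑ ^ (k * r) ∂μ +
          K * (G * ENNReal.ofReal (lam ^ (-(α - ℓ)) *
            h ^ (k * r * (1 - 1 / p) - betaExp k (α - ℓ)))) *
          (∫⁻ t in Ioc a (a + h), ‖f t‖ₑ ^ p) ^ (k * r / p) := by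
  have hN0 : (0 : ℝ) < N := by exact_mod_cast hN
  obtain ⟨h₀, hh₀, τ₀, hτ₀, K, hK⟩ := hγ.exists_multilinear hα hℓ (δ := 1 / N) (by positivity) hr hp
  -- Each of the N parts is divided into m pieces of relative length 1/(Nm) ≤ τ₀, as the k-linear
  -- estimate demands. Neither N nor m depends on λ.
  obtain ⟨m, hm⟩ := exists_nat_gt (1 / τ₀)
  have hm0 : (0 : ℝ) < m := lt_trans (by positivity) hm
  have hmN : 0 < m := by exact_mod_cast hm0
  set W := separatedTuples N k with hW
  set V : Finset (Fin k → ℕ) := Fintype.piFinset fun _ : Fin k => Finset.range m with hV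
  set K₁ : ℝ≥0 := ((2 * N * m : ℝ) ^ (k * r)).toNNReal with hK₁
  refine ⟨h₀, hh₀, K₁ * (W.card * V.card * K), ?_⟩
  intro μ G hμ hsupp lam hlam f hf hfi hfin a h ha hh hhh₀ hah
  have hγc := hγ.continuousOn
  have hr0 : 0 ≤ r := by linarith
  set σ : ℕ → ℕ → ℝ := fun i v => (i + v / m) / N with hσ
  set τ : ℝ := 1 / (N * m) with hτ
  have hτ0 : 0 ≤ τ := by positivity
  have hσ0 : ∀ i v, 0 ≤ σ i v := fun i v => by positivity
  have hσ1 : ∀ i ∈ Finset.range N, ∀ v ∈ Finset.range m, σ i v + τ ≤ 1 := by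
    intro i hi v hv
    have h1 : (i : ℝ) + 1 ≤ N := by exact_mod_cast Finset.mem_range.1 hi
    have h2 : (v : ℝ) + 1 ≤ m := by exact_mod_cast Finset.mem_range.1 hv
    have e : σ i v + τ = (i + (v + 1) / m) / N := by simp only [hσ, hτ]; field_simp; ring
    rw [e, div_le_one hN0]
    have : (v + 1 : ℝ) / m ≤ 1 := (div_le_one hm0).2 h2
    linarith
  have hττ₀ : τ ≤ τ₀ := by
    rw [hτ]
    rw [div_lt_iff₀ hτ₀] at hm
    rw [div_le_iff₀ (by positivity)]
    have h1 : (1 : ℝ) ≤ N := by exact_mod_cast hN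
    nlinarith
  set z : EuclideanSpace ℝ (Fin (k + ℓ)) → ℕ → ℕ → ℂ := fun x i v =>
    oscInt γ lam f (a + h * σ i v) (a + h * (σ i v + τ)) x with hz
  have hI : ∀ s : ℝ, 0 ≤ s → s ≤ 1 → a + h * s ∈ Icc (0 : ℝ) 1 := fun s h0 h1 =>
    ⟨by positivity, by nlinarith⟩
  have hinner : ∀ x, ∀ i ∈ Finset.range N, ∑ v ∈ Finset.range m, z x i v
      = oscInt γ lam f (a + h * (i / N)) (a + h * (i / N) + h / N) x := by
    intro x i hi
    have hi1 : (i : ℝ) + 1 ≤ N := by exact_mod_cast Finset.mem_range.1 hi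
    have := sum_oscInt hγc lam hfi x (P := fun v => a + h * σ i v) (n := m) fun v hv => by
      refine hI _ (hσ0 i v) ?_
      simp only [hσ]
      rw [div_le_one hN0]
      have : (v : ℝ) / m ≤ 1 := (div_le_one hm0).2 (by exact_mod_cast hv)
      linarith
    have e1 : a + h * σ i 0 = a + h * (i / N) := by simp [hσ]
    have e2 : a + h * σ i m = a + h * (i / N) + h / N := by
      simp only [hσ]; field_simp; ring
    have e3 : ∀ v : ℕ, σ i (v + 1) = σ i v + τ := fun v => by
      simp only [hσ, hτ]; push_cast; field_simp; ring
    simp only [e1, e2, e3] at this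
    exact this
  have houter : ∀ x, ∑ i ∈ Finset.range N, ∑ v ∈ Finset.range m, z x i v
      = oscInt γ lam f a (a + h) x := by
    intro x
    have := sum_oscInt hγc lam hfi x (P := fun i => a + h * (i / N)) (n := N) fun i hi => by
      exact hI _ (by positivity) ((div_le_one hN0).2 (by exact_mod_cast hi))
    have e1 : a + h * (((0 : ℕ) : ℝ) / N) = a := by simp
    have e2 : a + h * ((N : ℝ) / N) = a + h := by rw [div_self hN0.ne', mul_one]
    have e3 : ∀ i : ℕ, a + h * (((i + 1 : ℕ) : ℝ) / N) = a + h * (i / N) + h / N := fun i => by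
      push_cast; field_simp; ring
    simp only [e1, e2, e3] at this
    rw [← this]
    exact Finset.sum_congr rfl fun i hi => hinner x i hi
  have hzc : ∀ i ∈ Finset.range N, ∀ v ∈ Finset.range m, Continuous fun x => z x i v := by
    intro i hi v hv
    refine continuous_oscInt hγc lam hfi (hI _ (hσ0 i v) ?_) (hI _ (by linarith [hσ0 i v])
      (hσ1 i hi v hv))
    linarith [hσ1 i hi v hv]
  have hWm : ∀ w ∈ W, (∀ i, w i ∈ Finset.range N) ∧
      ∀ i j, i ≠ j → w i + 1 < w j ∨ w j + 1 < w i := fun w hw => by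
    have := Finset.mem_filter.1 hw
    exact ⟨Fintype.mem_piFinset.1 this.1, this.2⟩
  have hVm : ∀ v ∈ V, ∀ i, v i ∈ Finset.range m := fun v hv => Fintype.mem_piFinset.1 hv
  have hbroad : ∀ w ∈ W, ∀ v ∈ V, ∫⁻ x, ∏ i, ‖z x (w i) (v i)‖ₑ ^ r ∂μ
      ≤ K * (G * ENNReal.ofReal (lam ^ (-(α - ℓ)) *
            h ^ (k * r * (1 - 1 / p) - betaExp k (α - ℓ)))) *
          (∫⁻ t in Ioc a (a + h), ‖f t‖ₑ ^ p) ^ (k * r / p) := by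
    intro w hw v hv
    obtain ⟨hwN, hwsep⟩ := hWm w hw
    refine hK hμ hsupp hlam hf ha hh hhh₀ hah ?_ hτ0 hττ₀ (fun i => hσ0 (w i) (v i))
      (fun i => hσ1 _ (hwN i) _ (hVm v hv i)) fun i j hij => ?_
    · refine ((lintegral_mono_set (Ioc_subset_Ioc ha hah)).trans_lt hfin.lt_top).ne
    -- Indices of non-adjacent parts differ by at least 2, while the offset of a piece inside its
    -- part is at most 1/N. So the left endpoints stay 1/N apart whichever pieces are chosen.
    · have key : ∀ i j : Fin k, w i + 1 < w j → 1 / (N : ℝ) ≤ σ (w j) (v j) - σ (w i) (v i) := by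
        intro i j hlt
        have h1 : (w i : ℝ) + 2 ≤ w j := by exact_mod_cast hlt
        have h2 : (v i : ℝ) / m ≤ 1 :=
          (div_le_one hm0).2 (by exact_mod_cast (Finset.mem_range.1 (hVm v hv i)).le)
        have h3 : 0 ≤ (v j : ℝ) / m := by positivity
        simp only [hσ]
        rw [← sub_div]
        gcongr
        linarith
      rcases hwsep i j hij with hlt | hlt
      · rw [abs_sub_comm]
        exact (key i j hlt).trans (le_abs_self _)
      · exact (key j i hlt).trans (le_abs_self _)
  have hpt : ∀ x, ‖oscInt γ lam f a (a + h) x‖ₑ ^ (k * r)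
      ≤ ENNReal.ofReal ((6 * k : ℝ) ^ (k * r)) * ∑ i ∈ Finset.range N,
          ‖oscInt γ lam f (a + h * (i / N)) (a + h * (i / N) + h / N) x‖ₑ ^ (k * r) +
        ENNReal.ofReal ((2 * N * m : ℝ) ^ (k * r)) * ∑ w ∈ W, ∑ v ∈ V,
          ∏ i, ‖z x (w i) (v i)‖ₑ ^ r := by
    intro x
    have := enorm_rpow_sum_le (k := k) hN hmN (z x) hr0
    rw [houter x, Finset.sum_congr rfl fun i hi => by rw [hinner x i hi]] at this
    exact this
  have hprodm : ∀ w ∈ W, ∀ v ∈ V, Measurable fun x => ∏ i, ‖z x (w i) (v i)‖ₑ ^ r := by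
    intro w hw v hv
    refine Finset.measurable_fun_prod _ fun i _ => ?_
    exact (hzc _ ((hWm w hw).1 i) _ (hVm v hv i)).measurable.enorm.pow_const r
  have hnarm : ∀ i ∈ Finset.range N, Measurable fun x =>
      ‖oscInt γ lam f (a + h * (i / N)) (a + h * (i / N) + h / N) x‖ₑ ^ (k * r) := by
    intro i hi
    have : Continuous fun x => ∑ v ∈ Finset.range m, z x i v :=
      continuous_finsetSum _ fun v hv => hzc i hi v hv
    simp_rw [fun x => hinner x i hi] at this
    exact this.measurable.enorm.pow_const _
  refine (lintegral_mono hpt).trans ?_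
  rw [lintegral_add_left ((Finset.measurable_fun_sum _ hnarm).const_mul _),
    lintegral_const_mul' _ _ ENNReal.ofReal_ne_top, lintegral_const_mul' _ _ ENNReal.ofReal_ne_top,
    lintegral_finsetSum _ hnarm, lintegral_finsetSum _ fun w hw =>
      Finset.measurable_fun_sum _ fun v hv => hprodm w hw v hv]
  refine add_le_add le_rfl ?_
  rw [Finset.sum_congr rfl fun w hw => lintegral_finsetSum V fun v hv => hprodm w hw v hv]
  calc _ ≤ ENNReal.ofReal ((2 * N * m : ℝ) ^ (k * r)) * (W.card • (V.card •
        (K * (G * ENNReal.ofReal (lam ^ (-(α - ℓ)) *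
            h ^ (k * r * (1 - 1 / p) - betaExp k (α - ℓ)))) *
          (∫⁻ t in Ioc a (a + h), ‖f t‖ₑ ^ p) ^ (k * r / p)))) := by
        gcongr
        exact Finset.sum_le_card_nsmul _ _ _ fun w hw =>
          Finset.sum_le_card_nsmul _ _ _ fun v hv => hbroad w hw v hv
    _ = _ := by
        have : ENNReal.ofReal ((2 * N * m : ℝ) ^ (k * r)) = K₁ := rfl
        rw [this, nsmul_eq_mul, nsmul_eq_mul]
        push_cast
        ring

end Induction

/-! ### Iteration over scales. -/

section Scales

theorem measure_univ_le_of_growth {d : ℕ} {α : ℝ} {μ : Measure (EuclideanSpace ℝ (Fin d))}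
    {G : ℝ≥0∞} (hμ : ∀ x r, 0 < r → μ (Metric.ball x r) ≤ G * ENNReal.ofReal (r ^ α))
    (hsupp : μ (Metric.closedBall 0 1)ᶜ = 0) : μ univ ≤ G * ENNReal.ofReal (2 ^ α) := by
  have h1 : μ univ ≤ μ (Metric.closedBall 0 1) := by
    rw [← union_compl_self (Metric.closedBall (0 : EuclideanSpace ℝ (Fin d)) 1)]
    exact (measure_union_le _ _).trans (by rw [hsupp, add_zero])
  refine (h1.trans (measure_mono (Metric.closedBall_subset_ball one_lt_two))).trans
    (hμ 0 2 two_pos)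

/-- Since [d − α] + 1 ≤ k forces d − α < k = d − ℓ. -/
theorem sub_pos_of_floor_lt {k ℓ : ℕ} {α : ℝ} (hℓ : ⌊((k + ℓ : ℕ) : ℝ) - α⌋₊ + 1 ≤ k) :
    0 < α - ℓ := by
  have h1 := Nat.lt_floor_add_one (((k + ℓ : ℕ) : ℝ) - α)
  have h2 : ((⌊((k + ℓ : ℕ) : ℝ) - α⌋₊ + 1 : ℕ) : ℝ) ≤ k := by exact_mod_cast hℓ
  push_cast at h1 h2
  linarith

theorem betaExp_pos {k ℓ : ℕ} {α : ℝ} (hℓ : ⌊((k + ℓ : ℕ) : ℝ) - α⌋₊ + 1 ≤ k) :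
    0 < betaExp k (α - ℓ) := by
  rw [betaExp_sub_eq rfl hℓ]
  have := sub_pos_of_floor_lt hℓ
  positivity

/-- The `L^p → L^q` bound on all sufficiently short intervals. -/
theorem IsNondegenerateCurve.exists_local_bound {k ℓ : ℕ} {α : ℝ} (hα : 0 < α)
    (hℓ : ⌊((k + ℓ : ℕ) : ℝ) - α⌋₊ + 1 ≤ k) {γ : ℝ → EuclideanSpace ℝ (Fin (k + ℓ))}
    (hγ : IsNondegenerateCurve γ) {p q : ℝ} (hp : 1 < p) (hpq : p ≤ q) (hkq : 2 * k ≤ q)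
    (h₁ : k / q + 1 / p ≤ 1) (h₂ : betaExp k (α - ℓ) / q + 1 / p < 1) :
    ∃ h₀ > 0, ∃ K : ℝ≥0, ∀ {μ : Measure (EuclideanSpace ℝ (Fin (k + ℓ)))} {G : ℝ≥0∞},
      (∀ x r, 0 < r → μ (Metric.ball x r) ≤ G * ENNReal.ofReal (r ^ α)) →
      μ (Metric.closedBall 0 1)ᶜ = 0 → ∀ {lam : ℝ}, 1 ≤ lam → ∀ {f : ℝ → ℂ}, Measurable f →
      IntegrableOn f (Ioc 0 1) → ∫⁻ t in Ioc 0 1, ‖f t‖ₑ ^ p ≠ ∞ →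
      ∀ {a h : ℝ}, 0 ≤ a → 0 < h → h ≤ h₀ → a + h ≤ 1 →
      ∫⁻ x, ‖oscInt γ lam f a (a + h) x‖ₑ ^ q ∂μ
        ≤ K * (G * ENNReal.ofReal (lam ^ (-(α - ℓ)) *
            h ^ (q * (1 - 1 / p) - betaExp k (α - ℓ)))) *
          (∫⁻ t in Ioc a (a + h), ‖f t‖ₑ ^ p) ^ (q / p) := by
  have hβ := betaExp_pos hℓ
  set β := betaExp k (α - ℓ) with hβdef
  have hp0 : 0 < p := by linarith
  have hq0 : 0 < q := by linarith
  have hk0 : (0 : ℝ) < k := by exact_mod_cast (by omega : 0 < k)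
  have hkr : k * (q / k) = q := by field_simp
  set θ := q * (1 - 1 / p) - β with hθ
  have hθ0 : 0 < θ := by
    have : β / q * q = β := by field_simp
    rw [hθ]
    nlinarith
  have hr2 : 2 ≤ q / k := by rwa [le_div_iff₀ hk0]
  -- With r = q/k, the condition r' ≤ p is a rewriting of k/q + 1/p ≤ 1.
  have hrp : q / k / (q / k - 1) ≤ p := by
    rw [div_le_iff₀ (by linarith)]
    have e : p * (q / k - 1) - q / k = q * p / k * (1 - (k / q + 1 / p)) := by
      field_simp; ring
    have : 0 ≤ q * p / k * (1 - (k / q + 1 / p)) := by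
      have := sub_nonneg.2 h₁
      positivity
    linarith
  obtain ⟨N, hN2, hNsmall⟩ : ∃ N : ℕ, 2 ≤ N ∧ (6 * k : ℝ) ^ q * (N : ℝ) ^ (-θ) ≤ 1 / 2 := by
    have h1 : Filter.Tendsto (fun n : ℕ => (6 * k : ℝ) ^ q * (n : ℝ) ^ (-θ)) Filter.atTop
        (nhds ((6 * k : ℝ) ^ q * 0)) :=
      ((tendsto_rpow_neg_atTop hθ0).comp tendsto_natCast_atTop_atTop).const_mul _
    rw [mul_zero] at h1
    have h2 := (h1.eventually (eventually_le_nhds (by norm_num : (0 : ℝ) < 1 / 2))).and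
      (Filter.eventually_ge_atTop 2)
    obtain ⟨N, hN⟩ := h2.exists
    exact ⟨N, hN.2, hN.1⟩
  have hN0 : 0 < N := by omega
  have hNR : (0 : ℝ) < N := by exact_mod_cast hN0
  obtain ⟨h₀, hh₀, K, hK⟩ := hγ.exists_induction_step hα hℓ hr2 hrp hN0
  simp only [hkr] at hK
  -- The value 2K + 1 is not exceeded by half of itself plus K, so it survives every step; its
  -- summand 1 covers the trivial bound at the bottom.
  refine ⟨h₀, hh₀, 2 * K + 1, ?_⟩
  intro μ G hμ hsupp lam hlam f hf hfi hfin
  have hlam0 : 0 < lam := by linarith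
  set c : ℝ := (N : ℝ) ^ (-β) with hc
  have hc0 : 0 < c := by positivity
  have hc1 : c < 1 := Real.rpow_lt_one_of_one_lt_of_neg (by exact_mod_cast hN2) (by linarith)
  -- Here n subdivisions suffice to bring h^β 2^α below λ^{-(α-ℓ)}, each replacing h by h/N and thus
  -- multiplying h^β by c. The constant does not depend on n, so nothing is lost in λ.
  have key : ∀ n : ℕ, ∀ {a h : ℝ}, 0 ≤ a → 0 < h → h ≤ h₀ → a + h ≤ 1 →
      h ^ β * c ^ n * 2 ^ α ≤ lam ^ (-(α - ℓ)) →
      ∫⁻ x, ‖oscInt γ lam f a (a + h) x‖ₑ ^ q ∂μ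
        ≤ (2 * K + 1 : ℝ≥0) * (G * ENNReal.ofReal (lam ^ (-(α - ℓ)) * h ^ θ)) *
          (∫⁻ t in Ioc a (a + h), ‖f t‖ₑ ^ p) ^ (q / p) := by
    intro n
    induction n with
    | zero =>
      intro a h ha hh hhh₀ hah hsmall
      rw [pow_zero, mul_one] at hsmall
      calc _ ≤ ∫⁻ _, ENNReal.ofReal (h ^ (q * (1 - 1 / p))) *
            (∫⁻ t in Ioc a (a + h), ‖f t‖ₑ ^ p) ^ (q / p) ∂μ :=
            lintegral_mono fun x => enorm_oscInt_rpow_le lam hf hh hp.le hq0 x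
        _ = ENNReal.ofReal (h ^ (q * (1 - 1 / p))) *
            (∫⁻ t in Ioc a (a + h), ‖f t‖ₑ ^ p) ^ (q / p) * μ univ := lintegral_const _
        _ ≤ ENNReal.ofReal (h ^ (q * (1 - 1 / p))) *
            (∫⁻ t in Ioc a (a + h), ‖f t‖ₑ ^ p) ^ (q / p) * (G * ENNReal.ofReal (2 ^ α)) := by
            gcongr
            exact measure_univ_le_of_growth hμ hsupp
        _ = 1 * (G * ENNReal.ofReal (h ^ β * 2 ^ α * h ^ θ)) *
            (∫⁻ t in Ioc a (a + h), ‖f t‖ₑ ^ p) ^ (q / p) := by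
            rw [mul_comm (h ^ β * 2 ^ α), ← mul_assoc (h ^ θ), ← Real.rpow_add hh, ENNReal.ofReal_mul (by positivity), hθ,
              sub_add_cancel]
            ring
        _ ≤ _ := by
            gcongr
            push_cast
            exact le_add_self
    | succ n ih =>
      intro a h ha hh hhh₀ hah hsmall
      set P := ∫⁻ t in Ioc a (a + h), ‖f t‖ₑ ^ p with hP
      set M := G * ENNReal.ofReal (lam ^ (-(α - ℓ)) * h ^ θ) with hM
      have hpiece : ∀ i ∈ Finset.range N,
          ∫⁻ x, ‖oscInt γ lam f (a + h * (i / N)) (a + h * (i / N) + h / N) x‖ₑ ^ q ∂μ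
          ≤ (2 * K + 1 : ℝ≥0) * (M * ENNReal.ofReal ((N : ℝ) ^ (-θ))) *
            (∫⁻ t in Ioc (a + h * (i / N)) (a + h * (i / N) + h / N), ‖f t‖ₑ ^ p) ^ (q / p) := by
        intro i hi
        have hi1 : (i : ℝ) + 1 ≤ N := by exact_mod_cast Finset.mem_range.1 hi
        have h1 : a + h * (i / N) + h / N ≤ 1 := by
          have e : a + h * (i / N) + h / N = a + h * ((i + 1) / N) := by ring
          have : (i + 1 : ℝ) / N ≤ 1 := (div_le_one hNR).2 hi1
          rw [e]
          nlinarith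
        have hN1 : (1 : ℝ) ≤ N := by exact_mod_cast hN0
        refine (ih (by positivity) (by positivity) ((div_le_self hh.le hN1).trans hhh₀) h1
          (le_trans (le_of_eq ?_) hsmall)).trans (le_of_eq ?_)
        · rw [Real.div_rpow hh.le hNR.le, pow_succ, hc, Real.rpow_neg hNR.le]
          ring
        · rw [Real.div_rpow hh.le hNR.le, hM, mul_assoc G, ← ENNReal.ofReal_mul (by positivity),
            Real.rpow_neg hNR.le θ, mul_assoc (lam ^ _), ← div_eq_mul_inv]
      -- Superadditivity of u ↦ u^{q/p} requires p ≤ q.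
      have hsum : ∑ i ∈ Finset.range N,
          (∫⁻ t in Ioc (a + h * (i / N)) (a + h * (i / N) + h / N), ‖f t‖ₑ ^ p) ^ (q / p)
          ≤ P ^ (q / p) := by
        refine (ENNReal.sum_rpow_le_rpow_sum _ _ ((one_le_div hp0).2 hpq)).trans ?_
        gcongr
        have := sum_lintegral_Ioc_le (P := fun i : ℕ => a + h * (i / N)) (fun i j hij => by
          dsimp only
          gcongr) N fun t => ‖f t‖ₑ ^ p
        have e1 : a + h * (((0 : ℕ) : ℝ) / N) = a := by simp
        have e2 : a + h * ((N : ℝ) / N) = a + h := by rw [div_self hNR.ne', mul_one]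
        have e3 : ∀ i : ℕ, a + h * (((i + 1 : ℕ) : ℝ) / N) = a + h * (i / N) + h / N := fun i => by
          push_cast; ring
        simp only [e1, e2, e3] at this
        exact this
      have hfrac : ENNReal.ofReal ((6 * k : ℝ) ^ q) * ENNReal.ofReal ((N : ℝ) ^ (-θ))
          ≤ ENNReal.ofReal (1 / 2) := by
        rw [← ENNReal.ofReal_mul (by positivity)]
        exact ENNReal.ofReal_le_ofReal hNsmall
      have hhalf : ENNReal.ofReal (1 / 2) * (2 * K + 1 : ℝ≥0) + K ≤ (2 * K + 1 : ℝ≥0) := by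
        have : ENNReal.ofReal (1 / 2) = ((1 / 2 : ℝ≥0) : ℝ≥0∞) := by
          rw [ENNReal.ofReal]
          congr 1
          ext
          simp
        rw [this]
        norm_cast
        rw [← NNReal.coe_le_coe]
        push_cast
        linarith
      calc _ ≤ _ := hK hμ hsupp hlam hf hfi hfin ha hh hhh₀ hah
        _ ≤ ENNReal.ofReal ((6 * k : ℝ) ^ q) * ∑ i ∈ Finset.range N,
            (2 * K + 1 : ℝ≥0) * (M * ENNReal.ofReal ((N : ℝ) ^ (-θ))) *
            (∫⁻ t in Ioc (a + h * (i / N)) (a + h * (i / N) + h / N), ‖f t‖ₑ ^ p) ^ (q / p)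
            + K * M * P ^ (q / p) :=
            add_le_add (mul_le_mul' le_rfl (Finset.sum_le_sum hpiece)) le_rfl
        _ ≤ ENNReal.ofReal ((6 * k : ℝ) ^ q) *
            ((2 * K + 1 : ℝ≥0) * (M * ENNReal.ofReal ((N : ℝ) ^ (-θ))) * P ^ (q / p))
            + K * M * P ^ (q / p) := by
            rw [← Finset.mul_sum]
            gcongr
        _ = ((ENNReal.ofReal ((6 * k : ℝ) ^ q) * ENNReal.ofReal ((N : ℝ) ^ (-θ)))
            * (2 * K + 1 : ℝ≥0) + K) * M * P ^ (q / p) := by ring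
        _ ≤ (ENNReal.ofReal (1 / 2) * (2 * K + 1 : ℝ≥0) + K) * M * P ^ (q / p) := by gcongr
        _ ≤ _ := by gcongr
  intro a h ha hh hhh₀ hah
  have hpos : 0 < lam ^ (-(α - ℓ)) / (h ^ β * 2 ^ α) := by positivity
  obtain ⟨n, hn⟩ := exists_pow_lt_of_lt_one hpos hc1
  refine key n ha hh hhh₀ hah ?_
  rw [lt_div_iff₀ (by positivity)] at hn
  nlinarith

/-- The unit interval splits into N intervals of length 1/N ≤ h₀, with N depending on neither λ nor
f nor μ, so a crude convexity bound for the sum is affordable. -/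
theorem IsNondegenerateCurve.exists_lintegral_bound {k ℓ : ℕ} {α : ℝ} (hα : 0 < α)
    (hℓ : ⌊((k + ℓ : ℕ) : ℝ) - α⌋₊ + 1 ≤ k) {γ : ℝ → EuclideanSpace ℝ (Fin (k + ℓ))}
    (hγ : IsNondegenerateCurve γ) {p q : ℝ} (hp : 1 < p) (hpq : p ≤ q) (hkq : 2 * k ≤ q)
    (h₁ : k / q + 1 / p ≤ 1) (h₂ : betaExp k (α - ℓ) / q + 1 / p < 1) :
    ∃ K : ℝ≥0, ∀ {μ : Measure (EuclideanSpace ℝ (Fin (k + ℓ)))} {G : ℝ≥0∞},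
      (∀ x r, 0 < r → μ (Metric.ball x r) ≤ G * ENNReal.ofReal (r ^ α)) →
      μ (Metric.closedBall 0 1)ᶜ = 0 → ∀ {lam : ℝ}, 1 ≤ lam → ∀ {f : ℝ → ℂ}, Measurable f →
      IntegrableOn f (Ioc 0 1) → ∫⁻ t in Ioc 0 1, ‖f t‖ₑ ^ p ≠ ∞ →
      ∫⁻ x, ‖oscInt γ lam f 0 1 x‖ₑ ^ q ∂μ
        ≤ K * (G * ENNReal.ofReal (lam ^ (-(α - ℓ)))) *
          (∫⁻ t in Ioc 0 1, ‖f t‖ₑ ^ p) ^ (q / p) := by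
  obtain ⟨h₀, hh₀, K, hK⟩ := hγ.exists_local_bound hα hℓ hp hpq hkq h₁ h₂
  obtain ⟨N, hN⟩ := exists_nat_gt (1 / h₀)
  have hNR : (0 : ℝ) < N := lt_trans (by positivity) hN
  have hN0 : 0 < N := by exact_mod_cast hNR
  have hNh : 1 / (N : ℝ) ≤ h₀ := by
    rw [div_lt_iff₀ hh₀] at hN
    rw [div_le_iff₀ hNR]
    linarith
  refine ⟨(N : ℝ≥0) ^ (q - 1) * (N * (K * ((1 / (N : ℝ)) ^
    (q * (1 - 1 / p) - betaExp k (α - ℓ))).toNNReal)), ?_⟩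
  intro μ G hμ hsupp lam hlam f hf hfi hfin
  have hlam0 : 0 < lam := by linarith
  have hγc := hγ.continuousOn
  have hstep : ∀ i : ℕ, (((i + 1 : ℕ) : ℝ) / N) = i / N + 1 / N := fun i => by
    push_cast; ring
  have hmem : ∀ i : ℕ, i ≤ N → (i : ℝ) / N ∈ Icc (0 : ℝ) 1 := fun i hi =>
    ⟨by positivity, (div_le_one hNR).2 (by exact_mod_cast hi)⟩
  have hsum : ∀ x, ∑ i ∈ Finset.range N, oscInt γ lam f (i / N) (i / N + 1 / N) x
      = oscInt γ lam f 0 1 x := by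
    intro x
    have := sum_oscInt hγc lam hfi x (P := fun i => (i : ℝ) / N) (n := N) hmem
    simp only [hstep, div_self hNR.ne', Nat.cast_zero, zero_div] at this
    exact this
  have hmeas : ∀ i ∈ Finset.range N, Measurable fun x =>
      ‖oscInt γ lam f (i / N) (i / N + 1 / N) x‖ₑ ^ q := by
    intro i hi
    have hi' := Finset.mem_range.1 hi
    refine (continuous_oscInt hγc lam hfi (hmem i hi'.le) ?_).measurable.enorm.pow_const q
    rw [← hstep]
    exact hmem _ hi'
  have hpiece : ∀ i ∈ Finset.range N,
      ∫⁻ x, ‖oscInt γ lam f (i / N) (i / N + 1 / N) x‖ₑ ^ q ∂μ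
      ≤ K * (G * ENNReal.ofReal (lam ^ (-(α - ℓ)) *
            (1 / (N : ℝ)) ^ (q * (1 - 1 / p) - betaExp k (α - ℓ)))) *
          (∫⁻ t in Ioc 0 1, ‖f t‖ₑ ^ p) ^ (q / p) := by
    intro i hi
    have hi' := hmem _ (Nat.succ_le_of_lt (Finset.mem_range.1 hi))
    rw [hstep] at hi'
    refine (hK hμ hsupp hlam hf hfi hfin (by positivity) (by positivity) hNh hi'.2).trans ?_
    refine mul_le_mul' le_rfl (ENNReal.rpow_le_rpow (lintegral_mono_set
      (Ioc_subset_Ioc (by positivity) hi'.2)) ?_)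
    exact div_nonneg (by linarith) (by linarith)
  calc _ ≤ ∫⁻ x, (N : ℝ≥0∞) ^ (q - 1) * ∑ i ∈ Finset.range N,
        ‖oscInt γ lam f (i / N) (i / N + 1 / N) x‖ₑ ^ q ∂μ := by
        refine lintegral_mono fun x => ?_
        rw [← hsum]
        have h1 := ENNReal.rpow_sum_le_const_mul_sum_rpow (Finset.range N)
          (fun i => ‖oscInt γ lam f (i / N) (i / N + 1 / N) x‖ₑ) (hp.le.trans hpq)
        rw [Finset.card_range] at h1
        exact (ENNReal.rpow_le_rpow (enorm_sum_le _ _) (by linarith)).trans h1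
    _ = (N : ℝ≥0∞) ^ (q - 1) * ∑ i ∈ Finset.range N,
        ∫⁻ x, ‖oscInt γ lam f (i / N) (i / N + 1 / N) x‖ₑ ^ q ∂μ := by
        rw [lintegral_const_mul _ (Finset.measurable_fun_sum _ hmeas),
          lintegral_finsetSum _ hmeas]
    _ ≤ (N : ℝ≥0∞) ^ (q - 1) * (N • (K * (G * ENNReal.ofReal (lam ^ (-(α - ℓ)) *
            (1 / (N : ℝ)) ^ (q * (1 - 1 / p) - betaExp k (α - ℓ)))) *
          (∫⁻ t in Ioc 0 1, ‖f t‖ₑ ^ p) ^ (q / p))) := by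
        gcongr
        have := Finset.sum_le_card_nsmul _ _ _ hpiece
        rwa [Finset.card_range] at this
    _ = _ := by
        rw [ENNReal.ofReal_mul (by positivity), nsmul_eq_mul]
        have : ENNReal.ofReal ((1 / (N : ℝ)) ^ (q * (1 - 1 / p) - betaExp k (α - ℓ)))
          = (((1 / (N : ℝ)) ^ (q * (1 - 1 / p) - betaExp k (α - ℓ))).toNNReal : ℝ≥0∞) := rfl
        rw [this]
        push_cast [ENNReal.coe_rpow_of_nonneg _ (by linarith : 0 ≤ q - 1)]
        ring

end Scales

/-! ### From power integrals to L^p norms. -/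

section Extension

theorem measure_ball_le_growthConst {d : ℕ} (α : ℝ) (μ : Measure (EuclideanSpace ℝ (Fin d)))
    (x : EuclideanSpace ℝ (Fin d)) (r : ℝ) (hr : 0 < r) :
    μ (Metric.ball x r) ≤ growthConst α μ * ENNReal.ofReal (r ^ α) := by
  have h1 : ENNReal.ofReal (r ^ (-α)) * μ (Metric.ball x r) ≤ growthConst α μ :=
    le_iSup_of_le x (le_iSup_of_le r (le_iSup_of_le hr le_rfl))
  calc μ (Metric.ball x r)
      = ENNReal.ofReal (r ^ (-α)) * μ (Metric.ball x r) * ENNReal.ofReal (r ^ α) := by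
        rw [mul_right_comm, ← ENNReal.ofReal_mul (by positivity), ← Real.rpow_add hr,
          neg_add_cancel, Real.rpow_zero, ENNReal.ofReal_one, one_mul]
    _ ≤ _ := by gcongr

theorem enorm_oscOp_le {d : ℕ} {γ : ℝ → EuclideanSpace ℝ (Fin d)}
    {a : EuclideanSpace ℝ (Fin d) → ℂ} (ha : ∀ x, ‖a x‖ ≤ 1) (lam : ℝ) {f g : ℝ → ℂ}
    (hfg : f =ᵐ[volume.restrict (Icc (0 : ℝ) 1)] g) (x : EuclideanSpace ℝ (Fin d)) :
    ‖oscOp γ a lam f x‖ₑ ≤ ‖oscInt γ lam g 0 1 x‖ₑ := by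
  have h1 : ‖a x‖ₑ ≤ 1 := by
    rw [← ofReal_norm, ← ENNReal.ofReal_one]
    exact ENNReal.ofReal_le_ofReal (ha x)
  have h2 : ∫ t in Icc (0 : ℝ) 1, Complex.exp (Complex.I * ((lam * inner ℝ x (γ t) : ℝ) : ℂ)) * f t
      = ∫ t in Icc (0 : ℝ) 1, Complex.exp (Complex.I * ((lam * inner ℝ x (γ t) : ℝ) : ℂ)) * g t :=
    integral_congr_ae (hfg.mono fun t ht => by simp only [ht])
  rw [oscOp, oscInt, intervalIntegral.integral_of_le zero_le_one, ← integral_Icc_eq_integral_Ioc,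
    enorm_mul, h2]
  exact mul_le_of_le_one_left' h1

theorem enorm_oscOp_le_eLpNorm {d : ℕ} {γ : ℝ → EuclideanSpace ℝ (Fin d)}
    {a : EuclideanSpace ℝ (Fin d) → ℂ} (ha : ∀ x, ‖a x‖ ≤ 1) (lam : ℝ) (f : ℝ → ℂ)
    (x : EuclideanSpace ℝ (Fin d)) :
    ‖oscOp γ a lam f x‖ₑ ≤ eLpNorm f 1 (volume.restrict (Icc (0 : ℝ) 1)) := by
  refine (enorm_oscOp_le ha lam (ae_eq_refl f) x).trans ?_
  rw [oscInt, intervalIntegral.integral_of_le zero_le_one, ← integral_Icc_eq_integral_Ioc,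
    eLpNorm_one_eq_lintegral_enorm]
  refine (enorm_integral_le_lintegral_enorm _).trans (lintegral_mono fun t => ?_)
  rw [enorm_mul, ← ofReal_norm, norm_exp_I_mul, ENNReal.ofReal_one, one_mul]

/-- Lowering the exponent `p` to a finite one not exceeding `q`. -/
theorem exists_exponent_le {k β : ℝ} (hk : 1 ≤ k) (hβ : 0 < β) {p : ℝ≥0∞} (hp : 1 ≤ p) {q : ℝ}
    (hkq : 2 * k ≤ q) (hβq : β + 1 < q) (h₁ : k / q + (1 / p).toReal ≤ 1)
    (h₂ : β / q + (1 / p).toReal < 1) :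
    ∃ s : ℝ, 1 < s ∧ s ≤ q ∧ k / q + 1 / s ≤ 1 ∧ β / q + 1 / s < 1 ∧ ENNReal.ofReal s ≤ p := by
  have hq0 : 0 < q := by linarith
  by_cases hpq : p ≤ ENNReal.ofReal q
  · have hpt : p ≠ ∞ := (hpq.trans_lt ENNReal.ofReal_lt_top).ne
    have e : (1 / p).toReal = 1 / p.toReal := by simp
    rw [e] at h₁ h₂
    have hp0 : 0 < p.toReal := ENNReal.toReal_pos (by positivity) hpt
    refine ⟨p.toReal, ?_, ENNReal.toReal_le_of_le_ofReal hq0.le hpq, h₁, h₂,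
      (ENNReal.ofReal_toReal hpt).le⟩
    have : 0 < β / q := by positivity
    have h3 : 1 / p.toReal < 1 := by linarith
    rwa [div_lt_one hp0] at h3
  -- When p > q the exponent q itself works: k + 1 ≤ 2k ≤ q gives the first condition, and β + 1 < q
  -- the second.
  · refine ⟨q, by linarith, le_rfl, ?_, ?_, (not_le.1 hpq).le⟩
    · rw [← add_div, div_le_one hq0]
      linarith
    · rwa [← add_div, div_lt_one hq0]

/-- The function f is replaced by a measurable representative on [0,1], the amplitude is dropped
because |a| ≤ 1, and q-th roots are taken. -/
theorem IsNondegenerateCurve.exists_eLpNorm_bound {k ℓ : ℕ} {α : ℝ} (hα : 0 < α)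
    (hℓ : ⌊((k + ℓ : ℕ) : ℝ) - α⌋₊ + 1 ≤ k) {γ : ℝ → EuclideanSpace ℝ (Fin (k + ℓ))}
    (hγ : IsNondegenerateCurve γ) {p q : ℝ} (hp : 1 < p) (hpq : p ≤ q) (hkq : 2 * k ≤ q)
    (h₁ : k / q + 1 / p ≤ 1) (h₂ : betaExp k (α - ℓ) / q + 1 / p < 1) :
    ∃ C : ℝ≥0, ∀ {μ : Measure (EuclideanSpace ℝ (Fin (k + ℓ)))},
      μ (Metric.closedBall 0 1)ᶜ = 0 → ∀ {a : EuclideanSpace ℝ (Fin (k + ℓ)) → ℂ},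
      (∀ x, ‖a x‖ ≤ 1) → ∀ {lam : ℝ}, 1 ≤ lam → ∀ {f : ℝ → ℂ},
      MemLp f (ENNReal.ofReal p) (volume.restrict (Icc (0 : ℝ) 1)) →
      eLpNorm (oscOp γ a lam f) (ENNReal.ofReal q) μ
        ≤ C * growthConst α μ ^ (1 / q) * ENNReal.ofReal (lam ^ (-((α - ℓ) * (1 / q))))
          * eLpNorm f (ENNReal.ofReal p) (volume.restrict (Icc (0 : ℝ) 1)) := by
  obtain ⟨K, hK⟩ := hγ.exists_lintegral_bound hα hℓ hp hpq hkq h₁ h₂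
  have hp0 : 0 < p := by linarith
  have hq0 : 0 < q := by linarith
  refine ⟨K ^ (1 / q), fun {μ} hsupp {a} ha {lam} hlam {f} hf => ?_⟩
  have hlam0 : 0 < lam := by linarith
  set g := hf.1.mk f with hg
  have hfg : f =ᵐ[volume.restrict (Icc (0 : ℝ) 1)] g := hf.1.ae_eq_mk
  have hgm : Measurable g := hf.1.stronglyMeasurable_mk.measurable
  have hgp : MemLp g (ENNReal.ofReal p) (volume.restrict (Icc (0 : ℝ) 1)) := hf.ae_eq hfg
  have hset : (volume : Measure ℝ).restrict (Icc 0 1) = volume.restrict (Ioc 0 1) :=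
    Measure.restrict_congr_set Ioc_ae_eq_Icc.symm
  have hnorm : ∀ {r : ℝ}, 0 < r → ∀ {X : Type} [MeasurableSpace X] (ν : Measure X) (u : X → ℂ),
      eLpNorm u (ENNReal.ofReal r) ν = (∫⁻ t, ‖u t‖ₑ ^ r ∂ν) ^ (1 / r) := by
    intro r hr X _ ν u
    rw [eLpNorm_eq_lintegral_rpow_enorm_toReal (by simpa using hr) ENNReal.ofReal_ne_top,
      ENNReal.toReal_ofReal hr.le]
  have hint : IntegrableOn g (Ioc 0 1) := by
    rw [IntegrableOn, ← hset]
    exact hgp.integrable (by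
      rw [← ENNReal.ofReal_one]
      exact ENNReal.ofReal_le_ofReal hp.le)
  have hfin : ∫⁻ t in Ioc 0 1, ‖g t‖ₑ ^ p ≠ ∞ := by
    have h3 := hgp.2
    rw [hnorm hp0, hset, ENNReal.rpow_lt_top_iff_of_pos (by positivity)] at h3
    exact h3.ne
  rw [eLpNorm_congr_ae hfg, hnorm hp0, hnorm hq0, hset]
  calc _ ≤ (∫⁻ x, ‖oscInt γ lam g 0 1 x‖ₑ ^ q ∂μ) ^ (1 / q) := by
        gcongr with x
        exact enorm_oscOp_le ha lam hfg x
    _ ≤ (K * (growthConst α μ * ENNReal.ofReal (lam ^ (-(α - ℓ)))) *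
          (∫⁻ t in Ioc 0 1, ‖g t‖ₑ ^ p) ^ (q / p)) ^ (1 / q) := by
        gcongr
        exact hK (measure_ball_le_growthConst α μ) hsupp hlam hgm hint hfin
    _ = _ := by
        have h0 : 0 ≤ 1 / q := by positivity
        rw [ENNReal.mul_rpow_of_nonneg _ _ h0, ENNReal.mul_rpow_of_nonneg _ _ h0,
          ENNReal.mul_rpow_of_nonneg _ _ h0, ENNReal.ofReal_rpow_of_pos (by positivity),
          ← Real.rpow_mul hlam0.le, ← ENNReal.rpow_mul, ENNReal.coe_rpow_of_nonneg _ h0, neg_mul,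
          ← mul_assoc]
        congr 2
        field_simp

end Extension

/-! ### The main theorem. -/

theorem theorem2p1 (d : ℕ) (hd : 3 ≤ d) (α : ℝ) (hα : 0 < α) (hαd : α ≤ d)
    (γ : ℝ → EuclideanSpace ℝ (Fin d)) (hγ : IsNondegenerateCurve γ)
    (ℓ : ℕ) (hℓ : ℓ + 1 + ⌊(d : ℝ) - α⌋₊ ≤ d)
    (p q : ℝ≥0∞) (hp : 1 ≤ p)
    (h₁ : ((d : ℝ) - ℓ) * (1 / q).toReal + (1 / p).toReal ≤ 1)
    (h₂ : ENNReal.ofReal (2 * ((d : ℝ) - ℓ)) ≤ q)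
    (h₃ : betaExp (d - ℓ) (α - ℓ) * (1 / q).toReal + (1 / p).toReal < 1)
    (h₄ : ENNReal.ofReal (betaExp (d - ℓ) (α - ℓ) + 1) < q) :
    ∃ C : ℝ≥0, ∀ (μ : Measure (EuclideanSpace ℝ (Fin d))),
      μ (Metric.closedBall 0 1)ᶜ = 0 → HasGrowth α μ →
      ∀ (a : EuclideanSpace ℝ (Fin d) → ℂ), Measurable a →
        (∀ x, ‖a x‖ ≤ 1) → Function.support a ⊆ Metric.closedBall 0 1 →
      ∀ (lam : ℝ), 1 ≤ lam →
      ∀ (f : ℝ → ℂ), MemLp f p (volume.restrict (Icc (0 : ℝ) 1)) →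
        eLpNorm (oscOp γ a lam f) q μ
          ≤ (C : ℝ≥0∞) * growthConst α μ ^ (1 / q).toReal
            * ENNReal.ofReal (lam ^ (-((α - ℓ) * (1 / q).toReal)))
            * eLpNorm f p (volume.restrict (Icc (0 : ℝ) 1)) := by
  have hprob : IsProbabilityMeasure ((volume : Measure ℝ).restrict (Icc 0 1)) := ⟨by simp⟩
  obtain ⟨k, rfl⟩ := Nat.exists_eq_add_of_le' (show ℓ ≤ d by omega)
  have hℓk : ⌊((k + ℓ : ℕ) : ℝ) - α⌋₊ + 1 ≤ k := by omega
  have hkc : ((k + ℓ : ℕ) : ℝ) - ℓ = k := by push_cast; ring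
  rw [hkc] at h₁ h₂
  rw [Nat.add_sub_cancel] at h₃ h₄
  have hβ := betaExp_pos hℓk
  have hk1 : (1 : ℝ) ≤ k := by exact_mod_cast (by omega : 1 ≤ k)
  -- For q = ∞ all powers of ⟨μ⟩_α and λ have exponent zero, and the claim is the trivial L¹ bound.
  rcases eq_or_ne q ∞ with rfl | hq
  · refine ⟨1, fun μ _ _ a _ ha _ lam _ f hf => ?_⟩
    simp only [ENNReal.div_top, ENNReal.toReal_zero, ENNReal.rpow_zero, mul_zero, neg_zero,
      Real.rpow_zero, ENNReal.ofReal_one, ENNReal.coe_one, one_mul, eLpNorm_exponent_top]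
    exact eLpNormEssSup_le_of_ae_enorm_bound (Filter.Eventually.of_forall fun x =>
      (enorm_oscOp_le_eLpNorm ha lam f x).trans (eLpNorm_le_eLpNorm_of_exponent_le hp hf.1))
  · obtain ⟨s, rfl⟩ : ∃ s : ℝ, q = ENNReal.ofReal s := ⟨_, (ENNReal.ofReal_toReal hq).symm⟩
    have h₄' : betaExp k (α - ℓ) + 1 < s := (ENNReal.ofReal_lt_ofReal_iff_of_nonneg
      (by linarith)).1 h₄
    have hs0 : 0 < s := by linarith
    have h₂' : 2 * (k : ℝ) ≤ s := (ENNReal.ofReal_le_ofReal_iff hs0.le).1 h₂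
    have e : (1 / ENNReal.ofReal s).toReal = 1 / s := by simp [hs0.le]
    rw [e, mul_one_div] at h₁ h₃
    rw [e]
    -- The estimate is proved with a finite exponent r ≤ min(p, q), and the L^r norm on the
    -- probability space [0,1] is at most the L^p norm.
    obtain ⟨r, hr1, hrs, hr₁, hr₂, hrp⟩ := exists_exponent_le hk1 hβ hp h₂' h₄' h₁ h₃
    obtain ⟨C, hC⟩ := hγ.exists_eLpNorm_bound hα hℓk hr1 hrs h₂' hr₁ hr₂
    refine ⟨C, fun μ hsupp _ a _ ha _ lam hlam f hf => ?_⟩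
    refine (hC hsupp ha hlam (hf.mono_exponent hrp)).trans ?_
    gcongr
    exact eLpNorm_le_eLpNorm_of_exponent_le hrp hf.1
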